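/- Let $(X,\mathsf d,\mathfrak m)$ be a complete geodesic metric measure space, let $\mathrm{Geo}(X)$ be its space of constant speed minimizing geodesics $\gamma:[0,1]\to X$, with evaluation maps $\mathrm e_t(\gamma)=\gamma_t$, and let $\mathrm{OptGeo}(\mu_0,\mu_1)$ be the set of Borel probability measures $\pi$ on $\mathrm{Geo}(X)$ such that $(\mathrm e_0,\mathrm e_1)_\#\pi$ is an optimal coupling of $\mu_0$ and $\mu_1$ for the cost $\mathsf d^2$. Write $\mu_t=(\mathrm e_t)_\#\pi=\rho_t\mathfrak m+\mu_t^s$ with $\mu_t^s\perp\mathfrak m$. For $K\in\mathbb R$ and $N\in[1,\infty)$ put $\sigma^{(t)}_{K,N}(\theta)=+\infty$ if $K\theta^2\ge N\pi^2$, $\;\sin(t\theta\sqrt{K/N})/\sin(\theta\sqrt{K/N})$ if $0<K\theta^2<N\pi^2$, $\;t$ if $K\theta^2=0$, and $\sinh(t\theta\sqrt{-K/N})/\sinh(\theta\sqrt{-K/N})$ if $K\theta^2<0$. Put $\tau^{(t)}_{K,N}(\theta)=t$ if $K\theta^2=0$, or if $K\theta^2<0$ and $N=1$; otherwise $\tau^{(t)}_{K,N}(\theta)=+\infty$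 if $K\theta^2\ge (N-1)\pi^2$, and $\tau^{(t)}_{K,N}(\theta)=t^{1/N}\sigma^{(t)}_{K,N-1}(\theta)^{1-1/N}$ in the remaining cases. The space satisfies $\mathsf{CD}^*(K,N)$ if for all Borel probability measures $\mu_0,\mu_1$ with bounded supports contained in $\operatorname{supp}\mathfrak m$ there is $\pi\in\mathrm{OptGeo}(\mu_0,\mu_1)$ such that for all $t\in[0,1]$ and all $N'\ge N$ $$-\int\rho_t^{1-\frac1{N'}}\,d\mathfrak m\le-\int\Big(\sigma^{(1-t)}_{K,N'}(\mathsf d(\gamma_0,\gamma_1))\,\rho_0(\gamma_0)^{-\frac1{N'}}+\sigma^{(t)}_{K,N'}(\mathsf d(\gamma_0,\gamma_1))\,\rho_1(\gamma_1)^{-\frac1{N'}}\Big)\,d\pi(\gamma),$$ where $\rho_i^{-1/N'}$ is read as $0$ on the singular part of $\mu_i$. It satisfies $\mathsf{CD}(K,N)$ if this holds with $\tau$ in place of $\sigma$. It satisfies $\mathsf{CD}(K,\infty)=\mathsf{CD}^*(K,\infty)$ if for all such $\mu_0,\mu_1$ there is $\pi\in\mathrm{OptGeo}(\mu_0,\mu_1)$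 with $\mathrm{Ent}(\mu_t)\le(1-t)\mathrm{Ent}(\mu_0)+t\,\mathrm{Ent}(\mu_1)-\frac K2t(1-t)W_2^2(\mu_0,\mu_1)$ for all $t\in[0,1]$, where $\mathrm{Ent}(\rho\mathfrak m)=\int\rho\log\rho\,d\mathfrak m$ and $\mathrm{Ent}(\mu)=+\infty$ if $\mu\not\ll\mathfrak m$. It satisfies $\mathsf{CD}(0,4)$ locally if each $x\in X$ has a radius $r>0$ such that for all Borel probability measures $\mu_0,\mu_1$ with supports in $B(x,r)$ there is $\pi\in\mathrm{OptGeo}(\mu_0,\mu_1)$ satisfying the defining inequality of $\mathsf{CD}(0,4)$ for all $t\in[0,1]$ and $N'\ge4$. Subsets of $\mathbb R^2$ carry the $l^\infty$-distance and the restricted Lebesgue measure. (1) For every $K\in\mathbb R$ and $N\in[1,\infty]$ there is a compact non-convex set $X\subset\mathbb R^2$ which is geodesic and satisfies $\mathsf{CD}(0,4)$ locally, but satisfies neither $\mathsf{CD}^*(K,N)$ nor $\mathsf{CD}(K,N)$. Moreover, $X$ can be chosen so that near some boundary point it coincides with the complement of an open Euclidean disc whose boundary circle passes through that point (a circular arc),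 and so that it has a neck: it contains two non-degenerate rectangles $[a,a+w]\times[y,y+h]$ and $[a+l,a+l+w]\times[y,y+h]$, and some vertical line $\{x=x_0\}$ with $a+w<x_0<a+l$ meets $X$ exactly in a non-degenerate segment of length less than $h$. (2) Infinitely many such pieces can be glued to a complete, non-compact geodesic space that satisfies $\mathsf{CD}(0,4)$ locally and fails $\mathsf{CD}(K,N)$ for every $K\in\mathbb R$ and every $N\in[1,\infty]$. Precisely, there are reals $a_0<a_1<\dots$ and sets $P_0,P_1,\dots\subset\mathbb R^2$, each with all the properties in (1) for some $K$ and $N$ depending on the set, such that $P_n\subset[a_n,a_{n+1}]\times\mathbb R$, $P_n\cap P_{n+1}$ is a non-degenerate segment of the line $\{x=a_{n+1}\}$, and $\bigcup_nP_n$ is such a space. -/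

import Mathlib

open MeasureTheory Set
open scoped ENNReal

noncomputable section

/-- Constant speed minimizing geodesics `γ : [0,1] → X`, with the topology of uniform convergence. -/
def Geo (X : Type*) [MetricSpace X] : Type _ :=
  {γ : C(unitInterval, X) //
    ∀ s t : unitInterval, dist (γ s) (γ t) = |(s : ℝ) - (t : ℝ)| * dist (γ 0) (γ 1)}

instance (X : Type*) [MetricSpace X] : TopologicalSpace (Geo X) :=
  instTopologicalSpaceSubtype

/-- `Geo X` carries its Borel σ-algebra. -/
instance (X : Type*) [MetricSpace X] : MeasurableSpace (Geo X) := borel (Geo X)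

instance (X : Type*) [MetricSpace X] : BorelSpace (Geo X) := ⟨rfl⟩

/-- The evaluation map `e_t : Geo X → X`. -/
def Geo.eval {X : Type*} [MetricSpace X] (t : unitInterval) (γ : Geo X) : X := γ.1 t

/-- `X` is a geodesic space. -/
def IsGeodesicSpace (X : Type*) [MetricSpace X] : Prop :=
  ∀ x y : X, ∃ γ : Geo X, γ.eval 0 = x ∧ γ.eval 1 = y

/-- `γ` is a measure on `X × X` with marginals `μ₀` and `μ₁`. -/
def IsCoupling {X : Type*} [MeasurableSpace X] (γ : Measure (X × X)) (μ₀ μ₁ : Measure X) : Prop :=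
  γ.map Prod.fst = μ₀ ∧ γ.map Prod.snd = μ₁

/-- The cost `∫ d(x,y)² dγ(x,y)`. -/
def quadCost {X : Type*} [MetricSpace X] [MeasurableSpace X] (γ : Measure (X × X)) : ℝ≥0∞ :=
  ∫⁻ p, edist p.1 p.2 ^ 2 ∂γ

/-- The squared transportation distance `W₂²(μ₀, μ₁)`. -/
def W2sq {X : Type*} [MetricSpace X] [MeasurableSpace X] (μ₀ μ₁ : Measure X) : ℝ≥0∞ :=
  ⨅ (γ : Measure (X × X)) (_ : IsCoupling γ μ₀ μ₁), quadCost γ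

/-- `π ∈ OptGeo(μ₀, μ₁)`: `π` is a probability measure on geodesics such that `(e₀, e₁)_# π` is an
optimal coupling of `μ₀` and `μ₁`. -/
def IsOptGeo {X : Type*} [MetricSpace X] [MeasurableSpace X]
    (π : Measure (Geo X)) (μ₀ μ₁ : Measure X) : Prop :=
  IsProbabilityMeasure π ∧
    IsCoupling (π.map fun γ => (γ.eval 0, γ.eval 1)) μ₀ μ₁ ∧
    quadCost (π.map fun γ => (γ.eval 0, γ.eval 1)) = W2sq μ₀ μ₁

/-- The distortion coefficient `σ_{K,N}^{(t)}(θ)`. -/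
def sigmaCoeff (K N t θ : ℝ) : ℝ≥0∞ :=
  if N * Real.pi ^ 2 ≤ K * θ ^ 2 then ⊤
  else if 0 < K * θ ^ 2 then
    ENNReal.ofReal (Real.sin (t * θ * √(K / N)) / Real.sin (θ * √(K / N)))
  else if K * θ ^ 2 = 0 then ENNReal.ofReal t
  else ENNReal.ofReal (Real.sinh (t * θ * √(-K / N)) / Real.sinh (θ * √(-K / N)))

/-- The distortion coefficient `τ_{K,N}^{(t)}(θ)`, which is
`t ^ (1/N) * σ_{K,N-1}^{(t)}(θ) ^ (1 - 1/N)` with the usual conventions in the limiting cases. -/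
def tauCoeff (K N t θ : ℝ) : ℝ≥0∞ :=
  if K * θ ^ 2 = 0 ∨ (K * θ ^ 2 < 0 ∧ N = 1) then ENNReal.ofReal t
  else if (N - 1) * Real.pi ^ 2 ≤ K * θ ^ 2 then ⊤
  else ENNReal.ofReal (t ^ (1 / N)) * sigmaCoeff K (N - 1) t θ ^ (1 - 1 / N)

/-- The integral `∫ ρ^(1 - 1/N) dm` where `μ = ρ m + μˢ` is the Lebesgue decomposition. The
restriction to `{ρ ≠ 0}` only matters for `N = 1`, where it gives `m {ρ > 0}`. -/
def renyi {X : Type*} [MeasurableSpace X] (m : Measure X) (N : ℝ) (μ : Measure X) : ℝ≥0∞ :=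
  ∫⁻ x in {x | μ.rnDeriv m x ≠ 0}, μ.rnDeriv m x ^ (1 - 1 / N) ∂m

/-- The function `ρ^(-1/N)` where `μ = ρ m + μˢ` is the Lebesgue decomposition, as a function defined
`μ`-almost everywhere. `dm/dμ` is `1/ρ` almost everywhere for the absolutely continuous part of `μ`
(see `MeasureTheory.Measure.inv_rnDeriv`), and `0` almost everywhere for the singular part of `μ`,
where the density is understood to be infinite. -/
def invDensityPow {X : Type*} [MeasurableSpace X] (m : Measure X) (N : ℝ) (μ : Measure X) (x : X) :
    ℝ≥0∞ :=
  m.rnDeriv μ x ^ (1 / N)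

/-- The inequality defining the curvature-dimension conditions, along `π`, for all `t ∈ [0,1]` and all
`N' ≥ N`, with distortion coefficients `w N' t θ`. Both sides of
`-∫ ρ_t^(1 - 1/N') dm ≤ -∫ w^(1-t) ρ₀^(-1/N') + w^(t) ρ₁^(-1/N') dπ`
have been multiplied by `-1`, and are then integrals of nonnegative functions. -/
def CDInequality {X : Type*} [MetricSpace X] [MeasurableSpace X] (w : ℝ → ℝ → ℝ → ℝ≥0∞)
    (m : Measure X) (N : ℝ) (μ₀ μ₁ : Measure X) (π : Measure (Geo X)) : Prop :=
  ∀ t : unitInterval, ∀ N' : ℝ, N ≤ N' →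
    ∫⁻ γ, w N' (1 - t) (dist (γ.eval 0) (γ.eval 1)) * invDensityPow m N' μ₀ (γ.eval 0)
        + w N' t (dist (γ.eval 0) (γ.eval 1)) * invDensityPow m N' μ₁ (γ.eval 1) ∂π
      ≤ renyi m N' (π.map (Geo.eval t))

/-- The curvature-dimension condition with distortion coefficients `w` and finite dimension bound
`N`. -/
def IsCDWith {X : Type*} [MetricSpace X] [MeasurableSpace X] (w : ℝ → ℝ → ℝ → ℝ≥0∞)
    (m : Measure X) (N : ℝ) : Prop :=
  ∀ μ₀ μ₁ : Measure X, IsProbabilityMeasure μ₀ → IsProbabilityMeasure μ₁ →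
    Bornology.IsBounded μ₀.support → Bornology.IsBounded μ₁.support →
    μ₀.support ⊆ m.support → μ₁.support ⊆ m.support →
    ∃ π : Measure (Geo X), IsOptGeo π μ₀ μ₁ ∧ CDInequality w m N μ₀ μ₁ π

/-- The local curvature-dimension condition with distortion coefficients `w` and finite dimension
bound `N`: every point has a ball such that measures supported in the ball are joined by a good
geodesic. The geodesic may leave the ball. -/
def IsCDWithLocally {X : Type*} [MetricSpace X] [MeasurableSpace X] (w : ℝ → ℝ → ℝ → ℝ≥0∞)
    (m : Measure X) (N : ℝ) : Prop :=
  ∀ x : X, ∃ r : ℝ, 0 < r ∧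
    ∀ μ₀ μ₁ : Measure X, IsProbabilityMeasure μ₀ → IsProbabilityMeasure μ₁ →
      μ₀.support ⊆ Metric.ball x r → μ₁.support ⊆ Metric.ball x r →
      ∃ π : Measure (Geo X), IsOptGeo π μ₀ μ₁ ∧ CDInequality w m N μ₀ μ₁ π

open Classical in
/-- The entropy `∫ ρ log ρ dm` if `μ = ρ m`, and `+∞` if `μ` is not absolutely continuous. It is the
integral of the positive part minus that of the negative part, and `+∞` if the former is infinite. -/
def entInfty {X : Type*} [MeasurableSpace X] (m μ : Measure X) : EReal :=
  if μ.AbsolutelyContinuous m ∧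
      ∫⁻ x, ENNReal.ofReal ((μ.rnDeriv m x).toReal * Real.log (μ.rnDeriv m x).toReal) ∂m ≠ ⊤ then
    ((∫⁻ x, ENNReal.ofReal
        ((μ.rnDeriv m x).toReal * Real.log (μ.rnDeriv m x).toReal) ∂m : ℝ≥0∞) : EReal)
      - ((∫⁻ x, ENNReal.ofReal
        (-((μ.rnDeriv m x).toReal * Real.log (μ.rnDeriv m x).toReal)) ∂m : ℝ≥0∞) : EReal)
  else ⊤

/-- The condition `CD(K,∞)`. `W₂` is finite for measures with bounded supports. -/
def IsCDInfty {X : Type*} [MetricSpace X] [MeasurableSpace X] (m : Measure X) (K : ℝ) : Prop :=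
  ∀ μ₀ μ₁ : Measure X, IsProbabilityMeasure μ₀ → IsProbabilityMeasure μ₁ →
    Bornology.IsBounded μ₀.support → Bornology.IsBounded μ₁.support →
    μ₀.support ⊆ m.support → μ₁.support ⊆ m.support →
    ∃ π : Measure (Geo X), IsOptGeo π μ₀ μ₁ ∧
      ∀ t : unitInterval,
        entInfty m (π.map (Geo.eval t)) ≤
          ((1 - (t : ℝ) : ℝ) : EReal) * entInfty m μ₀ + ((t : ℝ) : EReal) * entInfty m μ₁
            - ((K / 2 * (t : ℝ) * (1 - (t : ℝ)) * (W2sq μ₀ μ₁).toReal : ℝ) : EReal)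

/-- The condition `CD(K,N)`, for `K` real and `N ∈ [1,∞]`. -/
def IsCD {X : Type*} [MetricSpace X] [MeasurableSpace X] (m : Measure X) (K : ℝ) (N : ℝ≥0∞) :
    Prop :=
  (N = ⊤ → IsCDInfty m K) ∧ (N ≠ ⊤ → IsCDWith (tauCoeff K) m N.toReal)

/-- The reduced condition `CD*(K,N)`, for `K` real and `N ∈ [1,∞]`; `CD*(K,∞)` is `CD(K,∞)`. -/
def IsCDStar {X : Type*} [MetricSpace X] [MeasurableSpace X] (m : Measure X) (K : ℝ) (N : ℝ≥0∞) :
    Prop :=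
  (N = ⊤ → IsCDInfty m K) ∧ (N ≠ ⊤ → IsCDWith (sigmaCoeff K) m N.toReal)

/-- The space satisfies `CD(K,N)` locally, `N ∈ [1,∞)`. -/
def IsCDLocally {X : Type*} [MetricSpace X] [MeasurableSpace X] (m : Measure X) (K N : ℝ) : Prop :=
  IsCDWithLocally (tauCoeff K) m N

/-- The Lebesgue measure of the plane restricted to `X`, as a measure on the subspace `X`. The
distance of `ℝ × ℝ`, and so of its subspaces, is the one of the `l^∞`-norm. -/
def lebesgueOn (X : Set (ℝ × ℝ)) : Measure X :=
  (volume : Measure (ℝ × ℝ)).comap Subtype.val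

/-- Near some boundary point, `X` is the outside of a round open disc. -/
def HasCircularArc (X : Set (ℝ × ℝ)) : Prop :=
  ∃ (c p : ℝ × ℝ) (R r : ℝ), 0 < R ∧ 0 < r ∧ (p.1 - c.1) ^ 2 + (p.2 - c.2) ^ 2 = R ^ 2 ∧
    ∀ q ∈ Metric.ball p r, q ∈ X ↔ R ^ 2 ≤ (q.1 - c.1) ^ 2 + (q.2 - c.2) ^ 2

/-- `X` contains two rectangles of height `h` that are horizontal translates of each other, and some
vertical line strictly between them meets `X` in a segment of length less than `h`. -/
def HasNeck (X : Set (ℝ × ℝ)) : Prop :=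
  ∃ a l w y h x c d : ℝ, 0 < w ∧ 0 < h ∧ a + w < x ∧ x < a + l ∧ c < d ∧ d - c < h ∧
    Icc a (a + w) ×ˢ Icc y (y + h) ⊆ X ∧
    Icc (a + l) (a + l + w) ×ˢ Icc y (y + h) ⊆ X ∧
    {p | p ∈ X ∧ p.1 = x} = {x} ×ˢ Icc c d

/-- `X` is a compact, non-convex subset of the plane with a circular arc and a neck that, with the
`l^∞`-distance and the Lebesgue measure, is geodesic and satisfies `CD(0,4)` locally, but neither
`CD*(K,N)` nor `CD(K,N)`. -/
structure IsNeckExample (K : ℝ) (N : ℝ≥0∞) (X : Set (ℝ × ℝ)) : Prop where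
  isCompact : IsCompact X
  not_convex : ¬ Convex ℝ X
  hasCircularArc : HasCircularArc X
  hasNeck : HasNeck X
  isGeodesic : IsGeodesicSpace X
  locally_cd : IsCDLocally (lebesgueOn X) 0 4
  not_cdStar : ¬ IsCDStar (lebesgueOn X) K N
  not_cd : ¬ IsCD (lebesgueOn X) K N

end

/-!
The examples are cut out of the strip `ℝ × [0, 1]`. For every `n` an open Euclidean disc is removed,
centred below the axis over `2 n + 1`, of radius `5 ρ` and at depth `4 ρ` with `ρ = discH n` tending
to `0`. The part over `[2 n, 2 n + 2]` is the compact piece `discPiece n`, and the part over `[0, ∞)`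
is the union of the pieces. Where the circle bounds the set its slope is at most `3 / 4`, so that the
complement of the disc is invariant under upward displacements in the cone of slope `3 / 4`
(`discCompl_cone`). For the `l^∞`-distance vertical motion is free as long as it is not faster than
the horizontal one, hence points can be joined by geodesics that first climb and then descend
(`arch`, `isGeodesicSpace_discStrip`).

**The local condition.** Two nearby points whose displacement is mainly horizontal are joined by the
segment between them, pushed upwards by a multiple of `t (1 - t)` (`curveY`, `interp`). A push of the
order of the square of the displacement is enough to keep the curve outside the disc
(`interp_mem_discCompl`). Such a push distorts areas to second order, which would destroy
nonnegative curvature, but it is allowed to grow with the height. The growth stretches the vertical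
direction and pays for the distortion: `curveY'_ge` bounds the vertical derivative below by
`((1 - t) √b + t √(1 - b))²`, where `b` and `1 - b` are the derivatives of the heights of the end
points. Hence the vertical factor of the Jacobian is concave for the power `1 / 2`, the horizontal one
is affine, and their product is concave for the power `1 / 4` (`cdMean_le_mul`): this is where the
dimension `4` comes from.

The transport plan minimizes the cost `dist²`, and among the minimizers the Euclidean cost
(`exists_isLexOptimal`). Exchanging targets shows that such a plan is monotone: where one coordinate
of the displacement dominates, this coordinate is transported monotonically, and the other one is
transported monotonically for given end points of the first (`IsLexOptimal.exists_lexMonotone`).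
On each of countably many pieces the plan is thus triangular and monotone, and the inequality
between densities follows from one-dimensional changes of variables (`map_interp_triangular_le`).
The curves of a monotone plan do not meet at intermediate times (`LexMonotone.injOn_interp`), so the
images of the pieces are disjoint and the inequalities add up (`LexMonotone.map_interp_le`). This
gives `isCDLocally_of_interp_mem`.

**The failure of the global conditions.** The uniform measures on the two rectangles of width `2 ρ`
and height `1` at both sides of a disc are translates of each other by `8 ρ`. By Jensen's inequality
all optimal geodesics between them move horizontally by exactly `8 ρ`
(`IsOptGeo.ae_dist_eq_of_translation`), so that their midpoints lie above the disc, in a region whose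
area is smaller by the factor `1 - ρ / 2` (`NeckAt.exists_measures`). The curvature `K` allows only for
a loss of order `|K| ρ²`, whatever the dimension, which is a contradiction if `16 |K| ρ < 1`
(`NeckAt.not_isCDInfty`, `NeckAt.not_isCDWith`). A single small disc therefore refutes the conditions
for a given `K`, and infinitely many discs with `ρ → 0` refute them for all `K`.
-/


open scoped ProbabilityTheory

noncomputable section

/-! ### The vertical profile of the interpolating curves -/

/-- The profile of the vertical push: `(d² - δ²)² / d²` if `|δ| ≤ |d|`, and `0` otherwise. It has
size `d²` for displacements `(d, δ)` bounded away from the diagonals, vanishes to second order on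
the diagonals, and its square root is Lipschitz in `δ`. -/
def bumpE (d δ : ℝ) : ℝ := (max (d ^ 2 - δ ^ 2) 0) ^ 2 / d ^ 2

/-- The height of the interpolating curve at time `t`, between the heights `b₀` and `b₁`, for a
horizontal displacement `d`. The straight line is pushed upwards by a multiple of `t (1 - t)` that
grows with the height `b₀ + b₁ - 2 c` relative to the reference level `c`. The rate of growth `18 k`
is the one that compensates the distortion of the push, see `curveY'_ge`. -/
def curveY (k c d b₀ b₁ t : ℝ) : ℝ :=
  (1 - t) * b₀ + t * b₁ + t * (1 - t) * (k * bumpE d (b₁ - b₀) * (1 + 18 * k * (b₀ + b₁ - 2 * c)))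

lemma bumpE_nonneg (d δ : ℝ) : 0 ≤ bumpE d δ := by unfold bumpE; positivity

lemma bumpE_le_sq (d δ : ℝ) : bumpE d δ ≤ d ^ 2 := by
  unfold bumpE
  rcases eq_or_ne d 0 with rfl | hd
  · simp
  · have h1 : max (d ^ 2 - δ ^ 2) 0 ≤ d ^ 2 := max_le (by nlinarith [sq_nonneg δ]) (sq_nonneg d)
    have h2 : 0 ≤ max (d ^ 2 - δ ^ 2) 0 := le_max_right _ _
    rw [div_le_iff₀ (by positivity)]
    nlinarith

lemma bumpE_eq_zero {d δ : ℝ} (h : |d| ≤ |δ|) : bumpE d δ = 0 := by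
  have : max (d ^ 2 - δ ^ 2) 0 = 0 := max_eq_right (by have := sq_le_sq.2 h; linarith)
  simp [bumpE, this]

lemma bumpE_of_le {d δ : ℝ} (h : |δ| ≤ |d|) : bumpE d δ = (d ^ 2 - δ ^ 2) ^ 2 / d ^ 2 := by
  have : max (d ^ 2 - δ ^ 2) 0 = d ^ 2 - δ ^ 2 :=
    max_eq_left (by have := sq_le_sq.2 h; linarith)
  simp [bumpE, this]

lemma hasDerivAt_max_zero_sq (u : ℝ) :
    HasDerivAt (fun u : ℝ => (max u 0) ^ 2) (2 * max u 0) u := by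
  rcases lt_trichotomy u 0 with h | rfl | h
  · have : (fun u : ℝ => (max u 0) ^ 2) =ᶠ[nhds u] fun _ => 0 := by
      filter_upwards [Iio_mem_nhds h] with x hx
      simp [max_eq_right (mem_Iio.1 hx).le]
    rw [max_eq_right h.le, mul_zero]
    exact (hasDerivAt_const u (0 : ℝ)).congr_of_eventuallyEq this
  · rw [hasDerivAt_iff_isLittleO]
    simp only [max_self, mul_zero, sub_zero, ne_eq, OfNat.ofNat_ne_zero, not_false_eq_true,
      zero_pow, smul_eq_mul]
    have h1 : (fun x : ℝ => max x 0 ^ 2) =O[nhds 0] fun x : ℝ => x ^ 2 := by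
      apply Asymptotics.IsBigO.of_bound 1
      filter_upwards with x
      rw [one_mul, norm_pow, norm_pow]
      gcongr
      rw [Real.norm_eq_abs, Real.norm_eq_abs, abs_of_nonneg (le_max_right _ _)]
      exact max_le (le_abs_self x) (abs_nonneg x)
    refine h1.trans_isLittleO ?_
    simpa using Asymptotics.isLittleO_pow_id (𝕜 := ℝ) (n := 2) (by norm_num)
  · have : (fun u : ℝ => (max u 0) ^ 2) =ᶠ[nhds u] fun x => x ^ 2 := by
      filter_upwards [Ioi_mem_nhds h] with x hx
      rw [max_eq_left (mem_Ioi.1 hx).le]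
    rw [max_eq_left h.le]
    refine HasDerivAt.congr_of_eventuallyEq ?_ this
    simpa using hasDerivAt_pow 2 u

/-- The derivative of `bumpE d`. -/
def bumpE' (d δ : ℝ) : ℝ := -4 * δ * max (d ^ 2 - δ ^ 2) 0 / d ^ 2

lemma hasDerivAt_bumpE (d δ : ℝ) : HasDerivAt (bumpE d) (bumpE' d δ) δ := by
  have h1 : HasDerivAt (fun δ : ℝ => d ^ 2 - δ ^ 2) (-(2 * δ)) δ := by
    simpa using (hasDerivAt_pow 2 δ).const_sub (d ^ 2)
  have h2 := ((hasDerivAt_max_zero_sq (d ^ 2 - δ ^ 2)).comp δ h1).div_const (d ^ 2)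
  refine h2.congr_deriv ?_
  simp only [bumpE']
  ring

/-- The profile is a square of a Lipschitz function, so that the square of its derivative is bounded by a
multiple of the profile itself. -/
lemma bumpE'_sq_le (d δ : ℝ) : bumpE' d δ ^ 2 ≤ 16 * bumpE d δ := by
  unfold bumpE' bumpE
  rcases eq_or_ne d 0 with rfl | hd
  · simp
  have hd2 : 0 < d ^ 2 := by positivity
  rcases le_total (d ^ 2 - δ ^ 2) 0 with h | h
  · simp [max_eq_right h]
  · rw [max_eq_left h, div_pow, mul_div_assoc', div_le_div_iff₀ (by positivity) hd2]
    have : 0 ≤ (d ^ 2 - δ ^ 2) ^ 2 * d ^ 2 * (d ^ 2 - δ ^ 2) := by positivity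
    nlinarith

/-- The derivative of the height of the interpolating curve, when `b₀` and `b₁` move with speeds
`b` and `1 - b`. -/
def curveY' (k c d b₀ b₁ t b : ℝ) : ℝ :=
  (1 - t) * b + t * (1 - b) + t * (1 - t) *
    (k * (bumpE' d (b₁ - b₀) * (1 - 2 * b)) * (1 + 18 * k * (b₀ + b₁ - 2 * c))
      + k * bumpE d (b₁ - b₀) * (18 * k))

lemma hasDerivAt_curveY {β : ℝ → ℝ} {b v : ℝ} (k c d t : ℝ) (h : HasDerivAt β b v) :
    HasDerivAt (fun v => curveY k c d (β v) (v - β v) t) (curveY' k c d (β v) (v - β v) t b) v := by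
  have h1 : HasDerivAt (fun v => v - β v) (1 - b) v := (hasDerivAt_id v).sub h
  have h2 : HasDerivAt (fun v => v - β v - β v) (1 - b - b) v := h1.sub h
  have h3 := (hasDerivAt_bumpE d (v - β v - β v)).comp v h2
  have h4 : HasDerivAt (fun v => 1 + 18 * k * (β v + (v - β v) - 2 * c)) (18 * k * (b + (1 - b))) v :=
    (((h.add h1).sub_const (2 * c)).const_mul (18 * k)).const_add 1
  have h5 := ((h.const_mul (1 - t)).add (h1.const_mul t)).add
    (((h3.const_mul k).mul h4).const_mul (t * (1 - t)))
  refine h5.congr_deriv ?_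
  simp only [curveY', Function.comp]
  ring

/-- The key inequality: the growth of the push with the height, which is of the order of
`bumpE`, compensates the distortion, because the square of the derivative of `bumpE` is of the same
order. -/
lemma curveY'_ge {k c d b₀ b₁ t b : ℝ} (hk : 0 ≤ k) (hb : 0 ≤ b) (hb' : b ≤ 1) (ht : 0 ≤ t)
    (ht' : t ≤ 1) (hc : 36 * k * |b₀ + b₁ - 2 * c| ≤ 1) :
    ((1 - t) * √b + t * √(1 - b)) ^ 2 ≤ curveY' k c d b₀ b₁ t b := by
  set p := √b with hp
  set q := √(1 - b) with hq
  have hp0 : 0 ≤ p := Real.sqrt_nonneg _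
  have hq0 : 0 ≤ q := Real.sqrt_nonneg _
  have hp2 : p ^ 2 = b := Real.sq_sqrt hb
  have hq2 : q ^ 2 = 1 - b := Real.sq_sqrt (by linarith)
  set e := bumpE d (b₁ - b₀)
  set e' := bumpE' d (b₁ - b₀)
  set m := 1 + 18 * k * (b₀ + b₁ - 2 * c) with hm
  have hm2 : m ^ 2 ≤ 9 / 4 := by
    have h1 : |18 * k * (b₀ + b₁ - 2 * c)| ≤ 1 / 2 := by
      rw [abs_mul, abs_of_nonneg (by positivity : (0 : ℝ) ≤ 18 * k)]; linarith
    have := abs_le.1 h1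
    nlinarith
  have he' : e' ^ 2 ≤ 16 * e := bumpE'_sq_le _ _
  have he : 0 ≤ e := bumpE_nonneg _ _
  set Z := k * e' * (q + p) * m with hZ
  have hZ2 : Z ^ 2 ≤ 72 * k ^ 2 * e := by
    have h1 : (q + p) ^ 2 ≤ 2 := by nlinarith [sq_nonneg (q - p)]
    have h2 : e' ^ 2 * (q + p) ^ 2 * m ^ 2 ≤ (16 * e) * 2 * (9 / 4) := by gcongr
    have : Z ^ 2 = k ^ 2 * (e' ^ 2 * (q + p) ^ 2 * m ^ 2) := by rw [hZ]; ring
    rw [this]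
    nlinarith [sq_nonneg k]
  -- A square is completed; this is where the rate of growth `18 k` of the push is needed.
  have key : 0 ≤ (q - p) ^ 2 + (q - p) * Z + 18 * k ^ 2 * e := by
    nlinarith [sq_nonneg (q - p + Z / 2)]
  have h1 : curveY' k c d b₀ b₁ t b - ((1 - t) * p + t * q) ^ 2
      = t * (1 - t) * ((q - p) ^ 2 + (q - p) * Z + 18 * k ^ 2 * e) := by
    have h12 : 1 - 2 * b = q ^ 2 - p ^ 2 := by rw [hp2, hq2]; ring
    have : curveY' k c d b₀ b₁ t b = (1 - t) * p ^ 2 + t * q ^ 2 + t * (1 - t) *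
      (k * (e' * (q ^ 2 - p ^ 2)) * m + k * e * (18 * k)) := by
      rw [← h12, hp2, hq2]; rfl
    rw [this, hZ]
    ring
  have : 0 ≤ t * (1 - t) := mul_nonneg ht (by linarith)
  nlinarith [mul_nonneg this key]

/-- The profile is Lipschitz in the vertical displacement, with a constant of the order of the
horizontal one. -/
lemma abs_bump_diff {d δ δ' : ℝ} (h : |δ| ≤ |d|) (h' : |δ'| ≤ |d|) :
    |bumpE d δ' - bumpE d δ| ≤ 4 * |d| * |δ' - δ| := by
  rcases eq_or_ne d 0 with rfl | hd
  · simp [bumpE]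
  rw [bumpE_of_le h, bumpE_of_le h']
  have hd2 : 0 < d ^ 2 := by positivity
  have h1 : (d ^ 2 - δ' ^ 2) ^ 2 / d ^ 2 - (d ^ 2 - δ ^ 2) ^ 2 / d ^ 2
      = (δ' - δ) * ((δ' + δ) * ((δ ^ 2 + δ' ^ 2 - 2 * d ^ 2) / d ^ 2)) := by
    field_simp; ring
  have h2 : |(δ ^ 2 + δ' ^ 2 - 2 * d ^ 2) / d ^ 2| ≤ 2 := by
    rw [abs_div, abs_of_pos hd2, div_le_iff₀ hd2, abs_le]
    have := sq_le_sq.2 h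
    have := sq_le_sq.2 h'
    constructor <;> nlinarith [sq_nonneg δ, sq_nonneg δ']
  have h3 : |δ' + δ| ≤ 2 * |d| := (abs_add_le _ _).trans (by linarith)
  rw [h1, abs_mul, abs_mul]
  calc |δ' - δ| * (|δ' + δ| * _) ≤ |δ' - δ| * ((2 * |d|) * 2) := by gcongr
    _ = 4 * |d| * |δ' - δ| := by ring

/-- The height of the interpolating curve is strictly increasing in the heights of the end
points. -/
lemma curveY_mono {k c d b₀ b₁ b₀' b₁' t : ℝ} (hk : 0 ≤ k) (hd : 12 * k * |d| ≤ 1)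
    (hc' : 36 * k * |b₀' + b₁' - 2 * c| ≤ 1) (ht : 0 ≤ t)
    (ht' : t ≤ 1) (h : |b₁ - b₀| ≤ |d|) (h' : |b₁' - b₀'| ≤ |d|) (h0 : b₀ ≤ b₀') (h1 : b₁ ≤ b₁') :
    ((1 - t) * (b₀' - b₀) + t * (b₁' - b₁)) / 4 ≤ curveY k c d b₀' b₁' t - curveY k c d b₀ b₁ t := by
  have hE := abs_bump_diff h h'
  set E := bumpE d (b₁ - b₀)
  set E' := bumpE d (b₁' - b₀')
  have hE0 : 0 ≤ E := bumpE_nonneg _ _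
  have hδ : |b₁' - b₀' - (b₁ - b₀)| ≤ (b₀' - b₀) + (b₁' - b₁) := by
    rw [abs_le]; constructor <;> linarith
  set S := (b₀' - b₀) + (b₁' - b₁) with hS
  have hS0 : 0 ≤ S := by linarith
  set m' := 1 + 18 * k * (b₀' + b₁' - 2 * c) with hm'
  set m := 1 + 18 * k * (b₀ + b₁ - 2 * c) with hm
  have hmm : m' = m + 18 * k * S := by rw [hm, hm', hS]; ring
  have hm2 : |m'| ≤ 3 / 2 := by
    have h1 : |18 * k * (b₀' + b₁' - 2 * c)| ≤ 1 / 2 := by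
      rw [abs_mul, abs_of_nonneg (by positivity : (0 : ℝ) ≤ 18 * k)]; linarith
    have := abs_le.1 h1
    rw [abs_le]; constructor <;> linarith
  have h2 : |k * (E' - E) * m'| ≤ S / 2 := by
    rw [abs_mul, abs_mul, abs_of_nonneg hk]
    calc k * |E' - E| * |m'| ≤ k * (4 * |d| * S) * (3 / 2) := by gcongr; exact hE.trans (by gcongr)
      _ = (12 * k * |d|) * (S / 2) := by ring
      _ ≤ 1 * (S / 2) := by gcongr
      _ = S / 2 := one_mul _
  have h3 : curveY k c d b₀' b₁' t - curveY k c d b₀ b₁ t = (1 - t) * (b₀' - b₀) + t * (b₁' - b₁)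
      + t * (1 - t) * (k * (E' - E) * m' + k * E * (18 * k * S)) := by
    have : curveY k c d b₀' b₁' t - curveY k c d b₀ b₁ t = (1 - t) * (b₀' - b₀) + t * (b₁' - b₁)
      + t * (1 - t) * (k * E' * m' - k * E * m) := by
      simp only [curveY]; ring
    rw [this, hmm]; ring
  have h4 : 0 ≤ k * E * (18 * k * S) := by positivity
  have h5 := (abs_le.1 h2).1
  have htt : 0 ≤ t * (1 - t) := mul_nonneg ht (by linarith)
  have h6 : t * (1 - t) * (-(S / 2)) ≤ t * (1 - t) * (k * (E' - E) * m' + k * E * (18 * k * S)) := by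
    gcongr; linarith
  have h7 : t * (1 - t) * (b₀' - b₀) ≤ (1 - t) * (b₀' - b₀) := by
    have : 0 ≤ (1 - t) * (b₀' - b₀) := mul_nonneg (by linarith) (by linarith)
    nlinarith
  have h8 : t * (1 - t) * (b₁' - b₁) ≤ t * (b₁' - b₁) := by
    have : 0 ≤ t * (b₁' - b₁) := mul_nonneg (by linarith) (by linarith)
    nlinarith
  have h9 : 0 ≤ (1 - t) * (b₀' - b₀) := mul_nonneg (by linarith) (by linarith)
  have h10 : 0 ≤ t * (b₁' - b₁) := mul_nonneg (by linarith) (by linarith)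
  rw [h3]
  rw [hS] at h6
  nlinarith

/-- The push is nonnegative, and small enough for the curve to be a geodesic. -/
lemma bump_bounds {k c d b₀ b₁ : ℝ} (hk : 0 ≤ k) (hd : 12 * k * |d| ≤ 1)
    (hc : 36 * k * |b₀ + b₁ - 2 * c| ≤ 1) (h : |b₁ - b₀| ≤ |d|) :
    0 ≤ k * bumpE d (b₁ - b₀) * (1 + 18 * k * (b₀ + b₁ - 2 * c)) ∧
    k * bumpE d (b₁ - b₀) * (1 + 18 * k * (b₀ + b₁ - 2 * c)) ≤ (|d| - |b₁ - b₀|) / 2 := by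
  set δ := b₁ - b₀
  have h1 : |18 * k * (b₀ + b₁ - 2 * c)| ≤ 1 / 2 := by
    rw [abs_mul, abs_of_nonneg (by positivity : (0 : ℝ) ≤ 18 * k)]; linarith
  obtain ⟨h2, h3⟩ := abs_le.1 h1
  have hE0 : 0 ≤ bumpE d δ := bumpE_nonneg _ _
  have hE : bumpE d δ ≤ 4 * (|d| - |δ|) * |d| := by
    rcases eq_or_ne d 0 with rfl | hd
    · simp [bumpE]
    rw [bumpE_of_le h, div_le_iff₀ (by positivity), ← sq_abs d, ← sq_abs δ]
    have ha := abs_nonneg δ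
    have hb : 0 < |d| := abs_pos.2 hd
    set a := |δ|
    set D := |d|
    have : (D ^ 2 - a ^ 2) ^ 2 = (D - a) * ((D - a) * (D + a) ^ 2) := by ring
    rw [this, mul_comm 4, mul_assoc, mul_assoc]
    apply mul_le_mul_of_nonneg_left _ (by linarith)
    have : (D + a) ^ 2 ≤ 4 * D ^ 2 := by nlinarith
    nlinarith
  refine ⟨by apply mul_nonneg (by positivity); linarith, ?_⟩
  calc k * bumpE d δ * (1 + 18 * k * (b₀ + b₁ - 2 * c))
      ≤ k * (4 * (|d| - |δ|) * |d|) * (3 / 2) := by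
        have : 0 ≤ 4 * (|d| - |δ|) * |d| := by
          have := abs_nonneg d
          have : 0 ≤ |d| - |δ| := by linarith
          positivity
        gcongr <;> linarith
    _ = (12 * k * |d|) * ((|d| - |δ|) / 2) := by ring
    _ ≤ 1 * ((|d| - |δ|) / 2) := by gcongr
    _ = _ := one_mul _

/-! ### Monotone sets in the plane and one-dimensional changes of variables -/

/-- A compact family of monotone subsets of the plane, depending on a parameter `w`, is
parametrised by the sum `v` of the coordinates: both coordinates are nondecreasing functions of `v`.
The parametrisation extends to all `v`, and is measurable in `(w, v)`. -/
lemma exists_monotone_param {Q : Set (ℝ × ℝ × ℝ)} (hQ : IsCompact Q)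
    (hmono : ∀ w b₀ b₁ b₀' b₁', (w, b₀, b₁) ∈ Q → (w, b₀', b₁') ∈ Q →
      0 ≤ (b₀ - b₀') * (b₁ - b₁')) :
    ∃ β : ℝ × ℝ → ℝ, Measurable β ∧ (∀ w, Monotone fun v => β (w, v)) ∧
      (∀ w, Monotone fun v => v - β (w, v)) ∧
      ∀ w b₀ b₁, (w, b₀, b₁) ∈ Q → β (w, b₀ + b₁) = b₀ := by
  -- The smallest of the nondecreasing 1-Lipschitz functions through the points of the fibre.
  let f : ℝ × ℝ × ℝ → ℝ → ℝ := fun q v => q.2.1 + max (v - q.2.1 - q.2.2) 0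
  have hf : Continuous fun x : (ℝ × ℝ × ℝ) × ℝ => f x.1 x.2 := by fun_prop
  let fib : ℝ → Set (ℝ × ℝ × ℝ) := fun w => {q ∈ Q | q.1 = w}
  have hfib : ∀ w, IsCompact (fib w) := fun w =>
    hQ.inter_right (isClosed_eq continuous_fst continuous_const)
  have himg : ∀ w v, IsCompact ((fun q => f q v) '' fib w) := fun w v =>
    (hfib w).image (by fun_prop)
  let β : ℝ × ℝ → ℝ := fun p => sInf ((fun q => f q p.2) '' fib p.1)
  have hle : ∀ w v, ∀ q ∈ fib w, β (w, v) ≤ f q v := fun w v q hq =>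
    csInf_le (himg w v).bddBelow ⟨q, hq, rfl⟩
  have hatt : ∀ w v, (fib w).Nonempty → ∃ q ∈ fib w, f q v = β (w, v) := fun w v hne =>
    (himg w v).sInf_mem (hne.image _)
  have hemp : ∀ w v, ¬ (fib w).Nonempty → β (w, v) = 0 := fun w v hne => by
    simp [β, not_nonempty_iff_eq_empty.1 hne]
  refine ⟨β, ?_, ?_, ?_, ?_⟩
  · have hW : MeasurableSet {p : ℝ × ℝ | (fib p.1).Nonempty} := by
      have : {p : ℝ × ℝ | (fib p.1).Nonempty} = Prod.fst ⁻¹' (Prod.fst '' Q) := by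
        ext p
        constructor
        · rintro ⟨q, hq, h⟩; exact ⟨q, hq, h⟩
        · rintro ⟨q, hq, h⟩; exact ⟨q, hq, h⟩
      rw [this]
      exact (hQ.image continuous_fst).isClosed.measurableSet.preimage measurable_fst
    apply measurable_of_Iic
    intro c
    have hcl : IsClosed {p : ℝ × ℝ | ∃ q ∈ fib p.1, f q p.2 ≤ c} := by
      have : CompactSpace Q := isCompact_iff_compactSpace.1 hQ
      have h1 : IsClosed {x : Q × (ℝ × ℝ) | x.1.1.1 = x.2.1 ∧ f x.1.1 x.2.2 ≤ c} := by
        apply IsClosed.inter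
        · exact isClosed_eq (by fun_prop) (by fun_prop)
        · exact isClosed_le (hf.comp (by fun_prop : Continuous fun x : Q × (ℝ × ℝ) =>
            (((x.1 : ℝ × ℝ × ℝ), x.2.2) : (ℝ × ℝ × ℝ) × ℝ))) continuous_const
      convert isClosedMap_snd_of_compactSpace _ h1 using 1
      ext p
      constructor
      · rintro ⟨q, ⟨hq, h⟩, h'⟩; exact ⟨(⟨q, hq⟩, p), ⟨h, h'⟩, rfl⟩
      · rintro ⟨⟨⟨q, hq⟩, p'⟩, ⟨h, h'⟩, rfl⟩; exact ⟨q, ⟨hq, h⟩, h'⟩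
    have : β ⁻¹' Iic c = ({p | (fib p.1).Nonempty}ᶜ ∩ {_p | (0 : ℝ) ≤ c}) ∪
        {p : ℝ × ℝ | ∃ q ∈ fib p.1, f q p.2 ≤ c} := by
      ext ⟨w, v⟩
      simp only [mem_preimage, mem_Iic, mem_union, mem_inter_iff, mem_compl_iff, mem_ofPred_eq]
      constructor
      · intro h
        by_cases hne : (fib w).Nonempty
        · obtain ⟨q, hq, he⟩ := hatt w v hne
          exact Or.inr ⟨q, hq, he.trans_le h⟩
        · exact Or.inl ⟨hne, by rwa [hemp w v hne] at h⟩
      · rintro (⟨hne, h⟩ | ⟨q, hq, h⟩)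
        · rwa [hemp w v hne]
        · exact (hle w v q hq).trans h
    rw [this]
    exact (hW.compl.inter (MeasurableSet.const _)).union hcl.measurableSet
  · intro w v v' hv
    by_cases hne : (fib w).Nonempty
    · obtain ⟨q, hq, he⟩ := hatt w v' hne
      refine (hle w v q hq).trans (le_trans ?_ he.le)
      simp only [f]
      gcongr
    · simp [hemp w _ hne]
  · intro w v v' hv
    by_cases hne : (fib w).Nonempty
    · obtain ⟨q, hq, he⟩ := hatt w v hne
      have h1 := hle w v' q hq
      have h2 : f q v' ≤ f q v + (v' - v) := by
        simp only [f]
        have : max (v' - q.2.1 - q.2.2) 0 ≤ max (v - q.2.1 - q.2.2) 0 + (v' - v) :=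
          max_le (by linarith [le_max_left (v - q.2.1 - q.2.2) 0])
            (by linarith [le_max_right (v - q.2.1 - q.2.2) 0])
        linarith
      simp only
      linarith
    · simp [hemp w _ hne, hv]
  · intro w b₀ b₁ hq
    have hmem : (w, b₀, b₁) ∈ fib w := ⟨hq, rfl⟩
    apply le_antisymm
    · refine (hle w _ _ hmem).trans ?_
      simp [f]
    · obtain ⟨⟨w', c₀, c₁⟩, ⟨hq', hw'⟩, he⟩ := hatt w (b₀ + b₁) ⟨_, hmem⟩
      simp only at hw'
      subst hw'
      rw [← he]
      have := hmono w' _ _ _ _ hq hq'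
      simp only [f]
      by_contra hlt
      push Not at hlt
      have h1 := le_max_left (b₀ + b₁ - c₀ - c₁) 0
      have h2 := le_max_right (b₀ + b₁ - c₀ - c₁) 0
      nlinarith

/-- A function of two variables that is nondecreasing and 1-Lipschitz in the second one has a
measurable partial derivative with values in `[0,1]`. -/
lemma exists_measurable_deriv {β : ℝ × ℝ → ℝ} (hm : Measurable β)
    (h0 : ∀ w, Monotone fun v => β (w, v)) (h1 : ∀ w, Monotone fun v => v - β (w, v)) :
    ∃ b : ℝ × ℝ → ℝ, Measurable b ∧ (∀ p, 0 ≤ b p) ∧ (∀ p, b p ≤ 1) ∧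
      ∀ w, ∀ᵐ v, HasDerivAt (fun v => β (w, v)) (b (w, v)) v := by
  -- The upper limit of difference quotients is measurable, and it is the derivative where it exists.
  let Dq : ℕ → ℝ × ℝ → ℝ := fun n p => (n + 1 : ℝ) * (β (p.1, p.2 + 1 / (n + 1 : ℝ)) - β p)
  have hDq : ∀ n, Measurable (Dq n) := fun n => by
    have : Measurable fun p : ℝ × ℝ => β (p.1, p.2 + 1 / (n + 1 : ℝ)) :=
      hm.comp (by fun_prop)
    exact (this.sub hm).const_mul _
  have hr : ∀ n p, 0 ≤ Dq n p ∧ Dq n p ≤ 1 := by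
    rintro n ⟨w, v⟩
    have hn : (0 : ℝ) < n + 1 := by positivity
    have hle : v ≤ v + 1 / (n + 1 : ℝ) := by have : 0 < 1 / (n + 1 : ℝ) := by positivity
                                             linarith
    have ha := h0 w hle
    have hb := h1 w hle
    simp only at ha hb
    refine ⟨mul_nonneg hn.le (by linarith), ?_⟩
    simp only [Dq]
    calc (n + 1 : ℝ) * (β (w, v + 1 / (n + 1 : ℝ)) - β (w, v)) ≤ (n + 1 : ℝ) * (1 / (n + 1 : ℝ)) := by
          gcongr; linarith
      _ = 1 := by field_simp
  refine ⟨fun p => Filter.limsup (fun n => Dq n p) Filter.atTop, Measurable.limsup hDq,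
    fun p => ?_, fun p => ?_, fun w => ?_⟩
  · apply Filter.le_limsup_of_frequently_le
    · exact Filter.Frequently.of_forall fun n => (hr n p).1
    · exact Filter.isBoundedUnder_of ⟨1, fun n => (hr n p).2⟩
  · apply Filter.limsup_le_of_le
    · exact (Filter.isBoundedUnder_of ⟨0, fun n => (hr n p).1⟩ :
        Filter.IsBoundedUnder (· ≥ ·) Filter.atTop _).isCoboundedUnder_le
    · exact Filter.Eventually.of_forall fun n => (hr n p).2
  · filter_upwards [(h0 w).ae_differentiableAt] with v hv
    have hd := hv.hasDerivAt
    have hlim : Filter.Tendsto (fun n => Dq n (w, v)) Filter.atTop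
        (nhds (deriv (fun v => β (w, v)) v)) := by
      have h2 := hd.tendsto_slope_zero_right
      have h3 : Filter.Tendsto (fun n : ℕ => 1 / (n + 1 : ℝ)) Filter.atTop (nhdsWithin 0 (Ioi 0)) := by
        apply tendsto_nhdsWithin_iff.2 ⟨tendsto_one_div_add_atTop_nhds_zero_nat, ?_⟩
        filter_upwards with n
        exact mem_Ioi.2 (by positivity)
      refine (h2.comp h3).congr fun n => ?_
      simp [Dq]
    rw [hlim.limsup_eq]
    exact hd

/-- A 1-Lipschitz function does not increase the length of null sets. -/
lemma volume_image_eq_zero_of_lipschitz {g : ℝ → ℝ} (hg : LipschitzWith 1 g) {N : Set ℝ}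
    (hN : volume N = 0) : volume (g '' N) = 0 := by
  have := hg.hausdorffMeasure_image_le (d := 1) zero_le_one N
  rw [hausdorffMeasure_real, hN, mul_zero] at this
  exact le_antisymm this bot_le

/-- Removing a null set makes an almost everywhere derivative a derivative everywhere. -/
lemma exists_null_hasDerivAt {g j : ℝ → ℝ} {S : Set ℝ}
    (hj : ∀ᵐ v, v ∈ S → HasDerivAt g (j v) v) :
    ∃ N, MeasurableSet N ∧ volume N = 0 ∧ ∀ v ∈ S \ N, HasDerivAt g (j v) v := by
  obtain ⟨N, hN, hNm, hN0⟩ := exists_measurable_superset_of_null (ae_iff.1 hj)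
  refine ⟨N, hNm, hN0, fun v hv => ?_⟩
  by_contra h
  exact hv.2 (hN (by simp only [mem_ofPred_eq]; exact fun h' => h (h' hv.1)))

/-- Change of variables for a nondecreasing function that is only almost everywhere differentiable:
the image of the null set of exceptional points may have positive length, which gives an inequality. -/
lemma lintegral_deriv_mul_comp_le {g j : ℝ → ℝ} {S T : Set ℝ} (hS : MeasurableSet S)
    (hg : MonotoneOn g S) (hj : ∀ᵐ v, v ∈ S → HasDerivAt g (j v) v) (hT : MapsTo g S T)
    (u : ℝ → ℝ≥0∞) :
    ∫⁻ v in S, ENNReal.ofReal (j v) * u (g v) ≤ ∫⁻ x in T, u x := by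
  obtain ⟨N, hNm, hN0, hN⟩ := exists_null_hasDerivAt hj
  have h1 : S =ᵐ[volume] (S \ N : Set ℝ) := (sdiff_null_ae_eq_self hN0).symm
  rw [setLIntegral_congr h1, ← lintegral_image_eq_lintegral_deriv_mul_of_monotoneOn (hS.diff hNm)
    (fun v hv => (hN v hv).hasDerivWithinAt) (hg.mono sdiff_subset)]
  exact lintegral_mono_set (image_subset_iff.2 fun v hv => hT hv.1)

/-- For a 1-Lipschitz function the exceptional points do not contribute to the image, and the opposite
inequality holds. -/
lemma volume_image_le_lintegral_deriv {g j : ℝ → ℝ} {S : Set ℝ} (hS : MeasurableSet S)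
    (hg : Monotone g) (hL : LipschitzWith 1 g) (hj : ∀ᵐ v, v ∈ S → HasDerivAt g (j v) v) :
    volume (g '' S) ≤ ∫⁻ v in S, ENNReal.ofReal (j v) := by
  obtain ⟨N, hNm, hN0, hN⟩ := exists_null_hasDerivAt hj
  have h1 : S =ᵐ[volume] (S \ N : Set ℝ) := (sdiff_null_ae_eq_self hN0).symm
  rw [setLIntegral_congr h1, lintegral_deriv_eq_volume_image_of_monotoneOn (hS.diff hNm)
    (fun v hv => (hN v hv).hasDerivWithinAt) (hg.monotoneOn _)]
  calc volume (g '' S) ≤ volume (g '' (S \ N) ∪ g '' N) := by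
        apply measure_mono
        rw [← image_union]
        exact image_mono (by simp)
    _ ≤ volume (g '' (S \ N)) + volume (g '' N) := measure_union_le _ _
    _ = volume (g '' (S \ N)) := by rw [volume_image_eq_zero_of_lipschitz hL hN0, add_zero]

lemma lipschitzWith_one_of_monotone {g : ℝ → ℝ} (h0 : Monotone g) (h1 : Monotone fun v => v - g v) :
    LipschitzWith 1 g := by
  apply LipschitzWith.of_dist_le_mul
  intro x y
  rw [NNReal.coe_one, one_mul, Real.dist_eq, Real.dist_eq]
  rcases le_total x y with h | h
  · have := h0 h; have := h1 h
    simp only at *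
    rw [abs_of_nonpos (by linarith), abs_of_nonpos (by linarith)]; linarith
  · have := h0 h; have := h1 h
    simp only at *
    rw [abs_of_nonneg (by linarith), abs_of_nonneg (by linarith)]; linarith

/-! ### Triangular maps of the plane -/

lemma setLIntegral_prod_section {f : ℝ × ℝ → ℝ≥0∞} (hf : Measurable f) {S : Set (ℝ × ℝ)}
    (hS : MeasurableSet S) :
    ∫⁻ p in S, f p = ∫⁻ w, ∫⁻ v in Prod.mk w ⁻¹' S, f (w, v) := by
  rw [← lintegral_indicator hS, Measure.volume_eq_prod,
    lintegral_prod _ (hf.indicator hS).aemeasurable]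
  congr 1
  ext w
  rw [← lintegral_indicator (measurable_prodMk_left hS)]
  rfl

/-- A triangular map, monotone on the fibres, does not overlap itself: it maps the measure with
density the product of its diagonal derivatives to a measure below Lebesgue measure. -/
lemma setLIntegral_triangular_le {α a : ℝ → ℝ} {F j : ℝ × ℝ → ℝ} {S T : Set (ℝ × ℝ)}
    (ham : Measurable a) (hα : Monotone α) (ha : ∀ᵐ w, HasDerivAt α (a w) w)
    (hjm : Measurable j) (hS : MeasurableSet S) (hT : MeasurableSet T)
    (hF : ∀ w, MonotoneOn (fun v => F (w, v)) (Prod.mk w ⁻¹' S))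
    (hj : ∀ w, ∀ᵐ v, (w, v) ∈ S → HasDerivAt (fun v => F (w, v)) (j (w, v)) v)
    (hST : ∀ p ∈ S, (α p.1, F p) ∈ T) :
    ∫⁻ p in S, ENNReal.ofReal (a p.1) * ENNReal.ofReal (j p) ≤ volume T := by
  rw [setLIntegral_prod_section (by fun_prop) hS]
  calc ∫⁻ w, ∫⁻ v in Prod.mk w ⁻¹' S, ENNReal.ofReal (a w) * ENNReal.ofReal (j (w, v))
      = ∫⁻ w, ENNReal.ofReal (a w) * ∫⁻ v in Prod.mk w ⁻¹' S, ENNReal.ofReal (j (w, v)) := by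
        congr 1; ext w
        rw [lintegral_const_mul _ (by fun_prop)]
    _ ≤ ∫⁻ w, ENNReal.ofReal (a w) * volume (Prod.mk (α w) ⁻¹' T) := by
        gcongr with w
        have := lintegral_deriv_mul_comp_le (T := Prod.mk (α w) ⁻¹' T) (measurable_prodMk_left hS)
          (hF w) (hj w) (fun v hv => hST _ hv) 1
        simpa using this
    _ = ∫⁻ w in univ, ENNReal.ofReal (a w) * volume (Prod.mk (α w) ⁻¹' T) := by simp
    _ ≤ ∫⁻ x in univ, volume (Prod.mk x ⁻¹' T) :=
        lintegral_deriv_mul_comp_le (T := univ) MeasurableSet.univ (hα.monotoneOn _)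
          (ha.mono fun w hw _ => hw) (mapsTo_univ _ _) fun x => volume (Prod.mk x ⁻¹' T)
    _ = volume T := by
        rw [Measure.volume_eq_prod, Measure.prod_apply hT]; simp

/-- For a map that preserves the first coordinate and is nondecreasing and 1-Lipschitz in the second
one, the weight of the image of a set is at most the integral of the derivative. -/
lemma setLIntegral_image_fiber_le {g j : ℝ × ℝ → ℝ} {q : ℝ → ℝ≥0∞} {S : Set (ℝ × ℝ)}
    (hq : Measurable q) (hjm : Measurable j) (hS : MeasurableSet S)
    (hg0 : ∀ w, Monotone fun v => g (w, v)) (hg1 : ∀ w, Monotone fun v => v - g (w, v))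
    (hj : ∀ w, ∀ᵐ v, HasDerivAt (fun v => g (w, v)) (j (w, v)) v)
    (hT : MeasurableSet ((fun p => (p.1, g p)) '' S)) :
    ∫⁻ p in (fun p => (p.1, g p)) '' S, q p.1 ≤ ∫⁻ p in S, q p.1 * ENNReal.ofReal (j p) := by
  rw [setLIntegral_prod_section (by fun_prop) hS, setLIntegral_prod_section (by fun_prop) hT]
  refine lintegral_mono fun w => ?_
  simp only
  rw [lintegral_const_mul _ (by fun_prop), setLIntegral_const]
  gcongr
  refine le_trans (measure_mono ?_) (volume_image_le_lintegral_deriv (measurable_prodMk_left hS)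
    (hg0 w) (lipschitzWith_one_of_monotone (hg0 w) (hg1 w)) ((hj w).mono fun v hv _ => hv))
  rintro y ⟨⟨w', v⟩, hv, he⟩
  simp only [Prod.mk.injEq] at he
  obtain ⟨rfl, rfl⟩ := he
  exact ⟨v, hv, rfl⟩

/-- If the image of `lam` under `(w, v) ↦ (w, g (w, v))` is at most `q(w) dw dy`, then `lam` is at
most `q(w) ∂_v g(w, v) dw dv`. -/
lemma le_withDensity_of_map_fiber_le {g j : ℝ × ℝ → ℝ} {q : ℝ → ℝ≥0∞} {W : Set (ℝ × ℝ)}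
    {lam : Measure (ℝ × ℝ)} [IsFiniteMeasure lam]
    (hq : Measurable q) (hgm : Measurable g) (hjm : Measurable j) (hW : MeasurableSet W)
    (hlW : lam Wᶜ = 0)
    (hg0 : ∀ w, Monotone fun v => g (w, v)) (hg1 : ∀ w, Monotone fun v => v - g (w, v))
    (hj : ∀ w, ∀ᵐ v, HasDerivAt (fun v => g (w, v)) (j (w, v)) v)
    (hT : ∀ S ⊆ W, IsCompact S → IsCompact ((fun p => (p.1, g p)) '' S))
    (hle : lam.map (fun p => (p.1, g p)) ≤ volume.withDensity fun p => q p.1) :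
    lam ≤ volume.withDensity fun p => q p.1 * ENNReal.ofReal (j p) := by
  have hΨ : Measurable fun p : ℝ × ℝ => (p.1, g p) := by fun_prop
  have hcomp : ∀ S ⊆ W, IsCompact S →
      lam S ≤ (volume.withDensity fun p => q p.1 * ENNReal.ofReal (j p)) S := fun S hSW hS => by
    have hTm := (hT S hSW hS).measurableSet
    calc lam S ≤ lam ((fun p => (p.1, g p)) ⁻¹' ((fun p => (p.1, g p)) '' S)) :=
          measure_mono (subset_preimage_image _ _)
      _ = lam.map (fun p => (p.1, g p)) ((fun p => (p.1, g p)) '' S) :=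
          (Measure.map_apply hΨ hTm).symm
      _ ≤ (volume.withDensity fun p => q p.1) ((fun p => (p.1, g p)) '' S) := hle _
      _ = ∫⁻ p in (fun p => (p.1, g p)) '' S, q p.1 := withDensity_apply _ hTm
      _ ≤ ∫⁻ p in S, q p.1 * ENNReal.ofReal (j p) :=
          setLIntegral_image_fiber_le hq hjm hS.measurableSet hg0 hg1 hj hTm
      _ = _ := (withDensity_apply _ hS.measurableSet).symm
  refine Measure.le_iff.2 fun S hS => ?_
  have h1 : lam S = lam (S ∩ W) := by
    refine le_antisymm ?_ (measure_mono inter_subset_left)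
    calc lam S ≤ lam (S ∩ W ∪ Wᶜ) := measure_mono fun x hx => by
          by_cases h : x ∈ W
          · exact Or.inl ⟨hx, h⟩
          · exact Or.inr h
      _ ≤ lam (S ∩ W) + lam Wᶜ := measure_union_le _ _
      _ = lam (S ∩ W) := by rw [hlW, add_zero]
  rw [h1, (hS.inter hW).measure_eq_iSup_isCompact_of_ne_top (measure_ne_top _ _)]
  refine iSup_le fun K => iSup_le fun hK => iSup_le fun hKc => ?_
  exact (hcomp K (hK.trans inter_subset_right) hKc).trans (measure_mono (hK.trans inter_subset_left))

/-! ### Means of inverse densities -/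

/-- The mean `((1 - t) x^(1/N) + t y^(1/N))^N`. In its pointwise form, the curvature-dimension
inequality for `K = 0` says that the inverse density at time `t` is at least the mean of the inverse
densities at the end points. -/
def cdMean (N t : ℝ) (x y : ℝ≥0∞) : ℝ≥0∞ :=
  (ENNReal.ofReal (1 - t) * x ^ (1 / N) + ENNReal.ofReal t * y ^ (1 / N)) ^ N

lemma cdMean_mono {N t : ℝ} (hN : 0 < N) {x y x' y' : ℝ≥0∞} (hx : x ≤ x') (hy : y ≤ y') :
    cdMean N t x y ≤ cdMean N t x' y' := by
  unfold cdMean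
  gcongr

lemma cdMean_mul {N t : ℝ} (hN : 0 < N) (x y f : ℝ≥0∞) :
    cdMean N t (f * x) (f * y) = f * cdMean N t x y := by
  have h : 0 ≤ 1 / N := by positivity
  have hf : f = (f ^ (1 / N)) ^ N := by
    rw [← ENNReal.rpow_mul, one_div_mul_cancel hN.ne', ENNReal.rpow_one]
  unfold cdMean
  rw [ENNReal.mul_rpow_of_nonneg _ _ h, ENNReal.mul_rpow_of_nonneg _ _ h]
  conv_rhs => rw [hf]
  rw [← ENNReal.mul_rpow_of_nonneg _ _ hN.le]
  congr 1
  ring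

@[fun_prop]
lemma measurable_cdMean {α : Type*} [MeasurableSpace α] {N t : ℝ} {f g : α → ℝ≥0∞}
    (hf : Measurable f) (hg : Measurable g) : Measurable fun x => cdMean N t (f x) (g x) := by
  unfold cdMean
  fun_prop

/-- The means decrease with `N`. -/
lemma cdMean_le_four {N t : ℝ} (hN : 4 ≤ N) (ht : 0 ≤ t) (ht' : t ≤ 1) (x y : ℝ≥0∞) :
    cdMean N t x y ≤ cdMean 4 t x y := by
  have hw : ENNReal.ofReal (1 - t) + ENNReal.ofReal t = 1 := by
    rw [← ENNReal.ofReal_add (by linarith) ht]; simp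
  have h := ENNReal.rpow_arith_mean_le_arith_mean2_rpow (ENNReal.ofReal (1 - t)) (ENNReal.ofReal t)
    (x ^ (1 / N)) (y ^ (1 / N)) hw (p := N / 4) (by linarith)
  have he : 1 / N * (N / 4) = 1 / 4 := by field_simp
  rw [← ENNReal.rpow_mul, ← ENNReal.rpow_mul, he] at h
  have h2 := ENNReal.rpow_le_rpow h (z := 4) (by norm_num)
  rw [← ENNReal.rpow_mul] at h2
  have : N / 4 * 4 = N := by ring
  rw [this] at h2
  exact h2

/-- The product of two affine interpolations, the second one concave only for the power `1/2`,
is concave for the power `1/N`, `N ≥ 4`. -/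
lemma cdMean_le_mul {N t a b a' b' B : ℝ} (hN : 4 ≤ N) (ht : 0 ≤ t) (ht' : t ≤ 1)
    (ha : 0 ≤ a) (hb : 0 ≤ b) (ha' : 0 ≤ a') (hb' : 0 ≤ b')
    (hB : ((1 - t) * √b + t * √b') ^ 2 ≤ B) :
    cdMean N t (ENNReal.ofReal a * ENNReal.ofReal b) (ENNReal.ofReal a' * ENNReal.ofReal b')
      ≤ ENNReal.ofReal ((1 - t) * a + t * a') * ENNReal.ofReal B := by
  refine (cdMean_le_four hN ht ht' _ _).trans ?_
  have hA : ((1 - t) * √a + t * √a') ^ 2 ≤ (1 - t) * a + t * a' := by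
    have h1 := Real.sq_sqrt ha
    have h2 := Real.sq_sqrt ha'
    have : 0 ≤ t * (1 - t) := mul_nonneg ht (by linarith)
    nlinarith [mul_nonneg this (sq_nonneg (√a - √a'))]
  have hroot : ∀ x y : ℝ, 0 ≤ x → 0 ≤ y →
      (ENNReal.ofReal x * ENNReal.ofReal y) ^ (1 / 4 : ℝ) = ENNReal.ofReal (√√x * √√y) := by
    intro x y hx hy
    have hx4 : x = (√√x) ^ 4 := by
      rw [show (4 : ℕ) = 2 * 2 from rfl, pow_mul, Real.sq_sqrt (Real.sqrt_nonneg _), Real.sq_sqrt hx]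
    have hy4 : y = (√√y) ^ 4 := by
      rw [show (4 : ℕ) = 2 * 2 from rfl, pow_mul, Real.sq_sqrt (Real.sqrt_nonneg _), Real.sq_sqrt hy]
    rw [← ENNReal.ofReal_mul hx]
    conv_lhs => rw [hx4, hy4, ← mul_pow]
    rw [ENNReal.ofReal_rpow_of_nonneg (by positivity) (by norm_num), ← Real.rpow_natCast,
      ← Real.rpow_mul (by positivity)]
    norm_num
  unfold cdMean
  rw [hroot a b ha hb, hroot a' b' ha' hb', ← ENNReal.ofReal_mul (by linarith),
    ← ENNReal.ofReal_mul ht, ← ENNReal.ofReal_add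
      (mul_nonneg (by linarith) (by positivity)) (by positivity),
    ENNReal.ofReal_rpow_of_nonneg (add_nonneg (mul_nonneg (by linarith) (by positivity))
      (by positivity)) (by norm_num), ← ENNReal.ofReal_mul
      ((sq_nonneg _).trans hA)]
  apply ENNReal.ofReal_le_ofReal
  rw [show (4 : ℝ) = ((4 : ℕ) : ℝ) by norm_num, Real.rpow_natCast]
  set p := √√a
  set q := √√b
  set p' := √√a'
  set q' := √√b'
  have e1 : √a = p ^ 2 := (Real.sq_sqrt (Real.sqrt_nonneg _)).symm
  have e2 : √b = q ^ 2 := (Real.sq_sqrt (Real.sqrt_nonneg _)).symm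
  have e3 : √a' = p' ^ 2 := (Real.sq_sqrt (Real.sqrt_nonneg _)).symm
  have e4 : √b' = q' ^ 2 := (Real.sq_sqrt (Real.sqrt_nonneg _)).symm
  rw [e1, e3] at hA
  rw [e2, e4] at hB
  have hc : ((1 - t) * (p * q) + t * (p' * q')) ^ 2
      ≤ ((1 - t) * p ^ 2 + t * p' ^ 2) * ((1 - t) * q ^ 2 + t * q' ^ 2) := by
    have : 0 ≤ t * (1 - t) := mul_nonneg ht (by linarith)
    nlinarith [mul_nonneg this (sq_nonneg (p * q' - p' * q))]
  calc ((1 - t) * (p * q) + t * (p' * q')) ^ 4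
      = (((1 - t) * (p * q) + t * (p' * q')) ^ 2) ^ 2 := by ring
    _ ≤ (((1 - t) * p ^ 2 + t * p' ^ 2) * ((1 - t) * q ^ 2 + t * q' ^ 2)) ^ 2 := by gcongr
    _ = ((1 - t) * p ^ 2 + t * p' ^ 2) ^ 2 * ((1 - t) * q ^ 2 + t * q' ^ 2) ^ 2 := by ring
    _ ≤ _ := mul_le_mul hA hB (sq_nonneg _) ((sq_nonneg _).trans hA)

lemma ae_le_of_withDensity_le {α : Type*} [MeasurableSpace α] {τ : Measure α} [SigmaFinite τ]
    {f g : α → ℝ≥0∞} (hf : Measurable f) (h : τ.withDensity f ≤ τ.withDensity g) :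
    f ≤ᵐ[τ] g := by
  refine ae_le_of_forall_setLIntegral_le_of_sigmaFinite hf fun s hs _ => ?_
  rw [← withDensity_apply _ hs, ← withDensity_apply _ hs]
  exact h s

/-- Bounds of the form `D · θ ≤ J · m` are preserved by taking means of the `D`s and of the
`J`s. The measures `θ` and `m` need not be related: all densities are taken with respect to
`θ + m`. -/
lemma withDensity_cdMean_le {α : Type*} [MeasurableSpace α] {θ m : Measure α} [SigmaFinite θ]
    [SigmaFinite m] {N t : ℝ} (hN : 0 < N) {D₀ D₁ J₀ J₁ J : α → ℝ≥0∞} (hD₀ : Measurable D₀)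
    (hD₁ : Measurable D₁) (hJ₀ : Measurable J₀) (hJ₁ : Measurable J₁) (hJ : Measurable J)
    (h0 : θ.withDensity D₀ ≤ m.withDensity J₀) (h1 : θ.withDensity D₁ ≤ m.withDensity J₁)
    (hle : ∀ᵐ x ∂m, cdMean N t (J₀ x) (J₁ x) ≤ J x) :
    (θ.withDensity fun x => cdMean N t (D₀ x) (D₁ x)) ≤ m.withDensity J := by
  set τ := θ + m
  set f := θ.rnDeriv τ
  set g := m.rnDeriv τ
  have hf : Measurable f := Measure.measurable_rnDeriv _ _
  have hg : Measurable g := Measure.measurable_rnDeriv _ _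
  have hθ : θ = τ.withDensity f :=
    (Measure.withDensity_rnDeriv_eq θ τ (Measure.AbsolutelyContinuous.rfl.add_right _)).symm
  have hm : m = τ.withDensity g :=
    (Measure.withDensity_rnDeriv_eq m τ
      ((Measure.AbsolutelyContinuous.rfl (μ := m)).trans
        (Measure.le_add_left le_rfl).absolutelyContinuous)).symm
  have key : ∀ D : α → ℝ≥0∞, Measurable D → θ.withDensity D = τ.withDensity (f * D) := fun D hD => by
    conv_lhs => rw [hθ]
    rw [withDensity_mul _ hf hD]
  have key' : ∀ D : α → ℝ≥0∞, Measurable D → m.withDensity D = τ.withDensity (g * D) := fun D hD => by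
    conv_lhs => rw [hm]
    rw [withDensity_mul _ hg hD]
  rw [key _ hD₀, key' _ hJ₀] at h0
  rw [key _ hD₁, key' _ hJ₁] at h1
  rw [key _ (by fun_prop), key' _ hJ]
  have h0' := ae_le_of_withDensity_le (hf.mul hD₀) h0
  have h1' := ae_le_of_withDensity_le (hf.mul hD₁) h1
  have hle' : ∀ᵐ x ∂τ, g x ≠ 0 → cdMean N t (J₀ x) (J₁ x) ≤ J x := by
    rw [hm] at hle
    exact (ae_withDensity_iff hg).1 hle
  refine withDensity_mono ?_
  filter_upwards [h0', h1', hle'] with x hx0 hx1 hx2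
  simp only [Pi.mul_apply] at *
  rw [← cdMean_mul hN]
  refine (cdMean_mono hN hx0 hx1).trans ?_
  rw [cdMean_mul hN]
  by_cases hgx : g x = 0
  · simp [hgx]
  · gcongr
    exact hx2 hgx

/-! ### Interpolation along triangular monotone couplings -/

lemma map_withDensity_comp {α β : Type*} [MeasurableSpace α] [MeasurableSpace β] (μ : Measure α)
    {Φ : α → β} {D : β → ℝ≥0∞} (hΦ : Measurable Φ) (hD : Measurable D) :
    (μ.withDensity fun x => D (Φ x)).map Φ = (μ.map Φ).withDensity D := by
  ext s hs
  rw [Measure.map_apply hΦ hs, withDensity_apply _ (hΦ hs), withDensity_apply _ hs,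
    setLIntegral_map hs hD hΦ]

/-- If the image of `D ∘ Φ · θ` under the triangular map `Φ(w, v) = (α(w), β(w, v))` is at most
Lebesgue measure, then `D ∘ Φ · θ` is at most the product of the diagonal derivatives of `Φ`. -/
lemma withDensity_le_of_map_triangular_le {α a : ℝ → ℝ} {β b : ℝ × ℝ → ℝ} {D : ℝ × ℝ → ℝ≥0∞}
    {θ : Measure (ℝ × ℝ)} {W : Set (ℝ × ℝ)} (hW : IsCompact W) (hθW : θ Wᶜ = 0)
    (hα0 : Monotone α) (hα1 : Monotone fun w => w - α w) (ham : Measurable a)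
    (ha : ∀ᵐ w, HasDerivAt α (a w) w)
    (hβm : Measurable β) (hβ0 : ∀ w, Monotone fun v => β (w, v))
    (hβ1 : ∀ w, Monotone fun v => v - β (w, v)) (hbm : Measurable b)
    (hb : ∀ w, ∀ᵐ v, HasDerivAt (fun v => β (w, v)) (b (w, v)) v)
    (hcpt : ∀ S ⊆ W, IsCompact S → IsCompact ((fun p => (p.1, β p)) '' S))
    (hD : Measurable D) (hle : (θ.map fun p => (α p.1, β p)).withDensity D ≤ volume) :
    (θ.withDensity fun p => D (α p.1, β p)) ≤
      volume.withDensity fun p => ENNReal.ofReal (a p.1) * ENNReal.ofReal (b p) := by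
  have hαc : Continuous α := (lipschitzWith_one_of_monotone hα0 hα1).continuous
  have hαm : Measurable α := hαc.measurable
  set Φ : ℝ × ℝ → ℝ × ℝ := fun p => (α p.1, β p) with hΦ_def
  set Ψ : ℝ × ℝ → ℝ × ℝ := fun p => (p.1, β p) with hΨ_def
  have hΦ : Measurable Φ := by fun_prop
  have hΨ : Measurable Ψ := by fun_prop
  set lam := θ.withDensity fun p => D (Φ p) with hlam
  have hlamΦ : lam.map Φ ≤ volume := by rwa [hlam, map_withDensity_comp _ hΦ hD]
  have hlamW : lam Wᶜ = 0 := withDensity_absolutelyContinuous _ _ hθW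
  have hΨW : IsCompact (Ψ '' W) := hcpt W subset_rfl hW
  have hΦW : IsCompact (Φ '' W) := by
    have : Φ '' W = (fun p : ℝ × ℝ => (α p.1, p.2)) '' (Ψ '' W) := by rw [image_image]
    rw [this]
    exact hΨW.image (by fun_prop)
  have hfin : IsFiniteMeasure lam := by
    constructor
    calc lam univ ≤ lam (Φ ⁻¹' (Φ '' W) ∪ Wᶜ) := measure_mono fun x _ => by
          by_cases h : x ∈ W
          · exact Or.inl ⟨x, h, rfl⟩
          · exact Or.inr h
      _ ≤ lam (Φ ⁻¹' (Φ '' W)) + lam Wᶜ := measure_union_le _ _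
      _ = lam.map Φ (Φ '' W) := by
          rw [hlamW, add_zero, Measure.map_apply hΦ hΦW.measurableSet]
      _ ≤ volume (Φ '' W) := hlamΦ _
      _ < ⊤ := hΦW.measure_lt_top
  have hswap : (volume : Measure (ℝ × ℝ)).map Prod.swap = volume := by
    rw [Measure.volume_eq_prod, Measure.prod_swap]
  -- The first coordinate, treated as a fibrewise map after exchanging the coordinates.
  have hB : lam.map Ψ ≤ volume.withDensity fun p => ENNReal.ofReal (a p.1) := by
    have h1 : (lam.map Ψ).map Prod.swap ≤
        volume.withDensity fun p : ℝ × ℝ => 1 * ENNReal.ofReal (a p.2) := by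
      have hWs : IsCompact (Prod.swap '' (Ψ '' W)) := hΨW.image continuous_swap
      refine le_withDensity_of_map_fiber_le (g := fun p : ℝ × ℝ => α p.2)
        (j := fun p : ℝ × ℝ => a p.2) (q := fun _ => 1) (W := Prod.swap '' (Ψ '' W))
        measurable_const (by fun_prop) (by fun_prop) hWs.measurableSet ?_ (fun _ => hα0)
        (fun _ => hα1) (fun _ => ha) (fun S _ hS => hS.image (by fun_prop)) ?_
      · rw [Measure.map_apply measurable_swap hWs.measurableSet.compl,
          Measure.map_apply hΨ (measurable_swap hWs.measurableSet.compl)]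
        refine measure_mono_null (t := Wᶜ) (fun x hx hxW => hx ?_) hlamW
        exact ⟨Ψ x, ⟨x, hxW, rfl⟩, rfl⟩
      · rw [Measure.map_map measurable_swap hΨ, Measure.map_map (by fun_prop) (by fun_prop)]
        have h2 : ((fun p : ℝ × ℝ => (p.1, α p.2)) ∘ Prod.swap ∘ Ψ) = Prod.swap ∘ Φ := by
          ext p <;> rfl
        rw [h2, ← Measure.map_map measurable_swap hΦ]
        calc (lam.map Φ).map Prod.swap ≤ (volume : Measure (ℝ × ℝ)).map Prod.swap :=
              Measure.map_mono hlamΦ measurable_swap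
          _ = volume := hswap
          _ = _ := by rw [withDensity_const, one_smul]
    have h3 := Measure.map_mono h1 (measurable_swap (α := ℝ) (β := ℝ))
    rw [Measure.map_map measurable_swap measurable_swap, Prod.swap_swap_eq, Measure.map_id] at h3
    refine h3.trans (le_of_eq ?_)
    have := map_withDensity_comp (volume : Measure (ℝ × ℝ)) (Φ := Prod.swap)
      (D := fun p : ℝ × ℝ => ENNReal.ofReal (a p.1)) measurable_swap (by fun_prop)
    rw [hswap] at this
    simpa using this
  exact le_withDensity_of_map_fiber_le (q := fun w => ENNReal.ofReal (a w)) (by fun_prop) hβm hbm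
    hW.measurableSet hlamW hβ0 hβ1 hb hcpt hB

/-- The point at time `t` of the interpolating curve between the points of a pair. -/
def interp (k c t : ℝ) (q : (ℝ × ℝ) × (ℝ × ℝ)) : ℝ × ℝ :=
  ((1 - t) * q.1.1 + t * q.2.1, curveY k c (q.2.1 - q.1.1) q.1.2 q.2.2 t)

@[fun_prop]
lemma measurable_interp (k c t : ℝ) : Measurable (interp k c t) := by
  unfold interp curveY bumpE
  fun_prop

/-- The displacement of the pair is small, compared to the size `k` of the push, and at least as
large in the first coordinate as in the second one. -/
def SmallPair (k c : ℝ) (q : (ℝ × ℝ) × (ℝ × ℝ)) : Prop :=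
  |q.2.2 - q.1.2| ≤ |q.2.1 - q.1.1| ∧ 12 * k * |q.2.1 - q.1.1| ≤ 1 ∧
    36 * k * |q.1.2 + q.2.2 - 2 * c| ≤ 1

/-- The interpolation inequality for a triangular monotone coupling: if `D₀` and `D₁` are at most
the inverse densities of the marginals, their mean is at most the inverse density of the
interpolated measure. -/
theorem map_interp_triangular_le {k c t N : ℝ} {K : Set ((ℝ × ℝ) × (ℝ × ℝ))} (hK : IsCompact K)
    {Γ : Measure ((ℝ × ℝ) × (ℝ × ℝ))} [IsFiniteMeasure Γ] (hΓK : Γ Kᶜ = 0)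
    (hfst : ∀ q ∈ K, ∀ q' ∈ K, 0 ≤ (q.1.1 - q'.1.1) * (q.2.1 - q'.2.1))
    (hsnd : ∀ q ∈ K, ∀ q' ∈ K, q.1.1 = q'.1.1 → q.2.1 = q'.2.1 →
      0 ≤ (q.1.2 - q'.1.2) * (q.2.2 - q'.2.2))
    (hk : 0 ≤ k) (hkK : k = 0 ∨ ∀ q ∈ K, SmallPair k c q) (ht : 0 < t) (ht' : t < 1) (hN : 4 ≤ N)
    {D₀ D₁ : ℝ × ℝ → ℝ≥0∞} (hD₀ : Measurable D₀) (hD₁ : Measurable D₁)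
    (h0 : (Γ.map Prod.fst).withDensity D₀ ≤ volume) (h1 : (Γ.map Prod.snd).withDensity D₁ ≤ volume) :
    (Γ.withDensity fun q => cdMean N t (D₀ q.1) (D₁ q.2)).map (interp k c t) ≤ volume := by
  obtain ⟨α₀, hα₀m, hα₀0, hα₀1, hα₀⟩ := exists_monotone_param
    (Q := (fun q : (ℝ × ℝ) × (ℝ × ℝ) => ((0 : ℝ), q.1.1, q.2.1)) '' K) (hK.image (by fun_prop)) (by
      rintro w b₀ b₁ b₀' b₁' ⟨q, hq, he⟩ ⟨q', hq', he'⟩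
      simp only [Prod.mk.injEq] at he he'
      obtain ⟨-, rfl, rfl⟩ := he
      obtain ⟨-, rfl, rfl⟩ := he'
      exact hfst q hq q' hq')
  obtain ⟨a₀, ha₀m, ha₀0, ha₀1, ha₀⟩ := exists_measurable_deriv hα₀m hα₀0 hα₀1
  set α : ℝ → ℝ := fun w => α₀ (0, w) with hα_def
  set a : ℝ → ℝ := fun w => a₀ (0, w) with ha_def
  have ham : Measurable a := by fun_prop
  have hα0 : Monotone α := hα₀0 0
  have hα1 : Monotone fun w => w - α w := hα₀1 0
  have ha : ∀ᵐ w, HasDerivAt α (a w) w := ha₀ 0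
  have hαK : ∀ q ∈ K, α (q.1.1 + q.2.1) = q.1.1 := fun q hq => hα₀ 0 _ _ ⟨q, hq, rfl⟩
  obtain ⟨β, hβm, hβ0, hβ1, hβ⟩ := exists_monotone_param
    (Q := (fun q : (ℝ × ℝ) × (ℝ × ℝ) => (q.1.1 + q.2.1, q.1.2, q.2.2)) '' K)
    (hK.image (by fun_prop)) (by
      rintro w b₀ b₁ b₀' b₁' ⟨q, hq, he⟩ ⟨q', hq', he'⟩
      simp only [Prod.mk.injEq] at he he'
      obtain ⟨hw, rfl, rfl⟩ := he
      obtain ⟨hw', rfl, rfl⟩ := he'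
      have h1 := hαK q hq
      have h2 := hαK q' hq'
      rw [hw] at h1
      rw [hw'] at h2
      exact hsnd q hq q' hq' (h1.symm.trans h2) (by linarith))
  obtain ⟨b, hbm, hb0, hb1, hb⟩ := exists_measurable_deriv hβm hβ0 hβ1
  have hβK : ∀ q ∈ K, β (q.1.1 + q.2.1, q.1.2 + q.2.2) = q.1.2 := fun q hq =>
    hβ _ _ _ ⟨q, hq, rfl⟩
  have hαm : Measurable α := (lipschitzWith_one_of_monotone hα0 hα1).continuous.measurable
  -- The midpoint, up to a factor 2, is the coordinate on the coupling.
  set Θ : (ℝ × ℝ) × (ℝ × ℝ) → ℝ × ℝ := fun q => (q.1.1 + q.2.1, q.1.2 + q.2.2) with hΘ_def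
  have hΘc : Continuous Θ := by fun_prop
  have hΘ : Measurable Θ := hΘc.measurable
  set θ := Γ.map Θ with hθ_def
  set W := Θ '' K with hW_def
  have hW : IsCompact W := hK.image hΘc
  have hθW : θ Wᶜ = 0 := by
    rw [hθ_def, Measure.map_apply hΘ hW.measurableSet.compl]
    exact measure_mono_null (fun x hx hxK => hx ⟨x, hxK, rfl⟩) hΓK
  have hΓae : ∀ᵐ q ∂Γ, q ∈ K := by rw [ae_iff]; exact hΓK
  set Φ₀ : ℝ × ℝ → ℝ × ℝ := fun p => (α p.1, β p) with hΦ₀_def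
  set Φ₁ : ℝ × ℝ → ℝ × ℝ := fun p => (p.1 - α p.1, p.2 - β p) with hΦ₁_def
  have hΦ₀ : Measurable Φ₀ := by fun_prop
  have hΦ₁ : Measurable Φ₁ := by fun_prop
  have hΦ₀K : ∀ q ∈ K, Φ₀ (Θ q) = q.1 := fun q hq => Prod.ext (hαK q hq) (hβK q hq)
  have hΦ₁K : ∀ q ∈ K, Φ₁ (Θ q) = q.2 := fun q hq =>
    Prod.ext (by simp only [hΦ₁_def, hΘ_def]; rw [hαK q hq]; ring)
      (by simp only [hΦ₁_def, hΘ_def]; rw [hβK q hq]; ring)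
  have hm0 : θ.map Φ₀ = Γ.map Prod.fst := by
    rw [hθ_def, Measure.map_map hΦ₀ hΘ]
    exact Measure.map_congr (hΓae.mono hΦ₀K)
  have hm1 : θ.map Φ₁ = Γ.map Prod.snd := by
    rw [hθ_def, Measure.map_map hΦ₁ hΘ]
    exact Measure.map_congr (hΓae.mono hΦ₁K)
  have hbd0 : (θ.withDensity fun p => D₀ (Φ₀ p)) ≤
      volume.withDensity fun p => ENNReal.ofReal (a p.1) * ENNReal.ofReal (b p) := by
    refine withDensity_le_of_map_triangular_le hW hθW hα0 hα1 ham ha hβm hβ0 hβ1 hbm hb ?_ hD₀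
      (by rwa [hm0])
    intro S hSW hS
    have : (fun p => (p.1, β p)) '' S
        = (fun q : (ℝ × ℝ) × (ℝ × ℝ) => (q.1.1 + q.2.1, q.1.2)) '' (K ∩ Θ ⁻¹' S) := by
      ext x
      constructor
      · rintro ⟨p, hp, rfl⟩
        obtain ⟨q, hq, rfl⟩ := hSW hp
        exact ⟨q, ⟨hq, hp⟩, Prod.ext rfl (hβK q hq).symm⟩
      · rintro ⟨q, ⟨hq, hp⟩, rfl⟩
        exact ⟨Θ q, hp, Prod.ext rfl (hβK q hq)⟩
    rw [this]
    exact (hK.inter_right (hS.isClosed.preimage hΘc)).image (by fun_prop)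
  have hbd1 : (θ.withDensity fun p => D₁ (Φ₁ p)) ≤
      volume.withDensity fun p => ENNReal.ofReal (1 - a p.1) * ENNReal.ofReal (1 - b p) := by
    refine withDensity_le_of_map_triangular_le (α := fun w => w - α w) (a := fun w => 1 - a w)
      (β := fun p => p.2 - β p) (b := fun p => 1 - b p) hW hθW hα1 (by simpa using hα0)
      (by fun_prop) (ha.mono fun w hw => (hasDerivAt_id w).sub hw) (by fun_prop) hβ1
      (by simpa using hβ0) (by fun_prop) (fun w => (hb w).mono fun v hv => (hasDerivAt_id v).sub hv)
      ?_ hD₁ (by rwa [← hm1] at h1)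
    intro S hSW hS
    have : (fun p => (p.1, p.2 - β p)) '' S
        = (fun q : (ℝ × ℝ) × (ℝ × ℝ) => (q.1.1 + q.2.1, q.2.2)) '' (K ∩ Θ ⁻¹' S) := by
      ext x
      constructor
      · rintro ⟨p, hp, rfl⟩
        obtain ⟨q, hq, rfl⟩ := hSW hp
        exact ⟨q, ⟨hq, hp⟩, Prod.ext rfl (congrArg Prod.snd (hΦ₁K q hq)).symm⟩
      · rintro ⟨q, ⟨hq, hp⟩, rfl⟩
        have e : (Φ₁ (Θ q)).2 = q.2.2 := congrArg Prod.snd (hΦ₁K q hq)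
        exact ⟨Θ q, hp, Prod.ext rfl e⟩
    rw [this]
    exact (hK.inter_right (hS.isClosed.preimage hΘc)).image (by fun_prop)
  -- The interpolation in the coordinates `(w, v)`, and its diagonal derivatives.
  set d : ℝ → ℝ := fun w => w - α w - α w with hd_def
  set F : ℝ × ℝ → ℝ := fun p => curveY k c (d p.1) (β p) (p.2 - β p) t with hF_def
  set j : ℝ × ℝ → ℝ := fun p => curveY' k c (d p.1) (β p) (p.2 - β p) t (b p) with hj_def
  set αt : ℝ → ℝ := fun w => (1 - t) * α w + t * (w - α w) with hαt_def
  set at' : ℝ → ℝ := fun w => (1 - t) * a w + t * (1 - a w) with hat_def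
  have hFm : Measurable F := by unfold F curveY bumpE; fun_prop
  have hjm : Measurable j := by unfold j curveY' bumpE bumpE'; fun_prop
  have hatm : Measurable at' := by fun_prop
  have hWK : ∀ p ∈ W, k = 0 ∨ (|(p.2 - β p) - β p| ≤ |d p.1| ∧ 12 * k * |d p.1| ≤ 1 ∧
      36 * k * |β p + (p.2 - β p) - 2 * c| ≤ 1) := by
    rintro _ ⟨q, hq, rfl⟩
    refine hkK.imp_right fun h => ?_
    have e1 : α (q.1.1 + q.2.1) = q.1.1 := hαK q hq
    have e2 : β (q.1.1 + q.2.1, q.1.2 + q.2.2) = q.1.2 := hβK q hq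
    have := h q hq
    simp only [hΘ_def, hd_def, e1, e2, add_sub_cancel_left]
    exact this
  have hinterp : ∀ q ∈ K, interp k c t q = (αt (Θ q).1, F (Θ q)) := fun q hq => by
    have e1 : α (q.1.1 + q.2.1) = q.1.1 := hαK q hq
    have e2 : β (q.1.1 + q.2.1, q.1.2 + q.2.2) = q.1.2 := hβK q hq
    simp only [interp, hαt_def, hF_def, hΘ_def, hd_def, e1, e2, add_sub_cancel_left]
  have hmean : (θ.withDensity fun p => cdMean N t (D₀ (Φ₀ p)) (D₁ (Φ₁ p))) ≤
      (volume.restrict W).withDensity fun p => ENNReal.ofReal (at' p.1) * ENNReal.ofReal (j p) := by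
    have hres : ∀ {D : ℝ × ℝ → ℝ≥0∞} {J : ℝ × ℝ → ℝ≥0∞}, θ.withDensity D ≤ volume.withDensity J →
        θ.withDensity D ≤ (volume.restrict W).withDensity J := fun {D J} h => by
      rw [← restrict_withDensity hW.measurableSet]
      have h2 : θ.withDensity D = (θ.withDensity D).restrict W := by
        symm
        apply Measure.restrict_eq_self_of_ae_mem
        rw [ae_iff]
        exact withDensity_absolutelyContinuous _ _ hθW
      rw [h2]
      exact Measure.restrict_mono subset_rfl h
    refine withDensity_cdMean_le (by linarith) (by fun_prop) (by fun_prop) (by fun_prop)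
      (by fun_prop) (by fun_prop) (hres hbd0) (hres hbd1) ?_
    rw [ae_restrict_iff' hW.measurableSet]
    filter_upwards with p hp
    refine cdMean_le_mul hN ht.le ht'.le (ha₀0 _) (hb0 _) (by linarith [ha₀1 (0, p.1)])
      (by linarith [hb1 p]) (curveY'_ge hk (hb0 p) (hb1 p) ht.le ht'.le ?_)
    rcases hWK p hp with h | h
    · simp [h]
    · exact h.2.2
  have hmap : (Γ.withDensity fun q => cdMean N t (D₀ q.1) (D₁ q.2)).map (interp k c t)
      = (θ.withDensity fun p => cdMean N t (D₀ (Φ₀ p)) (D₁ (Φ₁ p))).map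
        (fun p => (αt p.1, F p)) := by
    have e1 : (Γ.withDensity fun q => cdMean N t (D₀ q.1) (D₁ q.2))
        = Γ.withDensity fun q => cdMean N t (D₀ (Φ₀ (Θ q))) (D₁ (Φ₁ (Θ q))) := by
      refine withDensity_congr_ae (hΓae.mono fun q hq => ?_)
      simp only [hΦ₀K q hq, hΦ₁K q hq]
    have e2 : (fun q => cdMean N t (D₀ (Φ₀ (Θ q))) (D₁ (Φ₁ (Θ q))))
        = fun q => (fun p => cdMean N t (D₀ (Φ₀ p)) (D₁ (Φ₁ p))) (Θ q) := rfl
    rw [hθ_def, ← map_withDensity_comp Γ hΘ (by fun_prop), Measure.map_map (by fun_prop) hΘ, e1]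
    refine Measure.map_congr ?_
    exact (withDensity_absolutelyContinuous Γ _).ae_le (hΓae.mono hinterp)
  rw [hmap]
  refine (Measure.map_mono hmean (by fun_prop)).trans (Measure.le_iff.2 fun T hT => ?_)
  have hΦt : Measurable fun p => (αt p.1, F p) := by fun_prop
  rw [Measure.map_apply hΦt hT, withDensity_apply _ (hΦt hT), Measure.restrict_restrict (hΦt hT)]
  refine setLIntegral_triangular_le hatm ?_ ?_ hjm ((hΦt hT).inter hW.measurableSet) hT ?_ ?_
    fun p hp => hp.1
  · exact (hα0.const_mul (by linarith)).add (hα1.const_mul ht.le)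
  · filter_upwards [ha] with w hw
    exact (hw.const_mul (1 - t)).add (((hasDerivAt_id w).sub hw).const_mul t)
  · intro w v hv v' hv' hvv'
    have m0 := hβ0 w hvv'
    have m1 := hβ1 w hvv'
    simp only at m0 m1
    have hnn : 0 ≤ ((1 - t) * (β (w, v') - β (w, v)) + t * (v' - β (w, v') - (v - β (w, v)))) := by
      apply add_nonneg <;> apply mul_nonneg <;> linarith
    rcases hWK _ hv.2 with h | h
    · simp only [hF_def, curveY, h]
      linarith
    · rcases hWK _ hv'.2 with h' | h'
      · simp only [hF_def, curveY, h']
        linarith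
      · have := curveY_mono (t := t) hk h.2.1 h'.2.2 ht.le ht'.le h.1 h'.1 m0 m1
        simp only [hF_def]
        linarith
  · intro w
    filter_upwards [hb w] with v hv _
    exact hasDerivAt_curveY k c (d w) t hv

/-! ### Lexicographically optimal couplings -/

/-- The square of the `l^∞`-distance of a pair of points of the plane. -/
def maxCost (q : (ℝ × ℝ) × (ℝ × ℝ)) : ℝ := dist q.1 q.2 ^ 2

/-- The square of the Euclidean distance of a pair of points of the plane. -/
def sumCost (q : (ℝ × ℝ) × (ℝ × ℝ)) : ℝ := (q.2.1 - q.1.1) ^ 2 + (q.2.2 - q.1.2) ^ 2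

@[fun_prop]
lemma continuous_maxCost : Continuous maxCost := by unfold maxCost; fun_prop

@[fun_prop]
lemma continuous_sumCost : Continuous sumCost := by unfold sumCost; fun_prop

lemma maxCost_nonneg (q : (ℝ × ℝ) × (ℝ × ℝ)) : 0 ≤ maxCost q := sq_nonneg _

lemma sumCost_nonneg (q : (ℝ × ℝ) × (ℝ × ℝ)) : 0 ≤ sumCost q := by unfold sumCost; positivity

/-- Among the couplings of its marginals, `Γ` minimizes `maxCost`, and among the minimizers of
`maxCost` it minimizes `sumCost`. -/
structure IsLexOptimal (Γ : Measure ((ℝ × ℝ) × (ℝ × ℝ))) : Prop where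
  isProb : IsProbabilityMeasure Γ
  max_ne_top : ∫⁻ q, ENNReal.ofReal (maxCost q) ∂Γ ≠ ⊤
  sum_ne_top : ∫⁻ q, ENNReal.ofReal (sumCost q) ∂Γ ≠ ⊤
  max_le : ∀ Γ' : Measure ((ℝ × ℝ) × (ℝ × ℝ)), IsCoupling Γ' (Γ.map Prod.fst) (Γ.map Prod.snd) →
    ∫⁻ q, ENNReal.ofReal (maxCost q) ∂Γ ≤ ∫⁻ q, ENNReal.ofReal (maxCost q) ∂Γ'
  sum_le : ∀ Γ' : Measure ((ℝ × ℝ) × (ℝ × ℝ)), IsCoupling Γ' (Γ.map Prod.fst) (Γ.map Prod.snd) →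
    ∫⁻ q, ENNReal.ofReal (maxCost q) ∂Γ' = ∫⁻ q, ENNReal.ofReal (maxCost q) ∂Γ →
    ∫⁻ q, ENNReal.ofReal (sumCost q) ∂Γ ≤ ∫⁻ q, ENNReal.ofReal (sumCost q) ∂Γ'

/-- Successive minimization of two continuous functions on a compact set. -/
lemma IsCompact.exists_lex_min {X : Type*} [TopologicalSpace X] {K : Set X} (hK : IsCompact K)
    (hne : K.Nonempty) {f g : X → ℝ≥0∞} (hf : Continuous f) (hg : Continuous g) :
    ∃ x ∈ K, (∀ y ∈ K, f x ≤ f y) ∧ ∀ y ∈ K, f y = f x → g x ≤ g y := by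
  obtain ⟨x₀, hx₀, hmin⟩ := hK.exists_isMinOn hne hf.continuousOn
  have hK' : IsCompact (K ∩ {x | f x ≤ f x₀}) :=
    hK.inter_right (isClosed_le hf continuous_const)
  obtain ⟨x, hx, hmin'⟩ := hK'.exists_isMinOn ⟨x₀, hx₀, (le_rfl : f x₀ ≤ f x₀)⟩ hg.continuousOn
  have hx0 : ∀ y ∈ K, f x₀ ≤ f y := fun y hy => hmin hy
  have hx1 : f x ≤ f x₀ := hx.2
  exact ⟨x, hx.1, fun y hy => hx1.trans (hx0 y hy), fun y hy he =>
    hmin' ⟨hy, (he.le.trans hx1 : f y ≤ f x₀)⟩⟩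

/-- Measures on a compact set have a lexicographically optimal coupling, because the set of their
couplings is weakly compact and both costs are weakly continuous on it. -/
theorem exists_isLexOptimal {μ₀ μ₁ : Measure (ℝ × ℝ)} [IsProbabilityMeasure μ₀]
    [IsProbabilityMeasure μ₁] {K : Set (ℝ × ℝ)} (hK : IsCompact K) (h0 : μ₀ Kᶜ = 0)
    (h1 : μ₁ Kᶜ = 0) :
    ∃ Γ, IsLexOptimal Γ ∧ IsCoupling Γ μ₀ μ₁ := by
  have hKK : IsCompact (K ×ˢ K) := hK.prod hK
  have hcpl : ∀ Γ : Measure ((ℝ × ℝ) × (ℝ × ℝ)), IsCoupling Γ μ₀ μ₁ → Γ (K ×ˢ K)ᶜ = 0 := by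
    rintro Γ ⟨hm0, hm1⟩
    have hKm := hK.measurableSet
    rw [← hm0, Measure.map_apply measurable_fst hKm.compl] at h0
    rw [← hm1, Measure.map_apply measurable_snd hKm.compl] at h1
    refine measure_mono_null (t := Prod.fst ⁻¹' Kᶜ ∪ Prod.snd ⁻¹' Kᶜ) ?_ (measure_union_null h0 h1)
    intro q hq
    by_contra h
    simp only [mem_union, mem_preimage, mem_compl_iff, not_or, not_not] at h
    exact hq ⟨h.1, h.2⟩
  -- Replace the costs by bounded ones that agree with them on `K × K`.
  have hbdd : ∀ f : (ℝ × ℝ) × (ℝ × ℝ) → ℝ, Continuous f → (∀ q, 0 ≤ f q) →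
      ∃ F : BoundedContinuousFunction ((ℝ × ℝ) × (ℝ × ℝ)) NNReal, ∀ q ∈ K ×ˢ K,
        (F q : ℝ≥0∞) = ENNReal.ofReal (f q) := by
    intro f hf hf0
    obtain ⟨M, hM⟩ := hKK.bddAbove_image hf.continuousOn
    refine ⟨BoundedContinuousFunction.mkOfBound ⟨fun q => min (Real.toNNReal (f q))
      (Real.toNNReal M), (continuous_real_toNNReal.comp hf).min continuous_const⟩
      (Real.toNNReal M) fun q q' => ?_, fun q hq => ?_⟩
    · have h1 : (min (Real.toNNReal (f q)) (Real.toNNReal M) : NNReal) ≤ Real.toNNReal M :=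
        min_le_right _ _
      have h2 : (min (Real.toNNReal (f q')) (Real.toNNReal M) : NNReal) ≤ Real.toNNReal M :=
        min_le_right _ _
      rw [NNReal.dist_eq, abs_le]
      have h3 := NNReal.coe_le_coe.2 h1
      have h4 := NNReal.coe_le_coe.2 h2
      have h5 := NNReal.coe_nonneg (min (Real.toNNReal (f q)) (Real.toNNReal M))
      have h6 := NNReal.coe_nonneg (min (Real.toNNReal (f q')) (Real.toNNReal M))
      constructor
      · exact (neg_le_neg h4).trans (by simp only [ContinuousMap.coe_mk]; linarith)
      · exact le_trans (by simp only [ContinuousMap.coe_mk]; linarith) h3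
    · have : f q ≤ M := hM ⟨q, hq, rfl⟩
      change ((min (Real.toNNReal (f q)) (Real.toNNReal M) : NNReal) : ℝ≥0∞) = _
      rw [min_eq_left (Real.toNNReal_le_toNNReal this)]
      rfl
  obtain ⟨Fc, hFc⟩ := hbdd maxCost continuous_maxCost maxCost_nonneg
  obtain ⟨Fs, hFs⟩ := hbdd sumCost continuous_sumCost sumCost_nonneg
  have hint : ∀ {f : (ℝ × ℝ) × (ℝ × ℝ) → ℝ} {F : BoundedContinuousFunction _ NNReal},
      (∀ q ∈ K ×ˢ K, (F q : ℝ≥0∞) = ENNReal.ofReal (f q)) →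
      ∀ Γ : Measure ((ℝ × ℝ) × (ℝ × ℝ)), IsCoupling Γ μ₀ μ₁ →
        ∫⁻ q, ENNReal.ofReal (f q) ∂Γ = ∫⁻ q, F q ∂Γ := by
    intro f F hF Γ hΓ
    refine lintegral_congr_ae ?_
    have : ∀ᵐ q ∂Γ, q ∈ K ×ˢ K := by rw [ae_iff]; exact hcpl Γ hΓ
    exact this.mono fun q hq => (hF q hq).symm
  have hprob : ∀ Γ : Measure ((ℝ × ℝ) × (ℝ × ℝ)), IsCoupling Γ μ₀ μ₁ → IsProbabilityMeasure Γ := by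
    rintro Γ ⟨hm0, hm1⟩
    constructor
    have := measure_univ (μ := μ₀)
    rwa [← hm0, Measure.map_apply measurable_fst MeasurableSet.univ, preimage_univ] at this
  set C : Set (ProbabilityMeasure ((ℝ × ℝ) × (ℝ × ℝ))) :=
    {Γ | IsCoupling (Γ : Measure ((ℝ × ℝ) × (ℝ × ℝ))) μ₀ μ₁} with hC
  have hCcl : IsClosed C := by
    let ν₀ : ProbabilityMeasure (ℝ × ℝ) := ⟨μ₀, inferInstance⟩
    let ν₁ : ProbabilityMeasure (ℝ × ℝ) := ⟨μ₁, inferInstance⟩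
    have e : C = {Γ | Γ.map measurable_fst.aemeasurable = ν₀} ∩
        {Γ | Γ.map measurable_snd.aemeasurable = ν₁} := by
      ext Γ
      exact ⟨fun h => ⟨Subtype.ext h.1, Subtype.ext h.2⟩,
        fun h => ⟨congrArg Subtype.val h.1, congrArg Subtype.val h.2⟩⟩
    rw [e]
    exact (isClosed_eq (ProbabilityMeasure.continuous_map continuous_fst) continuous_const).inter
      (isClosed_eq (ProbabilityMeasure.continuous_map continuous_snd) continuous_const)
  have hCcpt : IsCompact C := by
    have := isCompact_setOfPred_probabilityMeasure_mass_eq_compl_isCompact_le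
      (E := (ℝ × ℝ) × (ℝ × ℝ)) (u := fun _ => 0) (K := fun _ => K ×ˢ K) tendsto_const_nhds
      (fun _ => hKK) (Or.inl inferInstance)
    refine this.of_isClosed_subset hCcl fun Γ hΓ n => ?_
    have h := hcpl _ hΓ
    rw [← ENNReal.coe_le_coe, ProbabilityMeasure.ennreal_coeFn_eq_coeFn_toMeasure, h]
    exact bot_le
  have hCne : C.Nonempty := by
    refine ⟨⟨μ₀.prod μ₁, inferInstance⟩, ?_, ?_⟩
    · exact (Measure.map_fst_prod).trans (by simp)
    · exact (Measure.map_snd_prod).trans (by simp)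
  obtain ⟨Γ, hΓ, hmin, hlex⟩ := hCcpt.exists_lex_min hCne
    (ProbabilityMeasure.continuous_lintegral_boundedContinuousFunction Fc)
    (ProbabilityMeasure.continuous_lintegral_boundedContinuousFunction Fs)
  have hΓ' : IsCoupling (Γ : Measure ((ℝ × ℝ) × (ℝ × ℝ))) μ₀ μ₁ := hΓ
  have hfin : ∀ F : BoundedContinuousFunction ((ℝ × ℝ) × (ℝ × ℝ)) NNReal,
      ∫⁻ q, F q ∂(Γ : Measure ((ℝ × ℝ) × (ℝ × ℝ))) ≠ ⊤ := fun F =>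
    (BoundedContinuousFunction.lintegral_lt_top_of_nnreal _ F).ne
  refine ⟨Γ, ⟨inferInstance, ?_, ?_, ?_, ?_⟩, hΓ'⟩
  · rw [hint hFc _ hΓ']; exact hfin _
  · rw [hint hFs _ hΓ']; exact hfin _
  · intro Γ' hc
    rw [hΓ'.1, hΓ'.2] at hc
    have := hprob Γ' hc
    rw [hint hFc _ hΓ', hint hFc _ hc]
    exact hmin ⟨Γ', this⟩ hc
  · intro Γ' hc he
    rw [hΓ'.1, hΓ'.2] at hc
    have := hprob Γ' hc
    rw [hint hFc _ hΓ', hint hFc _ hc] at he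
    rw [hint hFs _ hΓ', hint hFs _ hc]
    exact hlex ⟨Γ', this⟩ hc he

/-- Exchange of the targets of two pairs. -/
def swapTarget (z : ((ℝ × ℝ) × (ℝ × ℝ)) × ((ℝ × ℝ) × (ℝ × ℝ))) : (ℝ × ℝ) × (ℝ × ℝ) :=
  (z.1.1, z.2.2)

@[fun_prop]
lemma continuous_swapTarget : Continuous swapTarget := by unfold swapTarget; fun_prop

/-- Exchanging targets according to a symmetric measure `η` on pairs of pairs, whose marginal is
part of a coupling, produces another coupling. -/
lemma exists_coupling_swap {Γ : Measure ((ℝ × ℝ) × (ℝ × ℝ))} [IsFiniteMeasure Γ]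
    {η : Measure (((ℝ × ℝ) × (ℝ × ℝ)) × ((ℝ × ℝ) × (ℝ × ℝ)))}
    (hsymm : η.map Prod.swap = η) (hle : η.map Prod.fst ≤ Γ) :
    ∃ Γ', IsCoupling Γ' (Γ.map Prod.fst) (Γ.map Prod.snd) ∧
      Γ' + η.map Prod.fst = Γ + η.map swapTarget := by
  have hsT : Measurable swapTarget := continuous_swapTarget.measurable
  have hfin : IsFiniteMeasure (η.map Prod.fst) := isFiniteMeasure_of_le Γ hle
  have hcancel : Γ - η.map Prod.fst + η.map Prod.fst = Γ := Measure.sub_add_cancel_of_le hle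
  have hf : (η.map swapTarget).map Prod.fst = (η.map Prod.fst).map Prod.fst := by
    rw [Measure.map_map measurable_fst hsT, Measure.map_map measurable_fst measurable_fst]
    rfl
  have hs : (η.map swapTarget).map Prod.snd = (η.map Prod.fst).map Prod.snd := by
    conv_rhs => rw [← hsymm]
    rw [Measure.map_map measurable_snd hsT, Measure.map_map measurable_fst measurable_swap,
      Measure.map_map measurable_snd (measurable_fst.comp measurable_swap)]
    rfl
  refine ⟨Γ - η.map Prod.fst + η.map swapTarget, ⟨?_, ?_⟩, ?_⟩
  · rw [Measure.map_add _ _ measurable_fst, hf, ← Measure.map_add _ _ measurable_fst, hcancel]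
  · rw [Measure.map_add _ _ measurable_snd, hs, ← Measure.map_add _ _ measurable_snd, hcancel]
  · rw [add_right_comm, hcancel]

/-- A symmetric measure integrates a function and its reflection to the same value. -/
lemma lintegral_add_swap {α : Type*} [MeasurableSpace α] {η : Measure (α × α)}
    (hsymm : η.map Prod.swap = η) {f : α × α → ℝ} (hf : Measurable f) (hf0 : ∀ z, 0 ≤ f z) :
    ∫⁻ z, ENNReal.ofReal (f z + f z.swap) ∂η = 2 * ∫⁻ z, ENNReal.ofReal (f z) ∂η := by
  have h1 : ∫⁻ z, ENNReal.ofReal (f z.swap) ∂η = ∫⁻ z, ENNReal.ofReal (f z) ∂η := by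
    conv_rhs => rw [← hsymm]
    rw [lintegral_map (by fun_prop) measurable_swap]
  simp_rw [fun z : α × α => ENNReal.ofReal_add (hf0 z) (hf0 z.swap)]
  rw [lintegral_add_left (by fun_prop), h1, two_mul]

lemma ae_eq_of_lintegral_ofReal_le {α : Type*} [MeasurableSpace α] {η : Measure α} {f g : α → ℝ}
    (hf : Measurable f) (hf0 : ∀ x, 0 ≤ f x) (hg0 : ∀ x, 0 ≤ g x)
    (hle : ∀ᵐ x ∂η, g x ≤ f x)
    (hi : ∫⁻ x, ENNReal.ofReal (f x) ∂η ≤ ∫⁻ x, ENNReal.ofReal (g x) ∂η)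
    (hfin : ∫⁻ x, ENNReal.ofReal (f x) ∂η ≠ ⊤) : ∀ᵐ x ∂η, g x = f x := by
  have h := ae_eq_of_ae_le_of_lintegral_le (hle.mono fun x hx => ENNReal.ofReal_le_ofReal hx)
    (ne_top_of_le_ne_top hfin (lintegral_mono_ae (hle.mono fun x hx => ENNReal.ofReal_le_ofReal hx)))
    (by fun_prop) hi
  filter_upwards [h] with x hx
  rwa [ENNReal.ofReal_eq_ofReal_iff (hg0 x) (hf0 x)] at hx

/-- Exchanging targets along `η` does not improve a cost that is minimal for `Γ`. -/
lemma ae_eq_of_swap_le {Γ Γ' : Measure ((ℝ × ℝ) × (ℝ × ℝ))}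
    {η : Measure (((ℝ × ℝ) × (ℝ × ℝ)) × ((ℝ × ℝ) × (ℝ × ℝ)))}
    (hsymm : η.map Prod.swap = η) (hle : η.map Prod.fst ≤ Γ)
    (hΓ' : Γ' + η.map Prod.fst = Γ + η.map swapTarget) {f : (ℝ × ℝ) × (ℝ × ℝ) → ℝ}
    (hf : Continuous f) (hf0 : ∀ q, 0 ≤ f q) (hfin : ∫⁻ q, ENNReal.ofReal (f q) ∂Γ ≠ ⊤)
    (hmin : ∫⁻ q, ENNReal.ofReal (f q) ∂Γ ≤ ∫⁻ q, ENNReal.ofReal (f q) ∂Γ')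
    (hη : ∀ᵐ z ∂η, f (swapTarget z) + f (swapTarget z.swap) ≤ f z.1 + f z.2) :
    (∀ᵐ z ∂η, f (swapTarget z) + f (swapTarget z.swap) = f z.1 + f z.2) ∧
      ∫⁻ q, ENNReal.ofReal (f q) ∂Γ' = ∫⁻ q, ENNReal.ofReal (f q) ∂Γ := by
  have hsT : Measurable swapTarget := continuous_swapTarget.measurable
  have hfm : Measurable f := hf.measurable
  have hI : ∫⁻ q, ENNReal.ofReal (f q) ∂Γ' + ∫⁻ z, ENNReal.ofReal (f z.1) ∂η
      = ∫⁻ q, ENNReal.ofReal (f q) ∂Γ + ∫⁻ z, ENNReal.ofReal (f (swapTarget z)) ∂η := by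
    have := congrArg (fun μ => ∫⁻ q, ENNReal.ofReal (f q) ∂μ) hΓ'
    simp only [lintegral_add_measure] at this
    rwa [lintegral_map (by fun_prop) measurable_fst, lintegral_map (by fun_prop) hsT] at this
  have hfin1 : ∫⁻ z, ENNReal.ofReal (f z.1) ∂η ≠ ⊤ := by
    refine ne_top_of_le_ne_top hfin ?_
    rw [← lintegral_map (f := fun q => ENNReal.ofReal (f q)) (by fun_prop) measurable_fst]
    exact lintegral_mono' hle le_rfl
  have h1 := lintegral_add_swap hsymm (f := fun z => f z.1) (by fun_prop) fun z => hf0 _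
  have h2 := lintegral_add_swap hsymm (f := fun z => f (swapTarget z)) (by fun_prop) fun z => hf0 _
  have hle1 : ∫⁻ z, ENNReal.ofReal (f z.1) ∂η ≤ ∫⁻ z, ENNReal.ofReal (f (swapTarget z)) ∂η := by
    by_contra hlt
    push Not at hlt
    have : ∫⁻ q, ENNReal.ofReal (f q) ∂Γ + ∫⁻ z, ENNReal.ofReal (f (swapTarget z)) ∂η
        < ∫⁻ q, ENNReal.ofReal (f q) ∂Γ' + ∫⁻ z, ENNReal.ofReal (f z.1) ∂η :=
      ENNReal.add_lt_add_of_le_of_lt hfin hmin hlt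
    exact this.ne hI.symm
  have hae : ∀ᵐ z ∂η, f (swapTarget z) + f (swapTarget z.swap) = f z.1 + f z.2 := by
    refine ae_eq_of_lintegral_ofReal_le (f := fun z => f z.1 + f z.2)
      (g := fun z => f (swapTarget z) + f (swapTarget z.swap)) (by fun_prop)
      (fun z => add_nonneg (hf0 _) (hf0 _)) (fun z => add_nonneg (hf0 _) (hf0 _)) hη ?_ ?_
    · simp only [Prod.fst_swap] at h1
      rw [h1, h2]
      gcongr
    · simp only [Prod.fst_swap] at h1
      rw [h1]
      exact ENNReal.mul_ne_top (by norm_num) hfin1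
  refine ⟨hae, ?_⟩
  have heq : ∫⁻ z, ENNReal.ofReal (f (swapTarget z)) ∂η = ∫⁻ z, ENNReal.ofReal (f z.1) ∂η := by
    simp only [Prod.fst_swap] at h1
    have : (2 : ℝ≥0∞) * ∫⁻ z, ENNReal.ofReal (f (swapTarget z)) ∂η
        = 2 * ∫⁻ z, ENNReal.ofReal (f z.1) ∂η := by
      rw [← h1, ← h2]
      exact lintegral_congr_ae (hae.mono fun z hz => by simp only [hz])
    exact (ENNReal.mul_right_inj (by norm_num) (by norm_num)).1 this
  rw [heq] at hI
  exact (ENNReal.add_left_inj hfin1).1 hI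

/-- An exchange of targets that does not increase `maxCost` preserves it, by optimality. -/
lemma IsLexOptimal.ae_max_eq {Γ : Measure ((ℝ × ℝ) × (ℝ × ℝ))} (hΓ : IsLexOptimal Γ)
    {η : Measure (((ℝ × ℝ) × (ℝ × ℝ)) × ((ℝ × ℝ) × (ℝ × ℝ)))}
    (hsymm : η.map Prod.swap = η) (hle : η.map Prod.fst ≤ Γ)
    (hη : ∀ᵐ z ∂η, maxCost (swapTarget z) + maxCost (swapTarget z.swap)
      ≤ maxCost z.1 + maxCost z.2) :
    ∀ᵐ z ∂η, maxCost (swapTarget z) + maxCost (swapTarget z.swap)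
      = maxCost z.1 + maxCost z.2 := by
  have := hΓ.isProb
  obtain ⟨Γ', hc, he⟩ := exists_coupling_swap hsymm hle
  exact (ae_eq_of_swap_le hsymm hle he continuous_maxCost maxCost_nonneg hΓ.max_ne_top
    (hΓ.max_le Γ' hc) hη).1

/-- An exchange of targets that increases neither of the costs preserves both of them: it produces
another minimizer of `maxCost`, so that the optimality for `sumCost` applies. -/
lemma IsLexOptimal.ae_sum_eq {Γ : Measure ((ℝ × ℝ) × (ℝ × ℝ))} (hΓ : IsLexOptimal Γ)
    {η : Measure (((ℝ × ℝ) × (ℝ × ℝ)) × ((ℝ × ℝ) × (ℝ × ℝ)))}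
    (hsymm : η.map Prod.swap = η) (hle : η.map Prod.fst ≤ Γ)
    (hη : ∀ᵐ z ∂η, maxCost (swapTarget z) + maxCost (swapTarget z.swap)
      ≤ maxCost z.1 + maxCost z.2)
    (hη' : ∀ᵐ z ∂η, sumCost (swapTarget z) + sumCost (swapTarget z.swap)
      ≤ sumCost z.1 + sumCost z.2) :
    ∀ᵐ z ∂η, sumCost (swapTarget z) + sumCost (swapTarget z.swap)
      = sumCost z.1 + sumCost z.2 := by
  have := hΓ.isProb
  obtain ⟨Γ', hc, he⟩ := exists_coupling_swap hsymm hle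
  have h1 := (ae_eq_of_swap_le hsymm hle he continuous_maxCost maxCost_nonneg hΓ.max_ne_top
    (hΓ.max_le Γ' hc) hη).2
  exact (ae_eq_of_swap_le hsymm hle he continuous_sumCost sumCost_nonneg hΓ.sum_ne_top
    (hΓ.sum_le Γ' hc h1) hη').1

/-! ### Monotonicity of lexicographically optimal couplings -/

lemma maxCost_eq (q : (ℝ × ℝ) × (ℝ × ℝ)) :
    maxCost q = max |q.2.1 - q.1.1| |q.2.2 - q.1.2| ^ 2 := by
  rw [maxCost, Prod.dist_eq, Real.dist_eq, Real.dist_eq, abs_sub_comm, abs_sub_comm q.1.2]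

lemma maxCost_eq_of_le {q : (ℝ × ℝ) × (ℝ × ℝ)} (h : |q.2.2 - q.1.2| ≤ |q.2.1 - q.1.1|) :
    maxCost q = (q.2.1 - q.1.1) ^ 2 := by
  rw [maxCost_eq, max_eq_left h, sq_abs]

/-- Exchanging the targets of two pairs in the support does not decrease the cost. -/
lemma IsLexOptimal.maxCost_add_le {Γ : Measure ((ℝ × ℝ) × (ℝ × ℝ))} (hΓ : IsLexOptimal Γ)
    {q q' : (ℝ × ℝ) × (ℝ × ℝ)} (hq : q ∈ Γ.support) (hq' : q' ∈ Γ.support) :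
    maxCost q + maxCost q' ≤ maxCost (q.1, q'.2) + maxCost (q'.1, q.2) := by
  have := hΓ.isProb
  set B : Set (((ℝ × ℝ) × (ℝ × ℝ)) × ((ℝ × ℝ) × (ℝ × ℝ))) :=
    {z | maxCost (swapTarget z) + maxCost (swapTarget z.swap) < maxCost z.1 + maxCost z.2} with hB
  have hBo : IsOpen B := isOpen_lt (by fun_prop) (by fun_prop)
  have hBm : MeasurableSet B := hBo.measurableSet
  have hBs : Prod.swap ⁻¹' B = B := by
    ext z
    simp only [hB, mem_preimage, mem_ofPred_eq, Prod.swap_swap, Prod.fst_swap, Prod.snd_swap]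
    rw [add_comm (maxCost z.2), add_comm (maxCost (swapTarget z.swap))]
  set η := (Γ.prod Γ).restrict B with hη
  have hsymm : η.map Prod.swap = η := by
    conv_lhs => rw [hη, ← hBs]
    rw [← Measure.restrict_map measurable_swap hBm, Measure.prod_swap]
  have hle : η.map Prod.fst ≤ Γ := by
    refine (Measure.map_mono Measure.restrict_le_self measurable_fst).trans ?_
    rw [Measure.map_fst_prod]
    simp
  have hlt : ∀ᵐ z ∂η, maxCost (swapTarget z) + maxCost (swapTarget z.swap)
      < maxCost z.1 + maxCost z.2 := ae_restrict_mem hBm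
  have heq := hΓ.ae_max_eq hsymm hle (hlt.mono fun z hz => hz.le)
  have hη0 : (Γ.prod Γ) B = 0 := by
    have : ∀ᵐ z ∂η, False := by
      filter_upwards [hlt, heq] with z h1 h2
      exact h1.ne h2
    rw [Filter.eventually_false_iff_eq_bot, ae_eq_bot] at this
    exact Measure.restrict_eq_zero.1 this
  by_contra hcon
  push Not at hcon
  have hmem : (q, q') ∈ B := hcon
  obtain ⟨U, V, hU, hV, hqU, hqV, hUV⟩ := isOpen_prod_iff.1 hBo q q' hmem
  have h1 : 0 < Γ U := (Measure.mem_support_iff_forall q).1 hq U (hU.mem_nhds hqU)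
  have h2 : 0 < Γ V := (Measure.mem_support_iff_forall q').1 hq' V (hV.mem_nhds hqV)
  have h3 := measure_mono_null hUV hη0
  rw [Measure.prod_prod] at h3
  exact (mul_ne_zero h1.ne' h2.ne') h3

/-- Grouping of the first and of the second coordinates of a pair of points. -/
def regroup (q : (ℝ × ℝ) × (ℝ × ℝ)) : (ℝ × ℝ) × (ℝ × ℝ) := ((q.1.1, q.2.1), (q.1.2, q.2.2))

@[fun_prop]
lemma measurable_regroup : Measurable regroup := by unfold regroup; fun_prop

/-- The set of pairs of displacements `(y, y')` over the same `x = (x₀, x₁)` that are crossing, and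
at most as large as the displacement `x`. -/
def crossingSet : Set ((ℝ × ℝ) × ((ℝ × ℝ) × (ℝ × ℝ))) :=
  {z | (z.2.1.1 - z.2.2.1) * (z.2.1.2 - z.2.2.2) < 0 ∧ |z.2.1.2 - z.2.1.1| ≤ |z.1.2 - z.1.1| ∧
    |z.2.2.2 - z.2.2.1| ≤ |z.1.2 - z.1.1|}

lemma measurableSet_crossingSet : MeasurableSet crossingSet := by
  have h1 : MeasurableSet {z : (ℝ × ℝ) × ((ℝ × ℝ) × (ℝ × ℝ)) |
      (z.2.1.1 - z.2.2.1) * (z.2.1.2 - z.2.2.2) < 0} :=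
    measurableSet_lt (by fun_prop) (by fun_prop)
  have h2 : MeasurableSet {z : (ℝ × ℝ) × ((ℝ × ℝ) × (ℝ × ℝ)) |
      |z.2.1.2 - z.2.1.1| ≤ |z.1.2 - z.1.1|} := measurableSet_le (by fun_prop) (by fun_prop)
  have h3 : MeasurableSet {z : (ℝ × ℝ) × ((ℝ × ℝ) × (ℝ × ℝ)) |
      |z.2.2.2 - z.2.2.1| ≤ |z.1.2 - z.1.1|} := measurableSet_le (by fun_prop) (by fun_prop)
  exact h1.inter (h2.inter h3)

/-- Uncrossing two displacements does not make them larger than the larger one of them. -/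
lemma abs_le_of_crossing {d y₀ y₁ y₀' y₁' : ℝ} (h : (y₀ - y₀') * (y₁ - y₁') < 0)
    (h1 : |y₁ - y₀| ≤ d) (h2 : |y₁' - y₀'| ≤ d) : |y₁' - y₀| ≤ d ∧ |y₁ - y₀'| ≤ d := by
  rw [abs_le] at h1 h2
  rw [abs_le, abs_le]
  rcases mul_neg_iff.1 h with ⟨ha, hb⟩ | ⟨ha, hb⟩ <;>
    exact ⟨⟨by linarith, by linarith⟩, ⟨by linarith, by linarith⟩⟩

/-- Independent copies of the second coordinates, given the first ones, almost surely do not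
cross: otherwise an exchange of targets decreases `sumCost` and preserves `maxCost`. -/
lemma IsLexOptimal.crossingSet_null {Γ : Measure ((ℝ × ℝ) × (ℝ × ℝ))} (hΓ : IsLexOptimal Γ)
    {Λ : Measure ((ℝ × ℝ) × (ℝ × ℝ))} [IsFiniteMeasure Λ] (hΛ : Λ.map regroup ≤ Γ) :
    (Λ.fst ⊗ₘ (Λ.condKernel ×ₖ Λ.condKernel)) crossingSet = 0 := by
  have := hΓ.isProb
  set κ := Λ.condKernel
  set η' := Λ.fst ⊗ₘ (κ ×ₖ κ) with hη'
  set T : (ℝ × ℝ) × ((ℝ × ℝ) × (ℝ × ℝ)) → ((ℝ × ℝ) × (ℝ × ℝ)) × ((ℝ × ℝ) × (ℝ × ℝ)) :=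
    fun z => (regroup (z.1, z.2.1), regroup (z.1, z.2.2)) with hT
  have hTm : Measurable T := by fun_prop
  set S : (ℝ × ℝ) × ((ℝ × ℝ) × (ℝ × ℝ)) → (ℝ × ℝ) × ((ℝ × ℝ) × (ℝ × ℝ)) :=
    fun z => (z.1, z.2.swap) with hS
  have hSm : Measurable S := by fun_prop
  have hη'S : η'.map S = η' := by
    ext s hs
    rw [Measure.map_apply hSm hs, hη', Measure.compProd_apply (hSm hs), Measure.compProd_apply hs]
    congr 1
    ext x
    rw [ProbabilityTheory.Kernel.prod_apply]
    conv_rhs => rw [← Measure.prod_swap]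
    rw [Measure.map_apply measurable_swap (measurable_prodMk_left hs)]
    rfl
  have hη'1 : η'.map (fun z => (z.1, z.2.1)) = Λ := by
    conv_rhs => rw [← Λ.disintegrate κ]
    ext s hs
    have hm : Measurable fun z : (ℝ × ℝ) × ((ℝ × ℝ) × (ℝ × ℝ)) => (z.1, z.2.1) := by fun_prop
    rw [Measure.map_apply hm hs, hη', Measure.compProd_apply (hm hs), Measure.compProd_apply hs]
    congr 1
    ext x
    rw [ProbabilityTheory.Kernel.prod_apply]
    have : Prod.mk x ⁻¹' ((fun z : (ℝ × ℝ) × ((ℝ × ℝ) × (ℝ × ℝ)) => (z.1, z.2.1)) ⁻¹' s)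
        = (Prod.mk x ⁻¹' s) ×ˢ univ := by
      ext z; simp
    rw [this, Measure.prod_prod, measure_univ, mul_one]
  have hCS : S ⁻¹' crossingSet = crossingSet := by
    ext z
    simp only [crossingSet, hS, mem_preimage, mem_ofPred_eq, Prod.fst_swap, Prod.snd_swap]
    rw [and_comm (a := |z.2.2.2 - z.2.2.1| ≤ |z.1.2 - z.1.1|)]
    have : (z.2.2.1 - z.2.1.1) * (z.2.2.2 - z.2.1.2) = (z.2.1.1 - z.2.2.1) * (z.2.1.2 - z.2.2.2) := by
      ring
    rw [this]
  set η := (η'.restrict crossingSet).map T with hη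
  have hsymm : η.map Prod.swap = η := by
    rw [hη, Measure.map_map measurable_swap hTm]
    have h1 : (η'.restrict crossingSet).map S = η'.restrict crossingSet := by
      conv_lhs => rw [← hCS]
      rw [← Measure.restrict_map hSm measurableSet_crossingSet, hη'S]
    conv_rhs => rw [← h1]
    rw [Measure.map_map hTm hSm]
    rfl
  have hle : η.map Prod.fst ≤ Γ := by
    rw [hη, Measure.map_map measurable_fst hTm]
    refine (Measure.map_mono Measure.restrict_le_self (measurable_fst.comp hTm)).trans ?_
    have : Prod.fst ∘ T = regroup ∘ fun z => (z.1, z.2.1) := rfl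
    rw [this, ← Measure.map_map measurable_regroup (by fun_prop), hη'1]
    exact hΛ
  have hmem : ∀ᵐ z ∂(η'.restrict crossingSet), z ∈ crossingSet :=
    ae_restrict_mem measurableSet_crossingSet
  have hmax : ∀ z ∈ crossingSet, maxCost (swapTarget (T z)) + maxCost (swapTarget (T z).swap)
      = maxCost (T z).1 + maxCost (T z).2 := by
    rintro z ⟨hz, h1, h2⟩
    obtain ⟨h3, h4⟩ := abs_le_of_crossing hz h1 h2
    rw [maxCost_eq_of_le (q := swapTarget (T z)) h3,
      maxCost_eq_of_le (q := swapTarget (T z).swap) h4, maxCost_eq_of_le (q := (T z).1) h1,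
      maxCost_eq_of_le (q := (T z).2) h2]
    rfl
  have hsum : ∀ z ∈ crossingSet, sumCost (swapTarget (T z)) + sumCost (swapTarget (T z).swap)
      < sumCost (T z).1 + sumCost (T z).2 := by
    rintro z ⟨hz, h1, h2⟩
    simp only [sumCost, swapTarget, hT, regroup, Prod.fst_swap, Prod.snd_swap]
    nlinarith
  have hae : ∀ {p : ((ℝ × ℝ) × (ℝ × ℝ)) × ((ℝ × ℝ) × (ℝ × ℝ)) → Prop}, MeasurableSet {z | p z} →
      (∀ z ∈ crossingSet, p (T z)) → ∀ᵐ z ∂η, p z := fun hp h => by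
    rw [hη, ae_map_iff hTm.aemeasurable hp]
    exact hmem.mono fun z hz => h z hz
  have heq := hΓ.ae_sum_eq hsymm hle
    (hae (measurableSet_le (by fun_prop) (by fun_prop)) fun z hz => (hmax z hz).le)
    (hae (measurableSet_le (by fun_prop) (by fun_prop)) fun z hz => (hsum z hz).le)
  rw [hη, ae_map_iff hTm.aemeasurable (measurableSet_eq_fun (by fun_prop) (by fun_prop))] at heq
  have : ∀ᵐ z ∂(η'.restrict crossingSet), False := by
    filter_upwards [hmem, heq] with z h1 h2
    exact (hsum z h1).ne h2
  rw [Filter.eventually_false_iff_eq_bot, ae_eq_bot] at this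
  exact Measure.restrict_eq_zero.1 this

/-- The set of pairs whose displacement is at least as large in the first coordinate as in the
second one. -/
def fstDominated : Set ((ℝ × ℝ) × (ℝ × ℝ)) := {q | |q.2.2 - q.1.2| ≤ |q.2.1 - q.1.1|}

lemma measurableSet_fstDominated : MeasurableSet fstDominated :=
  measurableSet_le (by fun_prop) (by fun_prop)

/-- Among the pairs with given first coordinates, the second coordinates are coupled
monotonically. -/
def FiberMonotone (S : Set ((ℝ × ℝ) × (ℝ × ℝ))) : Prop :=
  ∀ q ∈ S, ∀ q' ∈ S, q ∈ fstDominated → q' ∈ fstDominated → q.1.1 = q'.1.1 → q.2.1 = q'.2.1 →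
    0 ≤ (q.1.2 - q'.1.2) * (q.2.2 - q'.2.2)

/-- Almost every point of `A` lies in a fibre in which `A` is not negligible. -/
lemma ae_kernel_ne_zero {α β : Type*} [MeasurableSpace α] [MeasurableSpace β] {μ : Measure α}
    [SFinite μ] {κ : ProbabilityTheory.Kernel α β} [ProbabilityTheory.IsMarkovKernel κ]
    {A : Set (α × β)} (hA : MeasurableSet A) :
    ∀ᵐ z ∂(μ ⊗ₘ κ), z ∈ A → κ z.1 (Prod.mk z.1 ⁻¹' A) ≠ 0 := by
  have hm : Measurable fun z : α × β => κ z.1 (Prod.mk z.1 ⁻¹' A) :=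
    (ProbabilityTheory.Kernel.measurable_kernel_prodMk_left hA).comp measurable_fst
  have hset : MeasurableSet {z : α × β | z ∈ A → κ z.1 (Prod.mk z.1 ⁻¹' A) ≠ 0} := by
    have : {z : α × β | z ∈ A → κ z.1 (Prod.mk z.1 ⁻¹' A) ≠ 0}
        = Aᶜ ∪ ((fun z : α × β => κ z.1 (Prod.mk z.1 ⁻¹' A)) ⁻¹' {0}ᶜ) := by
      ext z; simp [imp_iff_not_or]
    rw [this]
    exact hA.compl.union (hm (measurableSet_singleton 0).compl)
  refine Measure.ae_compProd_of_ae_ae hset (Filter.Eventually.of_forall fun x => ?_)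
  by_cases h : κ x (Prod.mk x ⁻¹' A) = 0
  · have : ∀ᵐ y ∂(κ x), y ∉ Prod.mk x ⁻¹' A := by
      rw [ae_iff]; simp only [not_not]; exact h
    exact this.mono fun y hy hyA => (hy hyA).elim
  · exact Filter.Eventually.of_forall fun y _ => h

/-- The monotonicity on fibres holds on a set of full measure, although the fibres are null sets:
crossing pairs are separated by one of countably many pairs of quadrants with rational corners, and on
almost every fibre the conditional measure charges at most one quadrant of each pair. -/
lemma IsLexOptimal.exists_fiberMonotone {Γ : Measure ((ℝ × ℝ) × (ℝ × ℝ))} (hΓ : IsLexOptimal Γ) :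
    ∃ S, (∀ᵐ q ∂Γ, q ∈ S) ∧ FiberMonotone S := by
  have := hΓ.isProb
  set Λ := (Γ.restrict fstDominated).map regroup with hΛ
  have hΛle : Λ.map regroup ≤ Γ := by
    rw [hΛ, Measure.map_map measurable_regroup measurable_regroup]
    have : regroup ∘ regroup = id := rfl
    rw [this, Measure.map_id]
    exact Measure.restrict_le_self
  have hnull := hΓ.crossingSet_null hΛle
  set κ := Λ.condKernel
  -- The left upper and the right lower quadrants with rational corners. Points of `A₁ r` and of
  -- `A₂ r` over the same `x` cross.
  let A₁ : ℚ × ℚ → Set ((ℝ × ℝ) × (ℝ × ℝ)) := fun r =>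
    {z | z.2.1 < r.1 ∧ (r.2 : ℝ) < z.2.2 ∧ |z.2.2 - z.2.1| ≤ |z.1.2 - z.1.1|}
  let A₂ : ℚ × ℚ → Set ((ℝ × ℝ) × (ℝ × ℝ)) := fun r =>
    {z | (r.1 : ℝ) < z.2.1 ∧ z.2.2 < r.2 ∧ |z.2.2 - z.2.1| ≤ |z.1.2 - z.1.1|}
  have hD : MeasurableSet {z : (ℝ × ℝ) × (ℝ × ℝ) | |z.2.2 - z.2.1| ≤ |z.1.2 - z.1.1|} :=
    measurableSet_le (by fun_prop) (by fun_prop)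
  have hA₁ : ∀ r, MeasurableSet (A₁ r) := fun r => by
    have h1 : MeasurableSet {z : (ℝ × ℝ) × (ℝ × ℝ) | z.2.1 < r.1} :=
      measurableSet_lt (by fun_prop) (by fun_prop)
    have h2 : MeasurableSet {z : (ℝ × ℝ) × (ℝ × ℝ) | (r.2 : ℝ) < z.2.2} :=
      measurableSet_lt (by fun_prop) (by fun_prop)
    exact h1.inter (h2.inter hD)
  have hA₂ : ∀ r, MeasurableSet (A₂ r) := fun r => by
    have h1 : MeasurableSet {z : (ℝ × ℝ) × (ℝ × ℝ) | (r.1 : ℝ) < z.2.1} :=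
      measurableSet_lt (by fun_prop) (by fun_prop)
    have h2 : MeasurableSet {z : (ℝ × ℝ) × (ℝ × ℝ) | z.2.2 < r.2} :=
      measurableSet_lt (by fun_prop) (by fun_prop)
    exact h1.inter (h2.inter hD)
  have hx : ∀ᵐ x ∂Λ.fst, ∀ r, κ x (Prod.mk x ⁻¹' A₁ r) = 0 ∨ κ x (Prod.mk x ⁻¹' A₂ r) = 0 := by
    have h1 : ∀ᵐ z ∂(Λ.fst ⊗ₘ (κ ×ₖ κ)), z ∉ crossingSet := by rw [ae_iff]; simpa using hnull
    filter_upwards [Measure.ae_ae_of_ae_compProd h1] with x hx r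
    rw [ProbabilityTheory.Kernel.prod_apply, ae_iff] at hx
    have h2 : ((κ x).prod (κ x)) ((Prod.mk x ⁻¹' A₁ r) ×ˢ (Prod.mk x ⁻¹' A₂ r)) = 0 := by
      refine measure_mono_null ?_ hx
      rintro ⟨y, y'⟩ ⟨⟨h1, h2, h3⟩, ⟨h1', h2', h3'⟩⟩
      simp only [mem_ofPred_eq, not_not]
      exact ⟨mul_neg_of_neg_of_pos (by simp only at *; linarith) (by simp only at *; linarith),
        h3, h3'⟩
    rw [Measure.prod_prod] at h2
    exact mul_eq_zero.1 h2
  have hz : ∀ᵐ z ∂Λ, (∀ r, κ z.1 (Prod.mk z.1 ⁻¹' A₁ r) = 0 ∨ κ z.1 (Prod.mk z.1 ⁻¹' A₂ r) = 0) ∧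
      (∀ r, z ∈ A₁ r → κ z.1 (Prod.mk z.1 ⁻¹' A₁ r) ≠ 0) ∧
      (∀ r, z ∈ A₂ r → κ z.1 (Prod.mk z.1 ⁻¹' A₂ r) ≠ 0) := by
    have h1 : ∀ᵐ z ∂Λ, ∀ r, z ∈ A₁ r → κ z.1 (Prod.mk z.1 ⁻¹' A₁ r) ≠ 0 := by
      rw [ae_all_iff]; intro r
      have := ae_kernel_ne_zero (μ := Λ.fst) (κ := κ) (hA₁ r)
      rwa [Λ.disintegrate κ] at this
    have h2 : ∀ᵐ z ∂Λ, ∀ r, z ∈ A₂ r → κ z.1 (Prod.mk z.1 ⁻¹' A₂ r) ≠ 0 := by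
      rw [ae_all_iff]; intro r
      have := ae_kernel_ne_zero (μ := Λ.fst) (κ := κ) (hA₂ r)
      rwa [Λ.disintegrate κ] at this
    filter_upwards [ae_of_ae_map measurable_fst.aemeasurable hx, h1, h2] with z a b c
    exact ⟨a, b, c⟩
  have hq := ae_of_ae_map measurable_regroup.aemeasurable (hΛ ▸ hz)
  rw [ae_restrict_iff' measurableSet_fstDominated] at hq
  refine ⟨_, hq, ?_⟩
  -- Two crossing pairs are separated by rational quadrants.
  have key : ∀ q q' : (ℝ × ℝ) × (ℝ × ℝ),
      ((∀ r, κ (regroup q).1 (Prod.mk (regroup q).1 ⁻¹' A₁ r) = 0 ∨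
        κ (regroup q).1 (Prod.mk (regroup q).1 ⁻¹' A₂ r) = 0) ∧
      (∀ r, regroup q ∈ A₁ r → κ (regroup q).1 (Prod.mk (regroup q).1 ⁻¹' A₁ r) ≠ 0) ∧
      (∀ r, regroup q ∈ A₂ r → κ (regroup q).1 (Prod.mk (regroup q).1 ⁻¹' A₂ r) ≠ 0)) →
      ((∀ r, κ (regroup q').1 (Prod.mk (regroup q').1 ⁻¹' A₁ r) = 0 ∨
        κ (regroup q').1 (Prod.mk (regroup q').1 ⁻¹' A₂ r) = 0) ∧
      (∀ r, regroup q' ∈ A₁ r → κ (regroup q').1 (Prod.mk (regroup q').1 ⁻¹' A₁ r) ≠ 0) ∧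
      (∀ r, regroup q' ∈ A₂ r → κ (regroup q').1 (Prod.mk (regroup q').1 ⁻¹' A₂ r) ≠ 0)) →
      q ∈ fstDominated → q' ∈ fstDominated →
      q.1.1 = q'.1.1 → q.2.1 = q'.2.1 → q.1.2 < q'.1.2 → q'.2.2 < q.2.2 → False := by
    intro q q' hR hR' hqd hqd' e1 e2 hlt hlt'
    obtain ⟨r₁, hr₁, hr₁'⟩ := exists_rat_btwn hlt
    obtain ⟨r₂, hr₂, hr₂'⟩ := exists_rat_btwn hlt'
    have hx : (regroup q).1 = (regroup q').1 := Prod.ext e1 e2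
    have h1 := hR.2.1 (r₁, r₂) ⟨hr₁, hr₂', hqd⟩
    have h2 := hR'.2.2 (r₁, r₂) ⟨hr₁', hr₂, hqd'⟩
    rw [← hx] at h2
    rcases hR.1 (r₁, r₂) with h | h
    · exact h1 h
    · exact h2 h
  intro q hqS q' hqS' hqd hqd' e1 e2
  by_contra hneg
  push Not at hneg
  rcases mul_neg_iff.1 hneg with ⟨ha, hb⟩ | ⟨ha, hb⟩
  · exact key q' q (hqS' hqd') (hqS hqd) hqd' hqd e1.symm e2.symm (by linarith) (by linarith)
  · exact key q q' (hqS hqd) (hqS' hqd') hqd hqd' e1 e2 (by linarith) (by linarith)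

/-- Exchange of the two coordinates of the plane. -/
def swapCoord (q : (ℝ × ℝ) × (ℝ × ℝ)) : (ℝ × ℝ) × (ℝ × ℝ) := (q.1.swap, q.2.swap)

@[fun_prop]
lemma continuous_swapCoord : Continuous swapCoord := by unfold swapCoord; fun_prop

lemma maxCost_swapCoord (q : (ℝ × ℝ) × (ℝ × ℝ)) : maxCost (swapCoord q) = maxCost q := by
  rw [maxCost_eq, maxCost_eq, max_comm]; rfl

lemma sumCost_swapCoord (q : (ℝ × ℝ) × (ℝ × ℝ)) : sumCost (swapCoord q) = sumCost q := by
  simp only [sumCost, swapCoord, Prod.fst_swap, Prod.snd_swap]; ring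

lemma IsLexOptimal.map_swapCoord {Γ : Measure ((ℝ × ℝ) × (ℝ × ℝ))} (hΓ : IsLexOptimal Γ) :
    IsLexOptimal (Γ.map swapCoord) := by
  have := hΓ.isProb
  have hm : Measurable swapCoord := continuous_swapCoord.measurable
  have hinv : swapCoord ∘ swapCoord = id := rfl
  have hmax : ∀ Γ' : Measure ((ℝ × ℝ) × (ℝ × ℝ)), ∫⁻ q, ENNReal.ofReal (maxCost q) ∂(Γ'.map swapCoord)
      = ∫⁻ q, ENNReal.ofReal (maxCost q) ∂Γ' := fun Γ' => by
    rw [lintegral_map (by fun_prop) hm]; simp_rw [maxCost_swapCoord]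
  have hsum : ∀ Γ' : Measure ((ℝ × ℝ) × (ℝ × ℝ)), ∫⁻ q, ENNReal.ofReal (sumCost q) ∂(Γ'.map swapCoord)
      = ∫⁻ q, ENNReal.ofReal (sumCost q) ∂Γ' := fun Γ' => by
    rw [lintegral_map (by fun_prop) hm]; simp_rw [sumCost_swapCoord]
  have hcpl : ∀ Γ' : Measure ((ℝ × ℝ) × (ℝ × ℝ)),
      IsCoupling Γ' ((Γ.map swapCoord).map Prod.fst) ((Γ.map swapCoord).map Prod.snd) →
      IsCoupling (Γ'.map swapCoord) (Γ.map Prod.fst) (Γ.map Prod.snd) := by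
    rintro Γ' ⟨h0, h1⟩
    have e0 : Prod.fst ∘ swapCoord = Prod.swap ∘ Prod.fst := rfl
    have e1 : Prod.snd ∘ swapCoord = Prod.swap ∘ Prod.snd := rfl
    constructor
    · rw [Measure.map_map measurable_fst hm, e0, ← Measure.map_map measurable_swap measurable_fst, h0,
        Measure.map_map measurable_fst hm, Measure.map_map measurable_swap (measurable_fst.comp hm)]
      rfl
    · rw [Measure.map_map measurable_snd hm, e1, ← Measure.map_map measurable_swap measurable_snd, h1,
        Measure.map_map measurable_snd hm, Measure.map_map measurable_swap (measurable_snd.comp hm)]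
      rfl
  refine ⟨Measure.isProbabilityMeasure_map hm.aemeasurable, ?_, ?_, ?_, ?_⟩
  · rw [hmax]; exact hΓ.max_ne_top
  · rw [hsum]; exact hΓ.sum_ne_top
  · intro Γ' hc
    rw [hmax, ← hmax Γ']
    exact hΓ.max_le _ (hcpl Γ' hc)
  · intro Γ' hc he
    rw [hmax, ← hmax Γ'] at he
    rw [hsum, ← hsum Γ']
    exact hΓ.sum_le _ (hcpl Γ' hc) he

/-- The monotonicity properties of lexicographically optimal couplings: exchanging targets does not
decrease the cost, and among the pairs with given first coordinates the second coordinates are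
coupled monotonically, and the same holds with the coordinates exchanged. -/
structure LexMonotone (S : Set ((ℝ × ℝ) × (ℝ × ℝ))) : Prop where
  maxCost_add_le : ∀ q ∈ S, ∀ q' ∈ S,
    maxCost q + maxCost q' ≤ maxCost (q.1, q'.2) + maxCost (q'.1, q.2)
  fiber : FiberMonotone S
  fiber_swap : FiberMonotone (swapCoord ⁻¹' S)

/-- A lexicographically optimal coupling is concentrated on a monotone set: the first condition holds on
the support, the other two by `IsLexOptimal.exists_fiberMonotone`. -/
theorem IsLexOptimal.exists_lexMonotone {Γ : Measure ((ℝ × ℝ) × (ℝ × ℝ))} (hΓ : IsLexOptimal Γ) :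
    ∃ S, MeasurableSet S ∧ (∀ᵐ q ∂Γ, q ∈ S) ∧ LexMonotone S := by
  have := hΓ.isProb
  obtain ⟨S₁, hS₁, hm₁⟩ := hΓ.exists_fiberMonotone
  obtain ⟨S₂, hS₂, hm₂⟩ := hΓ.map_swapCoord.exists_fiberMonotone
  have hS₂' : ∀ᵐ q ∂Γ, swapCoord q ∈ S₂ :=
    ae_of_ae_map continuous_swapCoord.measurable.aemeasurable hS₂
  have hall : ∀ᵐ q ∂Γ, q ∈ Γ.support ∧ q ∈ S₁ ∧ swapCoord q ∈ S₂ := by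
    filter_upwards [Measure.support_mem_ae, hS₁, hS₂'] with q h1 h2 h3
    exact ⟨h1, h2, h3⟩
  obtain ⟨N, hN, hNm, hN0⟩ := exists_measurable_superset_of_null (ae_iff.1 hall)
  have hsub : ∀ q ∈ Nᶜ, q ∈ Γ.support ∧ q ∈ S₁ ∧ swapCoord q ∈ S₂ := fun q hq => by
    by_contra h; exact hq (hN h)
  refine ⟨Nᶜ, hNm.compl, ?_, ?_, ?_, ?_⟩
  · rw [ae_iff]; simpa using hN0
  · exact fun q hq q' hq' => hΓ.maxCost_add_le (hsub q hq).1 (hsub q' hq').1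
  · exact fun q hq q' hq' => hm₁ q (hsub q hq).2.1 q' (hsub q' hq').2.1
  · exact fun q hq q' hq' => hm₂ q (hsub _ hq).2.2 q' (hsub _ hq').2.2

/-! ### Injectivity of the interpolation -/

/-- The push vanishes, or it is at most half of the excess of the horizontal displacement over the
vertical one. -/
lemma interp_snd {k c : ℝ} {q : (ℝ × ℝ) × (ℝ × ℝ)} (hk : 0 ≤ k)
    (hq : 12 * k * |q.2.1 - q.1.1| ≤ 1 ∧ 36 * k * |q.1.2 + q.2.2 - 2 * c| ≤ 1) :
    ∃ B, (∀ t, (interp k c t q).2 = (1 - t) * q.1.2 + t * q.2.2 + t * (1 - t) * B) ∧ 0 ≤ B ∧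
      (|q.2.1 - q.1.1| ≤ |q.2.2 - q.1.2| → B = 0) ∧
      (|q.2.2 - q.1.2| ≤ |q.2.1 - q.1.1| → B ≤ (|q.2.1 - q.1.1| - |q.2.2 - q.1.2|) / 2) := by
  refine ⟨_, fun _ => rfl, ?_, fun h => ?_, fun h => (bump_bounds hk hq.1 hq.2 h).2⟩
  · rcases le_total |q.2.2 - q.1.2| |q.2.1 - q.1.1| with h | h
    · exact (bump_bounds hk hq.1 hq.2 h).1
    · rw [bumpE_eq_zero h]; simp
  · rw [bumpE_eq_zero h]; simp

/-- The vertical distances of the interpolating point from the end points are at most the fractions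
`t` and `1 - t` of the distance of the end points, strictly so if the displacement is larger in the
first coordinate. -/
lemma interp_bounds {k c t : ℝ} {q : (ℝ × ℝ) × (ℝ × ℝ)} (hk : 0 ≤ k)
    (hq : 12 * k * |q.2.1 - q.1.1| ≤ 1 ∧ 36 * k * |q.1.2 + q.2.2 - 2 * c| ≤ 1)
    (ht : 0 < t) (ht' : t < 1) :
    |(interp k c t q).2 - q.1.2| ≤ t * max |q.2.1 - q.1.1| |q.2.2 - q.1.2| ∧
    |q.2.2 - (interp k c t q).2| ≤ (1 - t) * max |q.2.1 - q.1.1| |q.2.2 - q.1.2| ∧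
    (|q.2.2 - q.1.2| < |q.2.1 - q.1.1| →
      |(interp k c t q).2 - q.1.2| < t * |q.2.1 - q.1.1| ∧
      |q.2.2 - (interp k c t q).2| < (1 - t) * |q.2.1 - q.1.1|) := by
  obtain ⟨B, hB, hB0, hB1, hB2⟩ := interp_snd hk hq
  rw [hB t]
  set δ := q.2.2 - q.1.2 with hδ
  set D := |q.2.1 - q.1.1|
  have e1 : (1 - t) * q.1.2 + t * q.2.2 + t * (1 - t) * B - q.1.2 = t * (δ + (1 - t) * B) := by
    rw [hδ]; ring
  have e2 : q.2.2 - ((1 - t) * q.1.2 + t * q.2.2 + t * (1 - t) * B) = (1 - t) * (δ - t * B) := by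
    rw [hδ]; ring
  have ht1 : 0 < 1 - t := by linarith
  rw [e1, e2, abs_mul, abs_mul, abs_of_pos ht, abs_of_pos ht1]
  have hδa := le_abs_self δ
  have hδb := neg_abs_le δ
  have b1 : (1 - t) * B ≤ B := by nlinarith
  have b2 : t * B ≤ B := by nlinarith
  have b3 : 0 ≤ (1 - t) * B := by positivity
  have b4 : 0 ≤ t * B := by positivity
  rcases lt_or_ge |δ| D with h | h
  · have h2 := hB2 h.le
    have s1 : |δ + (1 - t) * B| < D := by rw [abs_lt]; constructor <;> linarith
    have s2 : |δ - t * B| < D := by rw [abs_lt]; constructor <;> linarith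
    rw [max_eq_left h.le]
    exact ⟨by gcongr, by gcongr, fun _ => ⟨by gcongr, by gcongr⟩⟩
  · rw [hB1 h, max_eq_right h]
    simp only [mul_zero, add_zero, sub_zero, le_refl, true_and]
    exact fun h' => absurd h h'.not_ge

/-- Equality in the triangle inequality: a displacement `t * a` can only be completed to length `D` by
the rest of the displacement `a`. -/
lemma eq_of_abs_add_eq {t D a u : ℝ} (ht : 0 < t) (hD : 0 < D) (ha : |a| = D)
    (hu : |u| ≤ (1 - t) * D) (h : |t * a + u| = D) : u = (1 - t) * a := by
  obtain ⟨h1, h2⟩ := abs_le.1 hu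
  have htD : 0 < t * D := by positivity
  rcases abs_choice a with ha' | ha' <;> rcases abs_choice (t * a + u) with hb | hb <;>
    rw [ha'] at ha <;> rw [hb] at h
  · nlinarith
  · subst ha; linarith
  · have : a = -D := by linarith
    subst this; linarith
  · have : a = -D := by linarith
    subst this; linarith

lemma eq_zero_of_add_mul_le {t a b : ℝ} (ht : 0 < t) (ht' : t < 1) (ha : 0 ≤ a) (hb : 0 ≤ b)
    (h : ((1 - t) * a + t * b) / 4 ≤ 0) : a = 0 ∧ b = 0 := by
  have ht1 : 0 < 1 - t := by linarith
  have z0 := mul_nonneg ht1.le ha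
  have z1 := mul_nonneg ht.le hb
  exact ⟨(mul_eq_zero.1 (by linarith : (1 - t) * a = 0)).resolve_left ht1.ne',
    (mul_eq_zero.1 (by linarith : t * b = 0)).resolve_left ht.ne'⟩

lemma eq_eq_of_mul_nonneg {t a b : ℝ} (ht : 0 < t) (ht' : t < 1) (h : 0 ≤ a * b)
    (h0 : (1 - t) * a + t * b = 0) : a = 0 ∧ b = 0 := by
  have ht1 : 0 < 1 - t := by linarith
  have ha : a = 0 := by
    have : (1 - t) * a ^ 2 + t * (a * b) = 0 := by linear_combination a * h0
    have h2 : 0 ≤ t * (a * b) := by positivity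
    have h3 : 0 ≤ (1 - t) * a ^ 2 := by positivity
    have h4 : (1 - t) * a ^ 2 = 0 := by linarith
    rcases mul_eq_zero.1 h4 with h5 | h5
    · linarith
    · exact pow_eq_zero_iff (by norm_num) |>.1 h5
  refine ⟨ha, ?_⟩
  rw [ha] at h0
  rcases mul_eq_zero.1 (by linarith : t * b = 0) with h5 | h5
  · linarith
  · exact h5

/-- Pairs of a monotone set whose interpolating curves meet at an intermediate time have the same
length, also after exchanging targets. -/
lemma LexMonotone.max_eq {S : Set ((ℝ × ℝ) × (ℝ × ℝ))} (hS : LexMonotone S) {t : ℝ}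
    {q q' : (ℝ × ℝ) × (ℝ × ℝ)} (hqS : q ∈ S) (hqS' : q' ∈ S) {z : ℝ × ℝ}
    (ht : 0 < t) (ht' : t < 1)
    (h1 : dist q.1 z ≤ t * dist q.1 q.2) (h2 : dist z q.2 ≤ (1 - t) * dist q.1 q.2)
    (h1' : dist q'.1 z ≤ t * dist q'.1 q'.2) (h2' : dist z q'.2 ≤ (1 - t) * dist q'.1 q'.2) :
    dist q'.1 q'.2 = dist q.1 q.2 ∧ dist q.1 q'.2 = dist q.1 q.2 ∧ dist q'.1 q.2 = dist q.1 q.2 := by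
  have hc := hS.maxCost_add_le q hqS q' hqS'
  simp only [maxCost] at hc
  have ta := dist_triangle q.1 z q'.2
  have tb := dist_triangle q'.1 z q.2
  have p1 : 0 ≤ dist q.1 q'.2 := dist_nonneg
  have p2 : 0 ≤ dist q'.1 q.2 := dist_nonneg
  set D := dist q.1 q.2
  set D' := dist q'.1 q'.2
  set E := dist q.1 q'.2
  set E' := dist q'.1 q.2
  have hE : E ≤ t * D + (1 - t) * D' := by linarith
  have hE' : E' ≤ t * D' + (1 - t) * D := by linarith
  have sE : E ^ 2 ≤ (t * D + (1 - t) * D') ^ 2 := pow_le_pow_left₀ p1 hE 2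
  have sE' : E' ^ 2 ≤ (t * D' + (1 - t) * D) ^ 2 := pow_le_pow_left₀ p2 hE' 2
  have htt : 0 < t * (1 - t) := mul_pos ht (by linarith)
  have hD : t * (1 - t) * (D' - D) ^ 2 ≤ 0 := by nlinarith
  have hDD : D' = D := by
    have : (D' - D) ^ 2 = 0 := le_antisymm (by
      by_contra h; push Not at h; nlinarith [mul_pos htt h]) (sq_nonneg _)
    have := pow_eq_zero_iff (by norm_num) |>.1 this
    linarith
  rw [hDD] at hc hE hE'
  have hE2 : E ≤ D := by linarith
  have hE2' : E' ≤ D := by linarith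
  have p0 : 0 ≤ D := dist_nonneg
  refine ⟨hDD, le_antisymm hE2 ?_, le_antisymm hE2' ?_⟩
  · by_contra h; push Not at h
    nlinarith
  · by_contra h; push Not at h
    nlinarith

lemma dist_pair_eq (p p' : ℝ × ℝ) : dist p p' = max |p'.1 - p.1| |p'.2 - p.2| := by
  rw [Prod.dist_eq, Real.dist_eq, Real.dist_eq, abs_sub_comm, abs_sub_comm p.2]

lemma interp_dist {k c t : ℝ} {q : (ℝ × ℝ) × (ℝ × ℝ)} (hk : 0 ≤ k)
    (hq : 12 * k * |q.2.1 - q.1.1| ≤ 1 ∧ 36 * k * |q.1.2 + q.2.2 - 2 * c| ≤ 1)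
    (ht : 0 < t) (ht' : t < 1) :
    dist q.1 (interp k c t q) ≤ t * dist q.1 q.2 ∧
    dist (interp k c t q) q.2 ≤ (1 - t) * dist q.1 q.2 := by
  obtain ⟨h1, h2, -⟩ := interp_bounds hk hq ht ht'
  have e1 : (interp k c t q).1 - q.1.1 = t * (q.2.1 - q.1.1) := by simp only [interp]; ring
  have e2 : q.2.1 - (interp k c t q).1 = (1 - t) * (q.2.1 - q.1.1) := by simp only [interp]; ring
  rw [dist_pair_eq q.1 (interp k c t q), dist_pair_eq (interp k c t q) q.2, dist_pair_eq q.1 q.2,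
    e1, e2, abs_mul, abs_mul, abs_of_pos ht, abs_of_pos (by linarith : 0 < 1 - t)]
  have ht1 : 0 ≤ 1 - t := by linarith
  exact ⟨max_le (by gcongr; exact le_max_left _ _) h1, max_le (by gcongr; exact le_max_left _ _) h2⟩

/-- Two pairs whose curves meet coincide, if the displacement of one of them is strictly larger in the
first coordinate. All distances between sources and targets are equal, so that both pairs have the same
first coordinates, and the curves over them are ordered. -/
lemma LexMonotone.eq_of_fst_lt {S : Set ((ℝ × ℝ) × (ℝ × ℝ))} (hS : LexMonotone S) {k c t : ℝ}
    (hk : 0 ≤ k) (hsm : ∀ q ∈ S, 12 * k * |q.2.1 - q.1.1| ≤ 1 ∧ 36 * k * |q.1.2 + q.2.2 - 2 * c| ≤ 1)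
    (ht : 0 < t) (ht' : t < 1) {q q' : (ℝ × ℝ) × (ℝ × ℝ)} (hqS : q ∈ S) (hqS' : q' ∈ S)
    (he : interp k c t q = interp k c t q') (hlt : |q.2.2 - q.1.2| < |q.2.1 - q.1.1|) : q = q' := by
  have hd := interp_dist hk (hsm q hqS) ht ht'
  have hd' := interp_dist hk (hsm q' hqS') ht ht'
  obtain ⟨b1, b2, b3⟩ := interp_bounds hk (hsm q hqS) ht ht'
  obtain ⟨b1', b2', -⟩ := interp_bounds hk (hsm q' hqS') ht ht'
  obtain ⟨b3, b4⟩ := b3 hlt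
  rw [← he] at hd' b1' b2'
  obtain ⟨m1, m2, m3⟩ := hS.max_eq hqS hqS' ht ht' hd.1 hd.2 hd'.1 hd'.2
  rw [dist_pair_eq, dist_pair_eq q.1 q.2, max_eq_left hlt.le] at m1 m2 m3
  rw [m1] at b1' b2'
  have hx1 : (interp k c t q).1 = (1 - t) * q.1.1 + t * q.2.1 := rfl
  have hx1' : (interp k c t q).1 = (1 - t) * q'.1.1 + t * q'.2.1 := by rw [he]; rfl
  have hD : 0 < |q.2.1 - q.1.1| := (abs_nonneg _).trans_lt hlt
  set D := |q.2.1 - q.1.1| with hDdef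
  set z := interp k c t q
  have ht1 : 0 < 1 - t := by linarith
  have hle' : |q'.2.1 - q'.1.1| ≤ D := (le_max_left _ _).trans m1.le
  have x1eq : q'.2.1 = q.2.1 := by
    have hy : |q'.2.2 - q.1.2| < D := by
      have : q'.2.2 - q.1.2 = (q'.2.2 - z.2) + (z.2 - q.1.2) := by ring
      rw [this]
      exact (abs_add_le _ _).trans_lt (by linarith)
    have hx : |q'.2.1 - q.1.1| = D := by
      rcases max_choice |q'.2.1 - q.1.1| |q'.2.2 - q.1.2| with h | h <;> rw [h] at m2
      · exact m2
      · exact absurd m2 hy.ne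
    have hu : |q'.2.1 - z.1| ≤ (1 - t) * D := by
      have : q'.2.1 - z.1 = (1 - t) * (q'.2.1 - q'.1.1) := by rw [hx1']; ring
      rw [this, abs_mul, abs_of_pos ht1]
      gcongr
    have := eq_of_abs_add_eq ht hD (a := q.2.1 - q.1.1) rfl hu (by
      rw [← hx]; congr 1; rw [hx1]; ring)
    rw [hx1] at this; linarith
  have x0eq : q'.1.1 = q.1.1 := by
    have : (1 - t) * q'.1.1 = (1 - t) * q.1.1 := by rw [x1eq] at hx1'; linarith
    exact mul_left_cancel₀ ht1.ne' this
  have hdom' : |q'.2.2 - q'.1.2| ≤ |q'.2.1 - q'.1.1| := by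
    rw [x1eq, x0eq, ← hDdef, ← m1]; exact le_max_right _ _
  have hmono := hS.fiber q hqS q' hqS' hlt.le hdom' x0eq.symm x1eq.symm
  have hz2 : curveY k c (q.2.1 - q.1.1) q.1.2 q.2.2 t = curveY k c (q.2.1 - q.1.1) q'.1.2 q'.2.2 t := by
    have := congrArg Prod.snd he
    simp only [z, interp] at this
    rwa [x1eq, x0eq] at this
  have hyy : q.1.2 = q'.1.2 ∧ q.2.2 = q'.2.2 := by
    have hs := hsm q hqS
    have hs' := hsm q' hqS'
    rw [x1eq, x0eq] at hdom' hs'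
    have hor : (q.1.2 ≤ q'.1.2 ∧ q.2.2 ≤ q'.2.2) ∨ (q'.1.2 ≤ q.1.2 ∧ q'.2.2 ≤ q.2.2) := by
      rcases mul_nonneg_iff.1 hmono with ⟨a, b⟩ | ⟨a, b⟩
      · exact Or.inr ⟨by linarith, by linarith⟩
      · exact Or.inl ⟨by linarith, by linarith⟩
    rcases hor with ⟨a, b⟩ | ⟨a, b⟩
    · have := curveY_mono hk hs.1 hs'.2 ht.le ht'.le hlt.le hdom' a b
      obtain ⟨e0, e1⟩ := eq_zero_of_add_mul_le ht ht' (sub_nonneg.2 a) (sub_nonneg.2 b)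
        (this.trans (by linarith))
      exact ⟨by linarith, by linarith⟩
    · have := curveY_mono hk hs.1 hs.2 ht.le ht'.le hdom' hlt.le a b
      obtain ⟨e0, e1⟩ := eq_zero_of_add_mul_le ht ht' (sub_nonneg.2 a) (sub_nonneg.2 b)
        (this.trans (by linarith))
      exact ⟨by linarith, by linarith⟩
  exact Prod.ext (Prod.ext x0eq.symm hyy.1) (Prod.ext x1eq.symm hyy.2)

lemma interp_snd_of_le {k c t : ℝ} {q : (ℝ × ℝ) × (ℝ × ℝ)} (h : |q.2.1 - q.1.1| ≤ |q.2.2 - q.1.2|) :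
    (interp k c t q).2 = (1 - t) * q.1.2 + t * q.2.2 := by
  simp [interp, curveY, bumpE_eq_zero h]

/-- Two pairs whose curves meet coincide, if the displacement of one of them is strictly larger in the
second coordinate. -/
lemma LexMonotone.eq_of_snd_lt {S : Set ((ℝ × ℝ) × (ℝ × ℝ))} (hS : LexMonotone S) {k c t : ℝ}
    (hk : 0 ≤ k) (hsm : ∀ q ∈ S, 12 * k * |q.2.1 - q.1.1| ≤ 1 ∧ 36 * k * |q.1.2 + q.2.2 - 2 * c| ≤ 1)
    (ht : 0 < t) (ht' : t < 1) {q q' : (ℝ × ℝ) × (ℝ × ℝ)} (hqS : q ∈ S) (hqS' : q' ∈ S)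
    (he : interp k c t q = interp k c t q') (hlt : |q.2.1 - q.1.1| < |q.2.2 - q.1.2|) : q = q' := by
  have hd := interp_dist hk (hsm q hqS) ht ht'
  have hd' := interp_dist hk (hsm q' hqS') ht ht'
  obtain ⟨b1', b2', -⟩ := interp_bounds hk (hsm q' hqS') ht ht'
  rw [← he] at hd' b1' b2'
  obtain ⟨m1, m2, m3⟩ := hS.max_eq hqS hqS' ht ht' hd.1 hd.2 hd'.1 hd'.2
  rw [dist_pair_eq, dist_pair_eq q.1 q.2, max_eq_right hlt.le] at m1 m2 m3
  rw [m1] at b1' b2'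
  have hx1 : (interp k c t q).1 = (1 - t) * q.1.1 + t * q.2.1 := rfl
  have hx1' : (interp k c t q).1 = (1 - t) * q'.1.1 + t * q'.2.1 := by rw [he]; rfl
  have hy1 : (interp k c t q).2 = (1 - t) * q.1.2 + t * q.2.2 := interp_snd_of_le hlt.le
  have hD : 0 < |q.2.2 - q.1.2| := (abs_nonneg _).trans_lt hlt
  have hdist : |q'.2.1 - q'.1.1| ≤ |q.2.2 - q.1.2| := (le_max_left _ _).trans m1.le
  have ht1 : 0 < 1 - t := by linarith
  have hz0 : |(interp k c t q).1 - q.1.1| < t * |q.2.2 - q.1.2| := by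
    have : (interp k c t q).1 - q.1.1 = t * (q.2.1 - q.1.1) := by rw [hx1]; ring
    rw [this, abs_mul, abs_of_pos ht]
    gcongr
  have hz1 : |q.2.1 - (interp k c t q).1| < (1 - t) * |q.2.2 - q.1.2| := by
    have : q.2.1 - (interp k c t q).1 = (1 - t) * (q.2.1 - q.1.1) := by rw [hx1]; ring
    rw [this, abs_mul, abs_of_pos ht1]
    gcongr
  have hz1' : |q'.2.1 - (interp k c t q).1| ≤ (1 - t) * |q.2.2 - q.1.2| := by
    have : q'.2.1 - (interp k c t q).1 = (1 - t) * (q'.2.1 - q'.1.1) := by rw [hx1']; ring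
    rw [this, abs_mul, abs_of_pos ht1]
    gcongr
  have hz0' : |(interp k c t q).1 - q'.1.1| ≤ t * |q.2.2 - q.1.2| := by
    have : (interp k c t q).1 - q'.1.1 = t * (q'.2.1 - q'.1.1) := by rw [hx1']; ring
    rw [this, abs_mul, abs_of_pos ht]
    gcongr
  set D := |q.2.2 - q.1.2| with hDdef
  set z := interp k c t q
  have y1eq : q'.2.2 = q.2.2 := by
    have hx : |q'.2.1 - q.1.1| < D := by
      have : q'.2.1 - q.1.1 = (q'.2.1 - z.1) + (z.1 - q.1.1) := by ring
      rw [this]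
      exact (abs_add_le _ _).trans_lt (by linarith)
    have hy : |q'.2.2 - q.1.2| = D := by
      rcases max_choice |q'.2.1 - q.1.1| |q'.2.2 - q.1.2| with h | h <;> rw [h] at m2
      · exact absurd m2 hx.ne
      · exact m2
    have := eq_of_abs_add_eq ht hD (a := q.2.2 - q.1.2) rfl b2' (by
      rw [← hy]; congr 1; rw [hy1]; ring)
    rw [hy1] at this; linarith
  have y0eq : q'.1.2 = q.1.2 := by
    have hx : |q.2.1 - q'.1.1| < D := by
      have : q.2.1 - q'.1.1 = (q.2.1 - z.1) + (z.1 - q'.1.1) := by ring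
      rw [this]
      exact (abs_add_le _ _).trans_lt (by linarith)
    have hy : |q.2.2 - q'.1.2| = D := by
      rcases max_choice |q.2.1 - q'.1.1| |q.2.2 - q'.1.2| with h | h <;> rw [h] at m3
      · exact absurd m3 hx.ne
      · exact m3
    have := eq_of_abs_add_eq (t := 1 - t) ht1 hD (a := q.2.2 - q.1.2) rfl
      (u := z.2 - q'.1.2) (by simpa using b1') (by
        rw [← hy]; congr 1; rw [hy1]; ring)
    rw [hy1] at this; linarith
  have hdom' : |q'.2.1 - q'.1.1| ≤ |q'.2.2 - q'.1.2| := by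
    rw [y1eq, y0eq, ← hDdef]; exact hdist
  have hmono := hS.fiber_swap (swapCoord q) hqS (swapCoord q') hqS' hlt.le hdom' y0eq.symm y1eq.symm
  have hxx := eq_eq_of_mul_nonneg ht ht' hmono (by
    simp only [swapCoord, Prod.snd_swap]
    linarith)
  simp only [swapCoord, Prod.snd_swap] at hxx
  exact Prod.ext (Prod.ext (by linarith [hxx.1]) y0eq.symm) (Prod.ext (by linarith [hxx.2]) y1eq.symm)

/-- The interpolating curves of a monotone set do not meet at intermediate times. -/
theorem LexMonotone.injOn_interp {S : Set ((ℝ × ℝ) × (ℝ × ℝ))} (hS : LexMonotone S) {k c t : ℝ}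
    (hk : 0 ≤ k) (hsm : ∀ q ∈ S, 12 * k * |q.2.1 - q.1.1| ≤ 1 ∧ 36 * k * |q.1.2 + q.2.2 - 2 * c| ≤ 1)
    (ht : 0 < t) (ht' : t < 1) : InjOn (interp k c t) S := by
  intro q hqS q' hqS' he
  rcases lt_trichotomy |q.2.2 - q.1.2| |q.2.1 - q.1.1| with h | h | h
  · exact hS.eq_of_fst_lt hk hsm ht ht' hqS hqS' he h
  swap
  · exact hS.eq_of_snd_lt hk hsm ht ht' hqS hqS' he h
  rcases lt_trichotomy |q'.2.2 - q'.1.2| |q'.2.1 - q'.1.1| with h' | h' | h'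
  · exact (hS.eq_of_fst_lt hk hsm ht ht' hqS' hqS he.symm h').symm
  swap
  · exact (hS.eq_of_snd_lt hk hsm ht ht' hqS' hqS he.symm h').symm
  -- Both displacements are diagonal.
  have hd := interp_dist hk (hsm q hqS) ht ht'
  have hd' := interp_dist hk (hsm q' hqS') ht ht'
  rw [← he] at hd'
  obtain ⟨m1, m2, m3⟩ := hS.max_eq hqS hqS' ht ht' hd.1 hd.2 hd'.1 hd'.2
  rw [dist_pair_eq, dist_pair_eq q.1 q.2, h, max_self] at m1 m2
  rw [h', max_self] at m1
  have hx : (1 - t) * q.1.1 + t * q.2.1 = (1 - t) * q'.1.1 + t * q'.2.1 := congrArg Prod.fst he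
  have hy : (1 - t) * q.1.2 + t * q.2.2 = (1 - t) * q'.1.2 + t * q'.2.2 := by
    rw [← interp_snd_of_le (k := k) (c := c) h.ge, ← interp_snd_of_le (k := k) (c := c) h'.ge, he]
  have ht1 : 0 < 1 - t := by linarith
  have hfstcase : q'.2.1 - q'.1.1 = q.2.1 - q.1.1 → q = q' := fun hX => by
    have x0 : q'.1.1 = q.1.1 := by linear_combination -hx - t * hX
    have x1 : q'.2.1 = q.2.1 := by linarith
    have := eq_eq_of_mul_nonneg ht ht' (hS.fiber q hqS q' hqS' h.le h'.le x0.symm x1.symm)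
      (by linarith)
    exact Prod.ext (Prod.ext x0.symm (by linarith [this.1])) (Prod.ext x1.symm (by linarith [this.2]))
  rcases abs_eq_abs.1 m1 with hX | hX
  · exact hfstcase hX
  have hYabs : |q'.2.2 - q'.1.2| = |q.2.2 - q.1.2| := by rw [h, h', m1]
  rcases abs_eq_abs.1 hYabs with hY | hY
  · have y0 : q'.1.2 = q.1.2 := by linear_combination -hy - t * hY
    have y1 : q'.2.2 = q.2.2 := by linarith
    have := eq_eq_of_mul_nonneg ht ht' (hS.fiber_swap (swapCoord q) hqS (swapCoord q') hqS' h.ge h'.ge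
      y0.symm y1.symm) (by simp only [swapCoord, Prod.snd_swap]; linarith)
    simp only [swapCoord, Prod.snd_swap] at this
    exact Prod.ext (Prod.ext (by linarith [this.1]) y0.symm) (Prod.ext (by linarith [this.2]) y1.symm)
  · -- Opposite displacements: exchanging the targets shortens the distance.
    have e1 : q'.2.1 - q.1.1 = (2 * t - 1) * (q.2.1 - q.1.1) := by linear_combination -hx + (1 - t) * hX
    have e2 : q'.2.2 - q.1.2 = (2 * t - 1) * (q.2.2 - q.1.2) := by linear_combination -hy + (1 - t) * hY
    rw [e1, e2, abs_mul, abs_mul, h, max_self] at m2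
    have hlt : |2 * t - 1| < 1 := by rw [abs_lt]; constructor <;> linarith
    have h0 : |q.2.1 - q.1.1| = 0 := by
      by_contra hne
      have : 0 < |q.2.1 - q.1.1| := lt_of_le_of_ne (abs_nonneg _) (Ne.symm hne)
      nlinarith
    have := abs_eq_zero.1 h0
    exact hfstcase (by rw [hX, this, neg_zero])

/-! ### The interpolation inequality for monotone plans -/

/-- The interpolation inequality holds for all plans concentrated on a compact subset of `C`. -/
def InterpBound (k c t N : ℝ) (C : Set ((ℝ × ℝ) × (ℝ × ℝ))) : Prop :=
  ∀ K ⊆ C, IsCompact K → ∀ (Γ : Measure ((ℝ × ℝ) × (ℝ × ℝ))), IsFiniteMeasure Γ → Γ Kᶜ = 0 →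
    ∀ D₀ D₁ : ℝ × ℝ → ℝ≥0∞, Measurable D₀ → Measurable D₁ →
      (Γ.map Prod.fst).withDensity D₀ ≤ volume → (Γ.map Prod.snd).withDensity D₁ ≤ volume →
      (Γ.withDensity fun q => cdMean N t (D₀ q.1) (D₁ q.2)).map (interp k c t) ≤ volume

/-- The interpolation inequality, in coordinates in which the coupling is triangular. -/
lemma interpBound_of_homeomorph {k k' c t N : ℝ} {C : Set ((ℝ × ℝ) × (ℝ × ℝ))}
    (L : ℝ × ℝ ≃ₜ ℝ × ℝ) (hL : MeasurePreserving L volume volume)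
    (hfst : ∀ q ∈ C, ∀ q' ∈ C, 0 ≤ ((L q.1).1 - (L q'.1).1) * ((L q.2).1 - (L q'.2).1))
    (hsnd : ∀ q ∈ C, ∀ q' ∈ C, (L q.1).1 = (L q'.1).1 → (L q.2).1 = (L q'.2).1 →
      0 ≤ ((L q.1).2 - (L q'.1).2) * ((L q.2).2 - (L q'.2).2))
    (hint : ∀ q ∈ C, L (interp k c t q) = interp k' c t (L q.1, L q.2))
    (hk : 0 ≤ k') (hkK : k' = 0 ∨ ∀ q ∈ C, SmallPair k' c (L q.1, L q.2)) (ht : 0 < t) (ht' : t < 1)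
    (hN : 4 ≤ N) : InterpBound k c t N C := by
  intro K hKC hK Γ _ hΓK D₀ D₁ hD₀ hD₁ h0 h1
  have hLm : Measurable L := L.continuous.measurable
  have hLs : Measurable L.symm := L.symm.continuous.measurable
  set LL : (ℝ × ℝ) × (ℝ × ℝ) → (ℝ × ℝ) × (ℝ × ℝ) := fun q => (L q.1, L q.2) with hLL
  have hLLc : Continuous LL := by fun_prop
  have hLLm : Measurable LL := hLLc.measurable
  have hK' : IsCompact (LL '' K) := hK.image hLLc
  have hdom : ∀ (μ : Measure (ℝ × ℝ)) (D : ℝ × ℝ → ℝ≥0∞), Measurable D → μ.withDensity D ≤ volume →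
      (μ.map L).withDensity (fun x => D (L.symm x)) ≤ volume := fun μ D hD h => by
    have := map_withDensity_comp μ hLm (hD.comp hLs)
    simp only [Function.comp_def, Homeomorph.symm_apply_apply] at this
    rw [← this]
    exact (Measure.map_mono h hLm).trans hL.map_eq.le
  have key := map_interp_triangular_le (k := k') (c := c) (t := t) (N := N) hK' (Γ := Γ.map LL)
    (by
      rw [Measure.map_apply hLLm hK'.measurableSet.compl]
      refine measure_mono_null (fun q hq hqK => hq ⟨q, hqK, rfl⟩) hΓK)
    (by
      rintro _ ⟨q, hq, rfl⟩ _ ⟨q', hq', rfl⟩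
      exact hfst q (hKC hq) q' (hKC hq'))
    (by
      rintro _ ⟨q, hq, rfl⟩ _ ⟨q', hq', rfl⟩
      exact hsnd q (hKC hq) q' (hKC hq'))
    hk (hkK.imp_right fun h => by
      rintro _ ⟨q, hq, rfl⟩
      exact h q (hKC hq)) ht ht' hN (hD₀.comp hLs) (hD₁.comp hLs)
    (by
      have : (Γ.map LL).map Prod.fst = (Γ.map Prod.fst).map L := by
        rw [Measure.map_map measurable_fst hLLm, Measure.map_map hLm measurable_fst]; rfl
      rw [this]; exact hdom _ _ hD₀ h0)
    (by
      have : (Γ.map LL).map Prod.snd = (Γ.map Prod.snd).map L := by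
        rw [Measure.map_map measurable_snd hLLm, Measure.map_map hLm measurable_snd]; rfl
      rw [this]; exact hdom _ _ hD₁ h1)
  set H : (ℝ × ℝ) × (ℝ × ℝ) → ℝ≥0∞ := fun q => cdMean N t (D₀ q.1) (D₁ q.2) with hH
  rw [← map_withDensity_comp Γ hLLm (by fun_prop), Measure.map_map (by fun_prop) hLLm] at key
  simp only [hLL, Function.comp_apply, Homeomorph.symm_apply_apply] at key
  have hae : (interp k' c t ∘ fun q => (L q.1, L q.2)) =ᵐ[Γ.withDensity H] L ∘ interp k c t := by
    refine (withDensity_absolutelyContinuous Γ H).ae_le ?_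
    have : ∀ᵐ q ∂Γ, q ∈ K := mem_ae_iff.2 hΓK
    filter_upwards [this] with q hq
    exact (hint q (hKC hq)).symm
  rw [Measure.map_congr hae, ← Measure.map_map hLm (by fun_prop)] at key
  have key2 := Measure.map_mono key hLs
  rw [Measure.map_map hLs hLm, L.symm_comp_self, Measure.map_id] at key2
  refine key2.trans (le_of_eq ?_)
  conv_lhs => rw [← hL.map_eq]
  rw [Measure.map_map hLs hLm, L.symm_comp_self, Measure.map_id]

lemma withDensity_mono_left {α : Type*} [MeasurableSpace α] {μ ν : Measure α} (h : μ ≤ ν)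
    (f : α → ℝ≥0∞) : μ.withDensity f ≤ ν.withDensity f := by
  refine Measure.le_iff.2 fun s hs => ?_
  rw [withDensity_apply _ hs, withDensity_apply _ hs]
  exact lintegral_mono' (Measure.restrict_mono_measure h s) le_rfl

/-- Passage from compact sets to measurable ones. -/
lemma InterpBound.map_le {k c t N : ℝ} {C : Set ((ℝ × ℝ) × (ℝ × ℝ))} (h : InterpBound k c t N C)
    (hC : MeasurableSet C) {Γ : Measure ((ℝ × ℝ) × (ℝ × ℝ))} [IsFiniteMeasure Γ] (hΓ : Γ Cᶜ = 0)
    {D₀ D₁ : ℝ × ℝ → ℝ≥0∞} (hD₀ : Measurable D₀) (hD₁ : Measurable D₁)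
    (h0 : (Γ.map Prod.fst).withDensity D₀ ≤ volume) (h1 : (Γ.map Prod.snd).withDensity D₁ ≤ volume) :
    (Γ.withDensity fun q => cdMean N t (D₀ q.1) (D₁ q.2)).map (interp k c t) ≤ volume := by
  refine Measure.le_iff.2 fun T hT => ?_
  have hem := measurable_interp k c t
  set H : (ℝ × ℝ) × (ℝ × ℝ) → ℝ≥0∞ := fun q => cdMean N t (D₀ q.1) (D₁ q.2) with hH
  have hHm : Measurable H := by fun_prop
  rw [Measure.map_apply hem hT]
  have hK : ∀ n : ℕ, ∃ K ⊆ C, IsCompact K ∧ Γ (C \ K) < ENNReal.ofReal (1 / (n + 1 : ℝ)) := fun n =>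
    hC.exists_isCompact_sdiff_lt (measure_ne_top _ _) (by
      simp only [ne_eq, ENNReal.ofReal_eq_zero, not_le]; positivity)
  choose K hKC hKc hKΓ using hK
  have hnull : Γ (⋃ n, K n)ᶜ = 0 := by
    have hz : Γ (C \ ⋃ n, K n) = 0 := by
      have hlim : Filter.Tendsto (fun n : ℕ => ENNReal.ofReal (1 / (n + 1 : ℝ))) Filter.atTop
          (nhds 0) := by
        rw [← ENNReal.ofReal_zero]
        exact ENNReal.tendsto_ofReal tendsto_one_div_add_atTop_nhds_zero_nat
      refine le_antisymm (ge_of_tendsto' hlim fun n => ?_) zero_le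
      exact (measure_mono (sdiff_subset_sdiff_right (subset_iUnion _ _))).trans (hKΓ n).le
    refine measure_mono_null (fun q hq => ?_) (measure_union_null hΓ hz)
    by_cases hqC : q ∈ C
    · exact Or.inr ⟨hqC, hq⟩
    · exact Or.inl hqC
  have hν := withDensity_absolutelyContinuous Γ H
  calc Γ.withDensity H (interp k c t ⁻¹' T)
      ≤ Γ.withDensity H (⋃ n, K n ∩ interp k c t ⁻¹' T) + Γ.withDensity H (⋃ n, K n)ᶜ := by
        refine (measure_mono fun q hq => ?_).trans (measure_union_le _ _)
        by_cases h : q ∈ ⋃ n, K n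
        · rw [← iUnion_inter]; exact Or.inl ⟨h, hq⟩
        · exact Or.inr h
    _ = ⨆ n, Γ.withDensity H (accumulate (fun n => K n ∩ interp k c t ⁻¹' T) n) := by
        rw [hν hnull, add_zero, measure_iUnion_eq_iSup_accumulate]
    _ ≤ volume T := by
        refine iSup_le fun n => ?_
        have hAc : IsCompact (accumulate K n) := isCompact_accumulate hKc n
        have hAC : accumulate K n ⊆ C := fun q hq => by
          obtain ⟨m, -, hm⟩ := mem_accumulate.1 hq
          exact hKC m hm
        have := h _ hAC hAc (Γ.restrict (accumulate K n)) inferInstance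
          (by rw [Measure.restrict_apply hAc.measurableSet.compl, compl_inter_self, measure_empty])
          D₀ D₁ hD₀ hD₁
          ((withDensity_mono_left (Measure.map_mono Measure.restrict_le_self measurable_fst) _).trans h0)
          ((withDensity_mono_left (Measure.map_mono Measure.restrict_le_self measurable_snd) _).trans h1)
        have := this T
        rw [Measure.map_apply hem hT, ← restrict_withDensity hAc.measurableSet,
          Measure.restrict_apply (hem hT)] at this
        refine (measure_mono fun q hq => ?_).trans this
        obtain ⟨m, hmn, hm⟩ := mem_accumulate.1 hq
        exact ⟨hm.2, mem_accumulate.2 ⟨m, hmn, hm.1⟩⟩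

/-- If the curves do not meet, the interpolation inequality for countably many pieces implies the
one for their union. -/
lemma map_interp_le_of_iUnion {k c t N : ℝ} {S : Set ((ℝ × ℝ) × (ℝ × ℝ))} (hS : MeasurableSet S)
    (hinj : InjOn (interp k c t) S) {C : ℕ → Set ((ℝ × ℝ) × (ℝ × ℝ))} (hC : ∀ n, MeasurableSet (C n))
    (hSC : S ⊆ ⋃ n, C n) (hb : ∀ n, InterpBound k c t N (C n ∩ S))
    {Γ : Measure ((ℝ × ℝ) × (ℝ × ℝ))} [IsFiniteMeasure Γ] (hΓ : Γ Sᶜ = 0)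
    {D₀ D₁ : ℝ × ℝ → ℝ≥0∞} (hD₀ : Measurable D₀) (hD₁ : Measurable D₁)
    (h0 : (Γ.map Prod.fst).withDensity D₀ ≤ volume) (h1 : (Γ.map Prod.snd).withDensity D₁ ≤ volume) :
    (Γ.withDensity fun q => cdMean N t (D₀ q.1) (D₁ q.2)).map (interp k c t) ≤ volume := by
  refine Measure.le_iff.2 fun T hT => ?_
  have hem := measurable_interp k c t
  set H : (ℝ × ℝ) × (ℝ × ℝ) → ℝ≥0∞ := fun q => cdMean N t (D₀ q.1) (D₁ q.2) with hH
  have hHm : Measurable H := by fun_prop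
  rw [Measure.map_apply hem hT]
  set A : ℕ → Set ((ℝ × ℝ) × (ℝ × ℝ)) := fun n => disjointed C n ∩ S with hA
  have hAm : ∀ n, MeasurableSet (A n) := fun n => (MeasurableSet.disjointed hC n).inter hS
  have hAd : Pairwise (Function.onFun Disjoint A) := fun i j hij =>
    (disjoint_disjointed C hij).mono inter_subset_left inter_subset_left
  have himg : ∀ n, MeasurableSet (interp k c t '' A n) := fun n =>
    (hAm n).image_of_measurable_injOn hem (hinj.mono inter_subset_right)
  have hd : Pairwise (Function.onFun Disjoint fun n => T ∩ interp k c t '' A n) := by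
    intro i j hij
    refine Disjoint.mono inter_subset_right inter_subset_right (Set.disjoint_left.2 ?_)
    rintro _ ⟨q, hq, rfl⟩ ⟨q', hq', he⟩
    have := hinj hq'.2 hq.2 he
    subst this
    exact Set.disjoint_left.1 (hAd hij) hq hq'
  have hpiece : ∀ n, Γ.withDensity H (interp k c t ⁻¹' T ∩ A n) ≤
      volume (T ∩ interp k c t '' A n) := fun n => by
    have hB : InterpBound k c t N (A n) := fun K hK =>
      hb n K (hK.trans (inter_subset_inter_left _ (disjointed_subset C n)))
    have := hB.map_le (hAm n) (Γ := Γ.restrict (A n))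
      (by rw [Measure.restrict_apply (hAm n).compl, compl_inter_self, measure_empty]) hD₀ hD₁
      ((withDensity_mono_left (Measure.map_mono Measure.restrict_le_self measurable_fst) _).trans h0)
      ((withDensity_mono_left (Measure.map_mono Measure.restrict_le_self measurable_snd) _).trans h1)
      (T ∩ interp k c t '' A n)
    rw [Measure.map_apply hem (hT.inter (himg n)), ← restrict_withDensity (hAm n),
      Measure.restrict_apply (hem (hT.inter (himg n)))] at this
    refine (measure_mono fun q hq => ?_).trans this
    exact ⟨⟨hq.1, q, hq.2, rfl⟩, hq.2⟩
  have hcover : interp k c t ⁻¹' T ⊆ (⋃ n, interp k c t ⁻¹' T ∩ A n) ∪ Sᶜ := fun q hq => by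
    by_cases hqS : q ∈ S
    · left
      have : q ∈ ⋃ n, disjointed C n := by rw [iUnion_disjointed]; exact hSC hqS
      obtain ⟨n, hn⟩ := mem_iUnion.1 this
      exact mem_iUnion.2 ⟨n, hq, hn, hqS⟩
    · exact Or.inr hqS
  calc Γ.withDensity H (interp k c t ⁻¹' T)
      ≤ Γ.withDensity H (⋃ n, interp k c t ⁻¹' T ∩ A n) + Γ.withDensity H Sᶜ :=
        (measure_mono hcover).trans (measure_union_le _ _)
    _ ≤ ∑' n, Γ.withDensity H (interp k c t ⁻¹' T ∩ A n) := by
        rw [withDensity_absolutelyContinuous Γ H hΓ, add_zero]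
        exact measure_iUnion_le _
    _ ≤ ∑' n, volume (T ∩ interp k c t '' A n) := ENNReal.tsum_le_tsum hpiece
    _ = volume (⋃ n, T ∩ interp k c t '' A n) := (measure_iUnion hd fun n => hT.inter (himg n)).symm
    _ ≤ volume T := measure_mono (iUnion_subset fun n => inter_subset_left)

/-- The homeomorphism `(x, y) ↦ (y - x, x)`. -/
def diagCoord : ℝ × ℝ ≃ₜ ℝ × ℝ where
  toFun p := (p.2 - p.1, p.1)
  invFun p := (p.2, p.1 + p.2)
  left_inv p := by simp
  right_inv p := by simp
  continuous_toFun := by fun_prop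
  continuous_invFun := by fun_prop

/-- The homeomorphism `(x, y) ↦ (x + y, x)`. -/
def antidiagCoord : ℝ × ℝ ≃ₜ ℝ × ℝ where
  toFun p := (p.1 + p.2, p.1)
  invFun p := (p.2, p.1 - p.2)
  left_inv p := by simp
  right_inv p := by simp
  continuous_toFun := by fun_prop
  continuous_invFun := by fun_prop

lemma measurePreserving_diagCoord : MeasurePreserving diagCoord volume volume := by
  have h := (Measure.measurePreserving_swap (μ := (volume : Measure ℝ)) (ν := (volume : Measure ℝ))).comp
    (measurePreserving_prod_neg_add (volume : Measure ℝ) (volume : Measure ℝ))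
  rw [← Measure.volume_eq_prod] at h
  have e : ⇑diagCoord = Prod.swap ∘ fun z : ℝ × ℝ => (z.1, -z.1 + z.2) := by
    funext p
    simp [diagCoord, sub_eq_neg_add]
  rw [e]
  exact h

lemma measurePreserving_antidiagCoord : MeasurePreserving antidiagCoord volume volume := by
  have h := (Measure.measurePreserving_swap (μ := (volume : Measure ℝ)) (ν := (volume : Measure ℝ))).comp
    (measurePreserving_prod_add (volume : Measure ℝ) (volume : Measure ℝ))
  rw [← Measure.volume_eq_prod] at h
  exact h

lemma mul_nonneg_of_sq_add_sq_le {a b a' b' : ℝ}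
    (h : (b - a) ^ 2 + (b' - a') ^ 2 ≤ (b' - a) ^ 2 + (b - a') ^ 2) : 0 ≤ (a - a') * (b - b') := by
  nlinarith

lemma interp_zero (c' t : ℝ) (q : (ℝ × ℝ) × (ℝ × ℝ)) :
    interp 0 c' t q = ((1 - t) * q.1.1 + t * q.2.1, (1 - t) * q.1.2 + t * q.2.2) := by
  simp [interp, curveY]

/-- On a product set on which the first displacement dominates, all exchanges of targets are
controlled by the first coordinates, which are therefore coupled monotonically. -/
lemma LexMonotone.interpBound_prod_fst {S : Set ((ℝ × ℝ) × (ℝ × ℝ))} (hS : LexMonotone S)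
    {k c t N : ℝ} (hk : 0 ≤ k)
    (hsm : ∀ q ∈ S, 12 * k * |q.2.1 - q.1.1| ≤ 1 ∧ 36 * k * |q.1.2 + q.2.2 - 2 * c| ≤ 1)
    (ht : 0 < t) (ht' : t < 1) (hN : 4 ≤ N) {U V : Set (ℝ × ℝ)}
    (hUV : U ×ˢ V ⊆ {q | |q.2.2 - q.1.2| < |q.2.1 - q.1.1|}) :
    InterpBound k c t N (U ×ˢ V ∩ S) := by
  refine interpBound_of_homeomorph (k' := k) (Homeomorph.refl _) (MeasurePreserving.id _) ?_ ?_
    (fun q _ => rfl) hk (Or.inr fun q hq => ⟨(hUV hq.1).le, hsm q hq.2⟩) ht ht' hN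
  · rintro q hq q' hq'
    have h := hS.maxCost_add_le q hq.2 q' hq'.2
    have e1 : (q.1, q'.2) ∈ U ×ˢ V := ⟨hq.1.1, hq'.1.2⟩
    have e2 : (q'.1, q.2) ∈ U ×ˢ V := ⟨hq'.1.1, hq.1.2⟩
    rw [maxCost_eq_of_le (hUV hq.1).le, maxCost_eq_of_le (hUV hq'.1).le,
      maxCost_eq_of_le (hUV e1).le, maxCost_eq_of_le (hUV e2).le] at h
    exact mul_nonneg_of_sq_add_sq_le h
  · rintro q hq q' hq' h0 h1
    have hd : ∀ q ∈ U ×ˢ V, |q.2.2 - q.1.2| ≤ |q.2.1 - q.1.1| := fun q hq => (hUV hq).le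
    exact hS.fiber q hq.2 q' hq'.2 (hd q hq.1) (hd q' hq'.1) h0 h1

/-- On a product set on which the second displacement dominates, the coordinates change roles. The
curves are segments there, so that no push has to be taken into account. -/
lemma LexMonotone.interpBound_prod_snd {S : Set ((ℝ × ℝ) × (ℝ × ℝ))} (hS : LexMonotone S)
    {k c t N : ℝ} (ht : 0 < t) (ht' : t < 1) (hN : 4 ≤ N) {U V : Set (ℝ × ℝ)}
    (hUV : U ×ˢ V ⊆ {q | |q.2.1 - q.1.1| < |q.2.2 - q.1.2|}) :
    InterpBound k c t N (U ×ˢ V ∩ S) := by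
  have hmax : ∀ q ∈ U ×ˢ V, maxCost q = (q.2.2 - q.1.2) ^ 2 := fun q hq => by
    rw [maxCost_eq, max_eq_right (hUV hq).le, sq_abs]
  refine interpBound_of_homeomorph (k' := 0) (Homeomorph.prodComm ℝ ℝ)
    Measure.measurePreserving_swap ?_ ?_ (fun q hq => ?_) le_rfl (Or.inl rfl) ht ht' hN
  · rintro q hq q' hq'
    have h := hS.maxCost_add_le q hq.2 q' hq'.2
    have e1 : (q.1, q'.2) ∈ U ×ˢ V := ⟨hq.1.1, hq'.1.2⟩
    have e2 : (q'.1, q.2) ∈ U ×ˢ V := ⟨hq'.1.1, hq.1.2⟩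
    rw [hmax _ hq.1, hmax _ hq'.1, hmax _ e1, hmax _ e2] at h
    exact mul_nonneg_of_sq_add_sq_le h
  · rintro q hq q' hq' h0 h1
    have hd : ∀ q ∈ U ×ˢ V, |q.2.1 - q.1.1| ≤ |q.2.2 - q.1.2| := fun q hq => (hUV hq).le
    exact hS.fiber_swap (swapCoord q) hq.2 (swapCoord q') hq'.2 (hd q hq.1) (hd q' hq'.1) h0 h1
  · rw [interp_zero]
    refine Prod.ext ?_ rfl
    exact interp_snd_of_le (hUV hq.1).le

/-- Pairs on diagonal lines: the line is preserved, which makes the first of the coordinates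
`(y - x, x)` trivially monotone, and along the lines the cost is the one-dimensional quadratic cost. -/
lemma LexMonotone.interpBound_diag {S : Set ((ℝ × ℝ) × (ℝ × ℝ))} (hS : LexMonotone S)
    {k c t N : ℝ} (ht : 0 < t) (ht' : t < 1) (hN : 4 ≤ N) :
    InterpBound k c t N ({q | q.2.2 - q.1.2 = q.2.1 - q.1.1} ∩ S) := by
  have hmax : ∀ q : (ℝ × ℝ) × (ℝ × ℝ), q.2.2 - q.1.2 = q.2.1 - q.1.1 →
      maxCost q = (q.2.1 - q.1.1) ^ 2 := fun q hq => by
    rw [maxCost_eq, hq, max_self, sq_abs]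
  refine interpBound_of_homeomorph (k' := 0) diagCoord measurePreserving_diagCoord ?_ ?_
    (fun q hq => ?_) le_rfl (Or.inl rfl) ht ht' hN
  · rintro q ⟨hq, -⟩ q' ⟨hq', -⟩
    simp only [diagCoord, Homeomorph.homeomorph_mk_coe, Equiv.coe_fn_mk, mem_ofPred_eq] at *
    have e1 : q.2.2 - q.2.1 = q.1.2 - q.1.1 := by linarith
    have e2 : q'.2.2 - q'.2.1 = q'.1.2 - q'.1.1 := by linarith
    rw [e1, e2]
    exact mul_self_nonneg _
  · rintro q ⟨hq, hqS⟩ q' ⟨hq', hqS'⟩ h0 h1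
    simp only [diagCoord, Homeomorph.homeomorph_mk_coe, Equiv.coe_fn_mk, mem_ofPred_eq] at *
    have h := hS.maxCost_add_le q hqS q' hqS'
    rw [hmax q hq, hmax q' hq', hmax (q.1, q'.2) (by simp only; linarith),
      hmax (q'.1, q.2) (by simp only; linarith)] at h
    exact mul_nonneg_of_sq_add_sq_le h
  · have hq1 : q.2.2 - q.1.2 = q.2.1 - q.1.1 := hq.1
    rw [interp_zero]
    have := interp_snd_of_le (k := k) (c := c) (t := t) (q := q) (by rw [hq1])
    refine Prod.ext ?_ rfl
    simp only [diagCoord, Homeomorph.homeomorph_mk_coe, Equiv.coe_fn_mk]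
    rw [this]
    simp only [interp]; ring

/-- Pairs on antidiagonal lines, in the coordinates `(x + y, x)`. -/
lemma LexMonotone.interpBound_antidiag {S : Set ((ℝ × ℝ) × (ℝ × ℝ))} (hS : LexMonotone S)
    {k c t N : ℝ} (ht : 0 < t) (ht' : t < 1) (hN : 4 ≤ N) :
    InterpBound k c t N ({q | q.2.2 - q.1.2 = -(q.2.1 - q.1.1)} ∩ S) := by
  have hmax : ∀ q : (ℝ × ℝ) × (ℝ × ℝ), q.2.2 - q.1.2 = -(q.2.1 - q.1.1) →
      maxCost q = (q.2.1 - q.1.1) ^ 2 := fun q hq => by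
    rw [maxCost_eq, hq, abs_neg, max_self, sq_abs]
  refine interpBound_of_homeomorph (k' := 0) antidiagCoord measurePreserving_antidiagCoord ?_ ?_
    (fun q hq => ?_) le_rfl (Or.inl rfl) ht ht' hN
  · rintro q ⟨hq, -⟩ q' ⟨hq', -⟩
    simp only [antidiagCoord, Homeomorph.homeomorph_mk_coe, Equiv.coe_fn_mk, mem_ofPred_eq] at *
    have e1 : q.2.1 + q.2.2 = q.1.1 + q.1.2 := by linarith
    have e2 : q'.2.1 + q'.2.2 = q'.1.1 + q'.1.2 := by linarith
    rw [e1, e2]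
    exact mul_self_nonneg _
  · rintro q ⟨hq, hqS⟩ q' ⟨hq', hqS'⟩ h0 h1
    simp only [antidiagCoord, Homeomorph.homeomorph_mk_coe, Equiv.coe_fn_mk, mem_ofPred_eq] at *
    have h := hS.maxCost_add_le q hqS q' hqS'
    rw [hmax q hq, hmax q' hq', hmax (q.1, q'.2) (by simp only; linarith),
      hmax (q'.1, q.2) (by simp only; linarith)] at h
    exact mul_nonneg_of_sq_add_sq_le h
  · have hq1 : q.2.2 - q.1.2 = -(q.2.1 - q.1.1) := hq.1
    rw [interp_zero]
    have := interp_snd_of_le (k := k) (c := c) (t := t) (q := q) (by rw [hq1, abs_neg])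
    refine Prod.ext ?_ rfl
    simp only [antidiagCoord, Homeomorph.homeomorph_mk_coe, Equiv.coe_fn_mk]
    rw [this]
    simp only [interp]; ring

/-- **The interpolation inequality**: along a monotone plan, the mean of the inverse densities of the
marginals is at most the inverse density of the interpolated measure. -/
theorem LexMonotone.map_interp_le {S : Set ((ℝ × ℝ) × (ℝ × ℝ))} (hS : LexMonotone S)
    (hSm : MeasurableSet S) {k c t N : ℝ} (hk : 0 ≤ k)
    (hsm : ∀ q ∈ S, 12 * k * |q.2.1 - q.1.1| ≤ 1 ∧ 36 * k * |q.1.2 + q.2.2 - 2 * c| ≤ 1)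
    (ht : 0 < t) (ht' : t < 1) (hN : 4 ≤ N)
    {Γ : Measure ((ℝ × ℝ) × (ℝ × ℝ))} [IsFiniteMeasure Γ] (hΓ : Γ Sᶜ = 0)
    {D₀ D₁ : ℝ × ℝ → ℝ≥0∞} (hD₀ : Measurable D₀) (hD₁ : Measurable D₁)
    (h0 : (Γ.map Prod.fst).withDensity D₀ ≤ volume) (h1 : (Γ.map Prod.snd).withDensity D₁ ≤ volume) :
    (Γ.withDensity fun q => cdMean N t (D₀ q.1) (D₁ q.2)).map (interp k c t) ≤ volume := by
  set B := TopologicalSpace.countableBasis (ℝ × ℝ)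
  have hB := TopologicalSpace.isBasis_countableBasis (ℝ × ℝ)
  set X : Set ((ℝ × ℝ) × (ℝ × ℝ)) := {q | |q.2.2 - q.1.2| < |q.2.1 - q.1.1|} with hX
  set Y : Set ((ℝ × ℝ) × (ℝ × ℝ)) := {q | |q.2.1 - q.1.1| < |q.2.2 - q.1.2|} with hY
  have hXo : IsOpen X := isOpen_lt (by fun_prop) (by fun_prop)
  have hYo : IsOpen Y := isOpen_lt (by fun_prop) (by fun_prop)
  set E₁ : Set ((ℝ × ℝ) × (ℝ × ℝ)) := {q | q.2.2 - q.1.2 = q.2.1 - q.1.1}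
  set E₂ : Set ((ℝ × ℝ) × (ℝ × ℝ)) := {q | q.2.2 - q.1.2 = -(q.2.1 - q.1.1)}
  -- Countably many product sets cover the two open regions in which one of the displacements
  -- dominates; the rest consists of the diagonal and the antidiagonal displacements.
  set 𝒞 : Set (Set ((ℝ × ℝ) × (ℝ × ℝ))) :=
    {C | C ∈ image2 (fun U V => U ×ˢ V) B B ∧ (C ⊆ X ∨ C ⊆ Y)} ∪ {E₁, E₂} with h𝒞
  have hcount : 𝒞.Countable := by
    refine Countable.union (Countable.mono (fun C hC => hC.1) ?_) (by simp)
    exact (TopologicalSpace.countable_countableBasis _).image2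
      (TopologicalSpace.countable_countableBasis _) _
  obtain ⟨C, hC⟩ := hcount.exists_eq_range ⟨E₁, by simp [h𝒞]⟩
  have hCmem : ∀ n, C n ∈ 𝒞 := fun n => by rw [hC]; exact mem_range_self n
  refine map_interp_le_of_iUnion hSm (hS.injOn_interp hk hsm ht ht') (C := C) (fun n => ?_)
    (fun q _ => ?_) (fun n => ?_) hΓ hD₀ hD₁ h0 h1
  · rcases hCmem n with ⟨⟨U, hU, V, hV, he⟩, -⟩ | h
    · rw [← he]
      exact ((hB.isOpen hU).prod (hB.isOpen hV)).measurableSet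
    · rcases h with h | h
      · rw [h]; exact measurableSet_eq_fun (by fun_prop) (by fun_prop)
      · rw [mem_singleton_iff.1 h]; exact measurableSet_eq_fun (by fun_prop) (by fun_prop)
  · have hex : ∃ C' ∈ 𝒞, q ∈ C' := by
      have hopen : ∀ O : Set ((ℝ × ℝ) × (ℝ × ℝ)), IsOpen O → q ∈ O →
          ∃ C' ∈ image2 (fun U V => U ×ˢ V) B B, q ∈ C' ∧ C' ⊆ O := fun O hO hq =>
        (hB.prod hB).exists_subset_of_mem_open hq hO
      rcases lt_trichotomy |q.2.2 - q.1.2| |q.2.1 - q.1.1| with h | h | h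
      · obtain ⟨C', h1, h2, h3⟩ := hopen X hXo h
        exact ⟨C', Or.inl ⟨h1, Or.inl h3⟩, h2⟩
      · rcases abs_eq_abs.1 h with h | h
        · exact ⟨E₁, by simp [h𝒞], h⟩
        · exact ⟨E₂, by simp [h𝒞], h⟩
      · obtain ⟨C', h1, h2, h3⟩ := hopen Y hYo h
        exact ⟨C', Or.inl ⟨h1, Or.inr h3⟩, h2⟩
    obtain ⟨C', h1, h2⟩ := hex
    rw [hC] at h1
    obtain ⟨n, rfl⟩ := h1
    exact mem_iUnion.2 ⟨n, h2⟩
  · rcases hCmem n with ⟨⟨U, hU, V, hV, he⟩, h | h⟩ | h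
    · rw [← he] at h ⊢
      exact hS.interpBound_prod_fst hk hsm ht ht' hN h
    · rw [← he] at h ⊢
      exact hS.interpBound_prod_snd ht ht' hN h
    · rcases h with h | h
      · rw [h]; exact hS.interpBound_diag ht ht' hN
      · rw [mem_singleton_iff.1 h]; exact hS.interpBound_antidiag ht ht' hN

/-! ### Geodesics -/

/-- A curve whose Lipschitz constant is the distance of its end points has constant speed. -/
lemma dist_eq_of_dist_le {X : Type*} [MetricSpace X] {γ : unitInterval → X}
    (h : ∀ s t : unitInterval, s ≤ t → dist (γ s) (γ t) ≤ (t - s : ℝ) * dist (γ 0) (γ 1))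
    (s t : unitInterval) : dist (γ s) (γ t) = |(s : ℝ) - t| * dist (γ 0) (γ 1) := by
  have key : ∀ s t : unitInterval, s ≤ t → dist (γ s) (γ t) = (t - s : ℝ) * dist (γ 0) (γ 1) := by
    intro s t hst
    refine le_antisymm (h s t hst) ?_
    have h1 := h 0 s unitInterval.nonneg'
    have h2 := h t 1 unitInterval.le_one'
    have h3 := dist_triangle4 (γ 0) (γ s) (γ t) (γ 1)
    simp only [Set.Icc.coe_zero, Set.Icc.coe_one] at h1 h2
    linarith
  rcases le_total s t with hst | hst
  · rw [key s t hst, abs_sub_comm, abs_of_nonneg (sub_nonneg.2 (Subtype.coe_le_coe.2 hst))]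
  · rw [dist_comm, key t s hst, abs_of_nonneg (sub_nonneg.2 (Subtype.coe_le_coe.2 hst))]

/-- A curve whose Lipschitz constant is the distance of its end points, as a geodesic. -/
def Geo.ofDistLe {X : Type*} [MetricSpace X] (γ : unitInterval → X)
    (h : ∀ s t : unitInterval, s ≤ t → dist (γ s) (γ t) ≤ (t - s : ℝ) * dist (γ 0) (γ 1)) : Geo X :=
  ⟨⟨γ, (LipschitzWith.of_dist_le_mul (K := nndist (γ 0) (γ 1)) fun s t => by
    rw [dist_eq_of_dist_le h, coe_nndist, mul_comm, Subtype.dist_eq, Real.dist_eq]).continuous⟩,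
    dist_eq_of_dist_le h⟩

lemma Geo.eval_ofDistLe {X : Type*} [MetricSpace X] (γ : unitInterval → X)
    (h : ∀ s t : unitInterval, s ≤ t → dist (γ s) (γ t) ≤ (t - s : ℝ) * dist (γ 0) (γ 1))
    (t : unitInterval) : (Geo.ofDistLe γ h).eval t = γ t := rfl

lemma continuous_eval {X : Type*} [MetricSpace X] (t : unitInterval) :
    Continuous (Geo.eval t : Geo X → X) :=
  (continuous_eval_const t).comp continuous_subtype_val

@[fun_prop]
lemma measurable_eval {X : Type*} [MetricSpace X] [MeasurableSpace X] [BorelSpace X]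
    (t : unitInterval) : Measurable (Geo.eval t : Geo X → X) :=
  (continuous_eval t).measurable

lemma interp_at_zero (k c : ℝ) (q : (ℝ × ℝ) × (ℝ × ℝ)) : interp k c 0 q = q.1 := by
  simp [interp, curveY]

lemma interp_at_one (k c : ℝ) (q : (ℝ × ℝ) × (ℝ × ℝ)) : interp k c 1 q = q.2 := by
  simp [interp, curveY]

/-- The interpolating curves are Lipschitz with the distance of the end points as constant: the speed of
the push is at most the excess of the horizontal displacement. -/
lemma dist_interp_le {k c s t : ℝ} {q : (ℝ × ℝ) × (ℝ × ℝ)} (hk : 0 ≤ k)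
    (hq : 12 * k * |q.2.1 - q.1.1| ≤ 1 ∧ 36 * k * |q.1.2 + q.2.2 - 2 * c| ≤ 1)
    (hs : 0 ≤ s) (hst : s ≤ t) (ht : t ≤ 1) :
    dist (interp k c s q) (interp k c t q) ≤ (t - s) * dist q.1 q.2 := by
  obtain ⟨B, hB, hB0, hB1, hB2⟩ := interp_snd hk hq
  have ets : 0 ≤ t - s := sub_nonneg.2 hst
  have e1 : (interp k c t q).1 - (interp k c s q).1 = (t - s) * (q.2.1 - q.1.1) := by
    simp only [interp]; ring
  have e2 : (interp k c t q).2 - (interp k c s q).2 =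
      (t - s) * (q.2.2 - q.1.2 + (1 - t - s) * B) := by rw [hB t, hB s]; ring
  rw [dist_pair_eq (interp k c s q), dist_pair_eq q.1 q.2, e1, e2, abs_mul, abs_mul,
    abs_of_nonneg ets]
  refine max_le (by gcongr; exact le_max_left _ _) ?_
  gcongr
  rcases le_total |q.2.1 - q.1.1| |q.2.2 - q.1.2| with h | h
  · rw [hB1 h, mul_zero, add_zero]; exact le_max_right _ _
  · refine le_trans ?_ (le_max_left _ _)
    have h2 := hB2 h
    have h3 : |(1 - t - s) * B| ≤ B := by
      rw [abs_mul, abs_of_nonneg hB0]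
      have : |1 - t - s| ≤ 1 := abs_le.2 ⟨by linarith, by linarith⟩
      nlinarith
    have := abs_add_le (q.2.2 - q.1.2) ((1 - t - s) * B)
    linarith

lemma continuous_bumpE : Continuous fun p : ℝ × ℝ => bumpE p.1 p.2 := by
  rw [continuous_iff_continuousAt]
  rintro ⟨d, δ⟩
  rcases eq_or_ne d 0 with rfl | hd
  · have h0 : bumpE 0 δ = 0 := by simp [bumpE]
    rw [ContinuousAt, h0]
    refine squeeze_zero (fun p => bumpE_nonneg _ _) (fun p => bumpE_le_sq _ _) ?_
    have : ContinuousAt (fun p : ℝ × ℝ => p.1 ^ 2) (0, δ) := by fun_prop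
    simpa [ContinuousAt] using this
  · unfold bumpE
    refine ContinuousAt.div (by fun_prop) (by fun_prop) (by simpa using hd)

lemma continuous_interp (k c : ℝ) :
    Continuous fun p : ((ℝ × ℝ) × (ℝ × ℝ)) × ℝ => interp k c p.2 p.1 := by
  have hb : Continuous fun p : ((ℝ × ℝ) × (ℝ × ℝ)) × ℝ =>
      bumpE (p.1.2.1 - p.1.1.1) (p.1.2.2 - p.1.1.2) :=
    continuous_bumpE.comp
      (g := fun p : ℝ × ℝ => bumpE p.1 p.2)
      (f := fun p : ((ℝ × ℝ) × (ℝ × ℝ)) × ℝ => (p.1.2.1 - p.1.1.1, p.1.2.2 - p.1.1.2)) (by fun_prop)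
  unfold interp curveY
  fun_prop

/-- The interpolating curves of pairs in `A`, as a measurable family of geodesics of `X`. -/
lemma exists_measurable_geo {X : Set (ℝ × ℝ)} (x₀ : X) {k c : ℝ} (hk : 0 ≤ k)
    {A : Set ((ℝ × ℝ) × (ℝ × ℝ))} (hA : MeasurableSet A)
    (hsm : ∀ q ∈ A, 12 * k * |q.2.1 - q.1.1| ≤ 1 ∧ 36 * k * |q.1.2 + q.2.2 - 2 * c| ≤ 1)
    (hAX : ∀ q ∈ A, ∀ t : unitInterval, interp k c t q ∈ X) :
    ∃ G : (ℝ × ℝ) × (ℝ × ℝ) → Geo X, Measurable G ∧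
      ∀ q ∈ A, ∀ t : unitInterval, (((G q).eval t : X) : ℝ × ℝ) = interp k c t q := by
  set G₀ : A → Geo X := fun q => Geo.ofDistLe (fun t => ⟨interp k c t q, hAX q q.2 t⟩) (by
    intro s t hst
    simp only [Subtype.dist_eq, Set.Icc.coe_zero, Set.Icc.coe_one, interp_at_zero, interp_at_one]
    exact dist_interp_le hk (hsm q q.2) s.2.1 hst t.2.2) with hG₀
  have hc : Continuous G₀ := by
    refine Continuous.subtype_mk (ContinuousMap.continuous_of_continuous_uncurry _ ?_) _
    refine Continuous.subtype_mk ?_ _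
    exact (continuous_interp k c).comp
      (f := fun p : A × unitInterval => ((p.1 : (ℝ × ℝ) × (ℝ × ℝ)), (p.2 : ℝ))) (by fun_prop)
  obtain ⟨G, hG, hGG⟩ := (MeasurableEmbedding.subtype_coe hA).exists_measurable_extend hc.measurable
    (fun _ => ⟨Geo.ofDistLe (fun _ => x₀) (by simp)⟩)
  refine ⟨G, hG, fun q hq t => ?_⟩
  have := congrFun hGG ⟨q, hq⟩
  simp only [Function.comp_apply] at this
  rw [this]
  rfl

/-! ### From densities to the Rényi functional -/

/-- If `g μ ≤ m`, then `g` is at most the inverse density of `μ`, where it does not vanish. -/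
lemma lintegral_rpow_le_renyi {X : Type*} [MeasurableSpace X] {m μ : Measure X} [SigmaFinite m]
    [IsFiniteMeasure μ] {g : X → ℝ≥0∞} (hg : Measurable g) (h : μ.withDensity g ≤ m) {N : ℝ}
    (hN : 1 ≤ N) : ∫⁻ x, g x ^ (1 / N) ∂μ ≤ renyi m N μ := by
  have hN0 : 0 < 1 / N := by positivity
  set A : Set X := {x | g x ≠ 0} with hA
  have hAm : MeasurableSet A := (measurableSet_eq_fun hg measurable_const).compl
  have hac : μ.restrict A ≪ m := by
    refine Measure.AbsolutelyContinuous.mk fun s hs hms => ?_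
    have h1 : μ.withDensity g s = 0 := le_antisymm ((h s).trans hms.le) zero_le
    rw [withDensity_apply _ hs, lintegral_eq_zero_iff hg] at h1
    rw [Measure.restrict_apply hs, inter_comm, ← Measure.restrict_apply hAm]
    exact h1
  set ρ := μ.rnDeriv m with hρ
  have hρm : Measurable ρ := Measure.measurable_rnDeriv _ _
  have hrest : μ.restrict A = m.withDensity (A.indicator ρ) := by
    rw [← Measure.withDensity_rnDeriv_eq _ _ hac]
    exact withDensity_congr_ae (Measure.rnDeriv_restrict μ m hAm)
  have hle : ∀ᵐ x ∂m, A.indicator ρ x * g x ≤ 1 := by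
    refine ae_le_of_withDensity_le (g := fun _ => 1) ((hρm.indicator hAm).mul hg) ?_
    refine (le_of_eq (withDensity_mul m (hρm.indicator hAm) hg)).trans ?_
    rw [← hrest]
    refine (withDensity_mono_left Measure.restrict_le_self g).trans (h.trans (le_of_eq ?_))
    exact withDensity_one.symm
  have hfin : ∀ᵐ x ∂m, ρ x < ⊤ := Measure.rnDeriv_lt_top μ m
  calc ∫⁻ x, g x ^ (1 / N) ∂μ = ∫⁻ x in A, g x ^ (1 / N) ∂μ := by
        rw [← lintegral_indicator hAm]
        refine lintegral_congr fun x => ?_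
        by_cases hx : x ∈ A
        · rw [indicator_of_mem hx]
        · have : g x = 0 := by simpa [hA] using hx
          rw [indicator_of_notMem hx, this, ENNReal.zero_rpow_of_pos hN0]
    _ = ∫⁻ x, A.indicator ρ x * g x ^ (1 / N) ∂m := by
        rw [hrest, lintegral_withDensity_eq_lintegral_mul _ (hρm.indicator hAm) (by fun_prop)]
        rfl
    _ ≤ ∫⁻ x, {x | ρ x ≠ 0}.indicator (fun x => ρ x ^ (1 - 1 / N)) x ∂m := by
        refine lintegral_mono_ae ?_
        filter_upwards [hle, hfin] with x hx hxf
        by_cases hxA : x ∈ A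
        swap
        · rw [indicator_of_notMem hxA, zero_mul]; exact zero_le
        rw [indicator_of_mem hxA] at hx ⊢
        by_cases h0 : ρ x = 0
        · rw [h0, zero_mul]; exact zero_le
        rw [indicator_of_mem (by exact h0)]
        have h2 : g x ≤ (ρ x)⁻¹ := by
          rw [ENNReal.le_inv_iff_mul_le, mul_comm]; exact hx
        calc ρ x * g x ^ (1 / N) ≤ ρ x * (ρ x)⁻¹ ^ (1 / N) := by gcongr
          _ = ρ x ^ (1 - 1 / N) := by
            rw [ENNReal.inv_rpow, ← ENNReal.rpow_neg, sub_eq_add_neg,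
              ENNReal.rpow_add _ _ h0 hxf.ne, ENNReal.rpow_one]
    _ = renyi m N μ := by
        rw [renyi, lintegral_indicator]
        exact (measurableSet_eq_fun hρm measurable_const).compl

/-! ### The local curvature-dimension condition for planar sets -/

lemma map_val_lebesgueOn {X : Set (ℝ × ℝ)} (hX : MeasurableSet X) :
    (lebesgueOn X).map Subtype.val = volume.restrict X := by
  rw [lebesgueOn, (MeasurableEmbedding.subtype_coe hX).map_comap, Subtype.range_coe]

lemma sigmaFinite_lebesgueOn {X : Set (ℝ × ℝ)} (hX : MeasurableSet X) :
    SigmaFinite (lebesgueOn X) := by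
  have : SigmaFinite ((lebesgueOn X).map Subtype.val) := by
    rw [map_val_lebesgueOn hX]; infer_instance
  exact SigmaFinite.of_map _ measurable_subtype_coe.aemeasurable this

lemma le_lebesgueOn {X : Set (ℝ × ℝ)} (hX : MeasurableSet X) {ν : Measure X}
    (h : ν.map Subtype.val ≤ volume) : ν ≤ lebesgueOn X := by
  have he := MeasurableEmbedding.subtype_coe hX
  refine Measure.le_iff.2 fun s hs => ?_
  have := h (Subtype.val '' s)
  rw [he.map_apply, preimage_image_eq _ Subtype.val_injective] at this
  rwa [lebesgueOn, he.comap_apply]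

lemma isCoupling_map_val {X : Set (ℝ × ℝ)} {μ₀ μ₁ : Measure X} {γ : Measure (X × X)}
    (h : IsCoupling γ μ₀ μ₁) :
    IsCoupling (γ.map (Prod.map Subtype.val Subtype.val)) (μ₀.map Subtype.val)
      (μ₁.map Subtype.val) := by
  have hm : Measurable (Prod.map (Subtype.val : X → ℝ × ℝ) (Subtype.val : X → ℝ × ℝ)) := by fun_prop
  constructor
  · rw [Measure.map_map measurable_fst hm, ← h.1, Measure.map_map measurable_subtype_coe measurable_fst]
    rfl
  · rw [Measure.map_map measurable_snd hm, ← h.2, Measure.map_map measurable_subtype_coe measurable_snd]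
    rfl

lemma quadCost_eq_maxCost {X : Set (ℝ × ℝ)} (γ : Measure (X × X)) :
    quadCost γ =
      ∫⁻ q, ENNReal.ofReal (maxCost q) ∂(γ.map (Prod.map Subtype.val Subtype.val)) := by
  rw [lintegral_map (by fun_prop) (by fun_prop), quadCost]
  refine lintegral_congr fun p => ?_
  rw [edist_dist, ← ENNReal.ofReal_pow dist_nonneg]
  rfl

lemma LexMonotone.mono {S T : Set ((ℝ × ℝ) × (ℝ × ℝ))} (hS : LexMonotone S) (h : T ⊆ S) :
    LexMonotone T :=
  ⟨fun q hq q' hq' => hS.maxCost_add_le q (h hq) q' (h hq'),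
    fun q hq q' hq' => hS.fiber q (h hq) q' (h hq'),
    fun q hq q' hq' => hS.fiber_swap q (h hq) q' (h hq')⟩

lemma tauCoeff_zero (N t θ : ℝ) : tauCoeff 0 N t θ = ENNReal.ofReal t := by simp [tauCoeff]

lemma cdMean_rpow {N : ℝ} (hN : 0 < N) (t : ℝ) (x y : ℝ≥0∞) :
    cdMean N t x y ^ (1 / N) = ENNReal.ofReal (1 - t) * x ^ (1 / N) + ENNReal.ofReal t * y ^ (1 / N) := by
  rw [cdMean, ← ENNReal.rpow_mul, mul_one_div_cancel hN.ne', ENNReal.rpow_one]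

/-- Let `Γ` be a plan concentrated on a monotone set `S`, whose pairs are small and joined by curves
in `X`. Then the plan on geodesics given by these curves satisfies the inequality of `CD(0,4)`. -/
lemma cdInequality_of_lexMonotone {X : Set (ℝ × ℝ)} (hX : MeasurableSet X)
    {S : Set ((ℝ × ℝ) × (ℝ × ℝ))} (hS : LexMonotone S) (hSm : MeasurableSet S) {k c : ℝ} (hk : 0 ≤ k)
    (hsm : ∀ q ∈ S, 12 * k * |q.2.1 - q.1.1| ≤ 1 ∧ 36 * k * |q.1.2 + q.2.2 - 2 * c| ≤ 1)
    {G : (ℝ × ℝ) × (ℝ × ℝ) → Geo X} (hG : Measurable G)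
    (hGS : ∀ q ∈ S, ∀ t : unitInterval, (((G q).eval t : X) : ℝ × ℝ) = interp k c t q)
    {Γ : Measure ((ℝ × ℝ) × (ℝ × ℝ))} [IsFiniteMeasure Γ] (hΓ : Γ Sᶜ = 0)
    {μ₀ μ₁ : Measure X} [IsFiniteMeasure μ₀] [IsFiniteMeasure μ₁]
    (h0 : Γ.map Prod.fst = μ₀.map Subtype.val)
    (h1 : Γ.map Prod.snd = μ₁.map Subtype.val)
    (hc0 : (Γ.map G).map (Geo.eval 0) = μ₀) (hc1 : (Γ.map G).map (Geo.eval 1) = μ₁) :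
    CDInequality (tauCoeff 0) (lebesgueOn X) 4 μ₀ μ₁ (Γ.map G) := by
  have hσ := sigmaFinite_lebesgueOn hX
  set m := lebesgueOn X with hm
  have hval := MeasurableEmbedding.subtype_coe hX
  have hae : ∀ᵐ q ∂Γ, q ∈ S := mem_ae_iff.2 hΓ
  intro t N' hN'
  have hN0 : 0 < N' := by linarith
  simp only [tauCoeff_zero, invDensityPow]
  have hD0m : Measurable (m.rnDeriv μ₀) := Measure.measurable_rnDeriv _ _
  have hD1m : Measurable (m.rnDeriv μ₁) := Measure.measurable_rnDeriv _ _
  -- At the end points the inequality is the one between inverse density and density.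
  rcases eq_or_ne t 0 with rfl | ht0
  · simp only [Set.Icc.coe_zero, sub_zero, ENNReal.ofReal_one, one_mul, ENNReal.ofReal_zero, zero_mul,
      add_zero]
    rw [← lintegral_map (f := fun x => m.rnDeriv μ₀ x ^ (1 / N')) (by fun_prop) (measurable_eval 0),
      hc0]
    exact lintegral_rpow_le_renyi hD0m (Measure.withDensity_rnDeriv_le _ _) (by linarith)
  rcases eq_or_ne t 1 with rfl | ht1
  · simp only [Set.Icc.coe_one, sub_self, ENNReal.ofReal_one, one_mul, ENNReal.ofReal_zero, zero_mul,
      zero_add]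
    rw [← lintegral_map (f := fun x => m.rnDeriv μ₁ x ^ (1 / N')) (by fun_prop) (measurable_eval 1),
      hc1]
    exact lintegral_rpow_le_renyi hD1m (Measure.withDensity_rnDeriv_le _ _) (by linarith)
  have htpos : (0 : ℝ) < t := unitInterval.pos_iff_ne_zero.2 ht0
  have htlt : (t : ℝ) < 1 := unitInterval.lt_one_iff_ne_one.2 ht1
  obtain ⟨D₀, hD₀, hDD₀⟩ := hval.exists_measurable_extend hD0m fun _ => ⟨0⟩
  obtain ⟨D₁, hD₁, hDD₁⟩ := hval.exists_measurable_extend hD1m fun _ => ⟨0⟩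
  have hdom : ∀ (μ : Measure X) (D : ℝ × ℝ → ℝ≥0∞), Measurable D → D ∘ Subtype.val = m.rnDeriv μ →
      (μ.map Subtype.val).withDensity D ≤ volume := fun μ D hD hDD => by
    rw [← map_withDensity_comp μ measurable_subtype_coe hD]
    have : (fun x : X => D x) = m.rnDeriv μ := hDD
    rw [this]
    refine (Measure.map_mono (Measure.withDensity_rnDeriv_le _ _) measurable_subtype_coe).trans ?_
    rw [hm, map_val_lebesgueOn hX]
    exact Measure.restrict_le_self
  have hmain := hS.map_interp_le hSm (t := t) hk hsm htpos htlt hN' hΓ hD₀ hD₁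
    (by rw [h0]; exact hdom μ₀ D₀ hD₀ hDD₀) (by rw [h1]; exact hdom μ₁ D₁ hD₁ hDD₁)
  set H : (ℝ × ℝ) × (ℝ × ℝ) → ℝ≥0∞ := fun q => cdMean N' t (D₀ q.1) (D₁ q.2) with hH
  have hHm : Measurable H := by fun_prop
  have hem := measurable_interp k c t
  -- As the curves do not meet, `H` is a function of the point at time `t`.
  have hinj := hS.injOn_interp hk hsm htpos htlt
  have := hSm.standardBorel
  have hemb : MeasurableEmbedding fun q : S => interp k c t q :=
    (hem.comp measurable_subtype_coe).measurableEmbedding hinj.injective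
  obtain ⟨g, hg, hgH⟩ := hemb.exists_measurable_extend (hHm.comp measurable_subtype_coe) fun _ => ⟨0⟩
  have hgH' : ∀ q ∈ S, g (interp k c t q) = H q := fun q hq => congrFun hgH ⟨q, hq⟩
  set μt := (Γ.map G).map (Geo.eval t) with hμt
  have hμtfin : IsFiniteMeasure μt := by rw [hμt]; infer_instance
  have hμtval : μt.map Subtype.val = Γ.map (interp k c t) := by
    rw [hμt, Measure.map_map measurable_subtype_coe (measurable_eval t),
      Measure.map_map (measurable_subtype_coe.comp (measurable_eval t)) hG]
    refine Measure.map_congr ?_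
    filter_upwards [hae] with q hq
    exact hGS q hq t
  have hgm : μt.withDensity (fun x => g x) ≤ m := by
    refine le_lebesgueOn hX ?_
    rw [map_withDensity_comp μt measurable_subtype_coe hg, hμtval, ← map_withDensity_comp Γ hem hg]
    refine le_trans (le_of_eq ?_) hmain
    congr 1
    refine withDensity_congr_ae ?_
    filter_upwards [hae] with q hq
    exact hgH' q hq
  refine le_trans (le_of_eq ?_) (lintegral_rpow_le_renyi (hg.comp measurable_subtype_coe) hgm
    (N := N') (by linarith))
  rw [hμt, lintegral_map (by fun_prop) (measurable_eval t), lintegral_map (by fun_prop) hG,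
    lintegral_map (by fun_prop) hG]
  refine lintegral_congr_ae ?_
  filter_upwards [hae] with q hq
  have e0 : m.rnDeriv μ₀ ((G q).eval 0) = D₀ q.1 := by
    rw [← hDD₀, Function.comp_apply, hGS q hq 0, Set.Icc.coe_zero, interp_at_zero]
  have e1 : m.rnDeriv μ₁ ((G q).eval 1) = D₁ q.2 := by
    rw [← hDD₁, Function.comp_apply, hGS q hq 1, Set.Icc.coe_one, interp_at_one]
  rw [e0, e1, Function.comp_apply, hGS q hq t, hgH' q hq, hH, cdMean_rpow hN0]

lemma measure_compl_eq_zero_of_support_subset {X : Type*} [MetricSpace X] [SecondCountableTopology X]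
    [MeasurableSpace X] {μ : Measure X} {U : Set X} (h : μ.support ⊆ U) : μ Uᶜ = 0 :=
  measure_mono_null (compl_subset_compl.2 h) Measure.measure_compl_support

/-- A closed set, such that near each point the interpolating curves, for a suitable size of the push,
stay in the set, satisfies `CD(0,4)` locally. -/
theorem isCDLocally_of_interp_mem {X : Set (ℝ × ℝ)} (hX : IsClosed X)
    (h : ∀ p ∈ X, ∃ r k : ℝ, 0 < r ∧ 0 ≤ k ∧ 72 * k * r ≤ 1 ∧
      ∀ p₀ ∈ X ∩ Metric.ball p r, ∀ p₁ ∈ X ∩ Metric.ball p r, ∀ t : ℝ, 0 ≤ t → t ≤ 1 →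
        interp k p.2 t (p₀, p₁) ∈ X) :
    IsCDLocally (lebesgueOn X) 0 4 := by
  rintro ⟨p, hp⟩
  obtain ⟨r, k, hr, hk, hkr, hcurve⟩ := h p hp
  refine ⟨r, hr, fun μ₀ μ₁ _ _ hs0 hs1 => ?_⟩
  have hXm := hX.measurableSet
  have hval := MeasurableEmbedding.subtype_coe hXm
  set B : Set (ℝ × ℝ) := X ∩ Metric.ball p r with hB
  have hBm : MeasurableSet B := hXm.inter measurableSet_ball
  have hK : IsCompact (X ∩ Metric.closedBall p r) := (isCompact_closedBall p r).inter_left hX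
  have hBK : B ⊆ X ∩ Metric.closedBall p r := inter_subset_inter_right _ Metric.ball_subset_closedBall
  have hnull : ∀ μ : Measure X, μ.support ⊆ Metric.ball (⟨p, hp⟩ : X) r → μ.map Subtype.val Bᶜ = 0 :=
    fun μ hs => by
      rw [hval.map_apply]
      have hsub : (Subtype.val ⁻¹' Bᶜ : Set X) ⊆ (Metric.ball (⟨p, hp⟩ : X) r)ᶜ :=
        fun x hx hxb => hx ⟨x.2, hxb⟩
      exact measure_mono_null hsub (measure_compl_eq_zero_of_support_subset hs)
  have hB0 := hnull μ₀ hs0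
  have hB1 := hnull μ₁ hs1
  have hP0 : IsProbabilityMeasure (μ₀.map Subtype.val) :=
    Measure.isProbabilityMeasure_map measurable_subtype_coe.aemeasurable
  have hP1 : IsProbabilityMeasure (μ₁.map Subtype.val) :=
    Measure.isProbabilityMeasure_map measurable_subtype_coe.aemeasurable
  obtain ⟨Γ, hΓ, hΓc⟩ := exists_isLexOptimal hK (measure_mono_null (compl_subset_compl.2 hBK) hB0)
    (measure_mono_null (compl_subset_compl.2 hBK) hB1)
  have := hΓ.isProb
  obtain ⟨S₀, hS₀m, hS₀, hS₀mono⟩ := hΓ.exists_lexMonotone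
  set S := S₀ ∩ B ×ˢ B with hS
  have hSm : MeasurableSet S := hS₀m.inter (hBm.prod hBm)
  have hΓS : Γ Sᶜ = 0 := by
    have e0 : Γ (Prod.fst ⁻¹' Bᶜ) = 0 := by
      rw [← Measure.map_apply measurable_fst hBm.compl, hΓc.1, hB0]
    have e1 : Γ (Prod.snd ⁻¹' Bᶜ) = 0 := by
      rw [← Measure.map_apply measurable_snd hBm.compl, hΓc.2, hB1]
    refine measure_mono_null (fun q hq => ?_) (measure_union_null (mem_ae_iff.1 hS₀)
      (measure_union_null e0 e1))
    by_contra hcon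
    simp only [mem_union, mem_compl_iff, mem_preimage, not_or, not_not] at hcon
    exact hq ⟨hcon.1, hcon.2⟩
  have hae : ∀ᵐ q ∂Γ, q ∈ S := mem_ae_iff.2 hΓS
  have hsm : ∀ q ∈ S, 12 * k * |q.2.1 - q.1.1| ≤ 1 ∧ 36 * k * |q.1.2 + q.2.2 - 2 * p.2| ≤ 1 := by
    rintro q ⟨-, ⟨-, h0⟩, -, h1⟩
    rw [Metric.mem_ball, Prod.dist_eq, max_lt_iff, Real.dist_eq, Real.dist_eq, abs_lt, abs_lt] at h0 h1
    have d1 : |q.2.1 - q.1.1| ≤ 2 * r := abs_le.2 ⟨by linarith, by linarith⟩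
    have d2 : |q.1.2 + q.2.2 - 2 * p.2| ≤ 2 * r := abs_le.2 ⟨by linarith, by linarith⟩
    constructor
    · calc 12 * k * |q.2.1 - q.1.1| ≤ 12 * k * (2 * r) := by gcongr
        _ ≤ 1 := by nlinarith
    · calc 36 * k * |q.1.2 + q.2.2 - 2 * p.2| ≤ 36 * k * (2 * r) := by gcongr
        _ ≤ 1 := by nlinarith
  obtain ⟨G, hG, hGS⟩ := exists_measurable_geo (⟨p, hp⟩ : X) (c := p.2) hk hSm hsm fun q hq t =>
    hcurve q.1 hq.2.1 q.2 hq.2.2 t t.2.1 t.2.2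
  have he0 : (Γ.map G).map (Geo.eval 0) = μ₀ := by
    refine hval.map_injective ?_
    rw [Measure.map_map measurable_subtype_coe (measurable_eval 0),
      Measure.map_map (measurable_subtype_coe.comp (measurable_eval 0)) hG, ← hΓc.1]
    refine Measure.map_congr ?_
    filter_upwards [hae] with q hq
    simp only [Function.comp_apply, hGS q hq 0, Set.Icc.coe_zero, interp_at_zero]
  have he1 : (Γ.map G).map (Geo.eval 1) = μ₁ := by
    refine hval.map_injective ?_
    rw [Measure.map_map measurable_subtype_coe (measurable_eval 1),
      Measure.map_map (measurable_subtype_coe.comp (measurable_eval 1)) hG, ← hΓc.2]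
    refine Measure.map_congr ?_
    filter_upwards [hae] with q hq
    simp only [Function.comp_apply, hGS q hq 1, Set.Icc.coe_one, interp_at_one]
  have hends : Measurable fun γ : Geo X => (γ.eval 0, γ.eval 1) :=
    (measurable_eval 0).prodMk (measurable_eval 1)
  have hcoup : IsCoupling ((Γ.map G).map fun γ => (γ.eval 0, γ.eval 1)) μ₀ μ₁ := by
    constructor
    · rw [Measure.map_map measurable_fst hends]; exact he0
    · rw [Measure.map_map measurable_snd hends]; exact he1
  refine ⟨Γ.map G, ⟨Measure.isProbabilityMeasure_map hG.aemeasurable, hcoup, ?_⟩,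
    cdInequality_of_lexMonotone hXm (hS₀mono.mono inter_subset_left) hSm hk hsm hG hGS hΓS
      hΓc.1 hΓc.2 he0 he1⟩
  refine le_antisymm (le_iInf₂ fun γ hγ => ?_)
    (iInf₂_le (f := fun (γ : Measure (X × X)) (_ : IsCoupling γ μ₀ μ₁) => quadCost γ) _ hcoup)
  have hΓeq : ((Γ.map G).map fun γ => (γ.eval 0, γ.eval 1)).map
      (Prod.map Subtype.val Subtype.val) = Γ := by
    rw [Measure.map_map (by fun_prop) hends, Measure.map_map (by fun_prop) hG]
    conv_rhs => rw [← Measure.map_id (μ := Γ)]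
    refine Measure.map_congr ?_
    filter_upwards [hae] with q hq
    simp only [Function.comp_apply, Prod.map_apply, hGS q hq 0, hGS q hq 1, Set.Icc.coe_zero,
      Set.Icc.coe_one, interp_at_zero, interp_at_one, id_eq]
  rw [quadCost_eq_maxCost, quadCost_eq_maxCost, hΓeq]
  refine hΓ.max_le _ ?_
  rw [hΓc.1, hΓc.2]
  exact isCoupling_map_val hγ

/-! ### A strip with discs removed -/

/-- The abscissa of the `n`-th disc. -/
def discX (n : ℕ) : ℝ := 2 * n + 1

/-- The height of the `n`-th disc over the axis. The disc has radius `5 ρ` and its centre is at depth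
`4 ρ` below the axis, so that it cuts out of the axis an interval of length `6 ρ`, at whose end points
the slope of the circle is `3 / 4`. -/
def discH (n : ℕ) : ℝ := 1 / (20 * (n + 1))

lemma discH_pos (n : ℕ) : 0 < discH n := by unfold discH; positivity

lemma discH_le (n : ℕ) : discH n ≤ 1 / 20 := by
  unfold discH
  gcongr
  have : (0 : ℝ) ≤ n := Nat.cast_nonneg n
  linarith

/-- The complement of the `n`-th open disc. -/
def discCompl (n : ℕ) : Set (ℝ × ℝ) :=
  {p | (5 * discH n) ^ 2 ≤ (p.1 - discX n) ^ 2 + (p.2 + 4 * discH n) ^ 2}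

/-- The part over `I` of the strip `ℝ × [0, 1]`, with all discs removed. -/
def discStrip (I : Set ℝ) : Set (ℝ × ℝ) :=
  {p | p.1 ∈ I ∧ 0 ≤ p.2 ∧ p.2 ≤ 1 ∧ ∀ n, p ∈ discCompl n}

lemma isClosed_discCompl (n : ℕ) : IsClosed (discCompl n) :=
  isClosed_le (by fun_prop) (by fun_prop)

lemma isClosed_discStrip {I : Set ℝ} (hI : IsClosed I) : IsClosed (discStrip I) := by
  have : discStrip I = Prod.fst ⁻¹' I ∩ ({p | 0 ≤ p.2} ∩ ({p | p.2 ≤ 1} ∩ ⋂ n, discCompl n)) := by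
    ext p; simp [discStrip]
  rw [this]
  exact (hI.preimage continuous_fst).inter ((isClosed_le continuous_const continuous_snd).inter
    ((isClosed_le continuous_snd continuous_const).inter (isClosed_iInter isClosed_discCompl)))

lemma mem_discCompl_of_abs_le {n : ℕ} {p : ℝ × ℝ} (h : 1 / 4 ≤ |p.1 - discX n|) :
    p ∈ discCompl n := by
  have h1 := discH_le n
  have h2 := discH_pos n
  have h3 : (5 * discH n) ^ 2 ≤ |p.1 - discX n| ^ 2 := by gcongr; linarith
  rw [sq_abs] at h3
  exact h3.trans (le_add_of_nonneg_right (sq_nonneg _))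

lemma two_le_abs_discX_sub {m n : ℕ} (h : m ≠ n) : 2 ≤ |discX m - discX n| := by
  have e : discX m - discX n = 2 * (((m : ℤ) - n : ℤ) : ℝ) := by
    unfold discX; push_cast; ring
  rw [e, abs_mul, abs_two, ← Int.cast_abs]
  have : (1 : ℤ) ≤ |(m : ℤ) - n| := Int.one_le_abs (sub_ne_zero.2 (by exact_mod_cast h))
  have : (1 : ℝ) ≤ ((|(m : ℤ) - n| : ℤ) : ℝ) := by exact_mod_cast this
  linarith

lemma mem_discCompl_of_ne {m n : ℕ} (h : m ≠ n) {p : ℝ × ℝ} (hp : |p.1 - discX n| ≤ 3 / 2) :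
    p ∈ discCompl m := by
  refine mem_discCompl_of_abs_le ?_
  have h1 := two_le_abs_discX_sub h
  have h2 := abs_sub_le (discX m) p.1 (discX n)
  rw [abs_sub_comm (discX m) p.1] at h2
  linarith

/-- The complement of the disc in the upper half plane is invariant under upward displacements in the
cone of slope `3 / 4`, the slope of the circle on the axis. -/
lemma discCompl_cone {n : ℕ} {p : ℝ × ℝ} (hp : p ∈ discCompl n) (h0 : 0 ≤ p.2) {a b : ℝ}
    (hab : 3 / 4 * |a| ≤ b) : (p.1 + a, p.2 + b) ∈ discCompl n := by
  have hs := discH_pos n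
  simp only [discCompl, mem_ofPred_eq] at hp ⊢
  set s := discH n
  set u := p.1 - discX n with hu
  set Y := p.2 + 4 * s with hY
  have e1 : p.1 + a - discX n = u + a := by rw [hu]; ring
  have e2 : p.2 + b + 4 * s = Y + b := by rw [hY]; ring
  have hY4 : 4 * s ≤ Y := by linarith
  have ha := abs_nonneg a
  rw [e1, e2]
  rcases le_total |u| (3 / 4 * Y) with h | h
  · have h1 : -(|u| * |a|) ≤ u * a := by rw [← abs_mul]; exact neg_abs_le _
    have h2 : |u| * |a| ≤ 3 / 4 * Y * |a| := by gcongr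
    have h3 : Y * (3 / 4 * |a|) ≤ Y * b := by gcongr
    nlinarith [sq_nonneg a, sq_nonneg b]
  · rcases le_total (3 * s) |u + a| with h' | h'
    · have h1 : (3 * s) ^ 2 ≤ |u + a| ^ 2 := by gcongr
      have h2 : (4 * s) ^ 2 ≤ (Y + b) ^ 2 := by gcongr; linarith
      rw [sq_abs] at h1
      nlinarith
    · have h1 : |u| - |u + a| ≤ |a| := by
        have := abs_sub_abs_le_abs_sub u (u + a)
        rwa [sub_add_cancel_left, abs_neg] at this
      have h2 : 4 * s + 3 / 4 * (3 * s - |u + a|) ≤ Y + b := by linarith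
      have h3 : (4 * s + 3 / 4 * (3 * s - |u + a|)) ^ 2 ≤ (Y + b) ^ 2 := by
        gcongr
      have h4 : |u + a| ^ 2 = (u + a) ^ 2 := sq_abs _
      nlinarith [sq_nonneg (3 * s - |u + a|)]

lemma mem_discCompl_of_one_le {n : ℕ} {p : ℝ × ℝ} (h : 1 ≤ p.2) : p ∈ discCompl n := by
  have h1 := discH_le n
  have h2 := discH_pos n
  have : (5 * discH n) ^ 2 ≤ (p.2 + 4 * discH n) ^ 2 := by gcongr; linarith
  exact this.trans (le_add_of_nonneg_left (sq_nonneg _))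

/-! ### Geodesics of the strip -/

/-- The highest curve with the given end points that has constant speed and stays in the strip. -/
def arch (p q : ℝ × ℝ) (t : ℝ) : ℝ × ℝ :=
  ((1 - t) * p.1 + t * q.1, min (min (p.2 + t * dist p q) (q.2 + (1 - t) * dist p q)) 1)

/-- Both branches of the curve are upward displacements of an end point in the cone of slope `1`. -/
lemma arch_mem {I : Set ℝ} (hI : I.OrdConnected) {p q : ℝ × ℝ} (hp : p ∈ discStrip I)
    (hq : q ∈ discStrip I) {t : ℝ} (ht : 0 ≤ t) (ht' : t ≤ 1) : arch p q t ∈ discStrip I := by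
  obtain ⟨hpI, hp0, hp1, hpd⟩ := hp
  obtain ⟨hqI, hq0, hq1, hqd⟩ := hq
  have hD : 0 ≤ dist p q := dist_nonneg
  have ht1 : 0 ≤ 1 - t := by linarith
  have hx : |q.1 - p.1| ≤ dist p q := by rw [dist_pair_eq]; exact le_max_left _ _
  refine ⟨hI.convex hpI hqI ht1 ht (by ring), ?_, min_le_right _ _, fun n => ?_⟩
  · exact le_min (le_min (by positivity) (by positivity)) zero_le_one
  · rcases min_choice (min (p.2 + t * dist p q) (q.2 + (1 - t) * dist p q)) 1 with h | h
    swap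
    · exact mem_discCompl_of_one_le (by simp only [arch]; rw [h])
    rcases min_choice (p.2 + t * dist p q) (q.2 + (1 - t) * dist p q) with h' | h'
    · have : arch p q t = (p.1 + t * (q.1 - p.1), p.2 + t * dist p q) := by
        refine Prod.ext (by simp only [arch]; ring) ?_
        simp only [arch]; rw [h, h']
      rw [this]
      refine discCompl_cone (hpd n) hp0 ?_
      rw [abs_mul, abs_of_nonneg ht]
      have := mul_le_mul_of_nonneg_left hx ht
      have := mul_nonneg ht hD
      linarith
    · have : arch p q t = (q.1 + (1 - t) * (p.1 - q.1), q.2 + (1 - t) * dist p q) := by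
        refine Prod.ext (by simp only [arch]; ring) ?_
        simp only [arch]; rw [h, h']
      rw [this]
      refine discCompl_cone (hqd n) hq0 ?_
      rw [abs_mul, abs_of_nonneg ht1, abs_sub_comm]
      have := mul_le_mul_of_nonneg_left hx ht1
      have := mul_nonneg ht1 hD
      linarith

lemma arch_zero {p q : ℝ × ℝ} (hp : p.2 ≤ 1) : arch p q 0 = p := by
  have h : |q.2 - p.2| ≤ dist p q := by rw [dist_pair_eq]; exact le_max_right _ _
  have := (abs_le.1 h).1
  refine Prod.ext (by simp [arch]) ?_
  simp only [arch, zero_mul, add_zero, sub_zero, one_mul]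
  rw [min_eq_left (b := q.2 + dist p q) (by linarith), min_eq_left hp]

lemma arch_one {p q : ℝ × ℝ} (hq : q.2 ≤ 1) : arch p q 1 = q := by
  have h : |q.2 - p.2| ≤ dist p q := by rw [dist_pair_eq]; exact le_max_right _ _
  have := (abs_le.1 h).2
  refine Prod.ext (by simp [arch]) ?_
  simp only [arch, zero_mul, add_zero, sub_self, one_mul]
  rw [min_eq_right (a := p.2 + dist p q) (by linarith), min_eq_left hq]

lemma dist_arch_le {p q : ℝ × ℝ} {s t : ℝ} (hst : s ≤ t) :
    dist (arch p q s) (arch p q t) ≤ (t - s) * dist p q := by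
  have hD : 0 ≤ dist p q := dist_nonneg
  have hts : 0 ≤ t - s := sub_nonneg.2 hst
  have hx : |q.1 - p.1| ≤ dist p q := by rw [dist_pair_eq]; exact le_max_left _ _
  rw [dist_pair_eq (arch p q s)]
  refine max_le ?_ ?_
  · have : (arch p q t).1 - (arch p q s).1 = (t - s) * (q.1 - p.1) := by simp only [arch]; ring
    rw [this, abs_mul, abs_of_nonneg hts]
    gcongr
  · simp only [arch]
    have h1 : (t - s) * dist p q = |(p.2 + t * dist p q) - (p.2 + s * dist p q)| := by
      rw [show (p.2 + t * dist p q) - (p.2 + s * dist p q) = (t - s) * dist p q by ring,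
        abs_of_nonneg (by positivity)]
    have h2 : (t - s) * dist p q = |(q.2 + (1 - t) * dist p q) - (q.2 + (1 - s) * dist p q)| := by
      rw [show (q.2 + (1 - t) * dist p q) - (q.2 + (1 - s) * dist p q) = -((t - s) * dist p q) by ring,
        abs_neg, abs_of_nonneg (by positivity)]
    refine (abs_min_sub_min_le_max _ _ _ _).trans (max_le ?_ (by simp; positivity))
    refine (abs_min_sub_min_le_max _ _ _ _).trans (max_le h1.ge h2.ge)

/-- The strip is geodesic: the curves `arch` have speed at most the distance of the end points, since
each of the functions whose minimum is taken is Lipschitz with this constant. -/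
theorem isGeodesicSpace_discStrip {I : Set ℝ} (hI : I.OrdConnected) :
    IsGeodesicSpace (discStrip I) := by
  rintro ⟨p, hp⟩ ⟨q, hq⟩
  refine ⟨Geo.ofDistLe (fun t => ⟨arch p q t, arch_mem hI hp hq t.2.1 t.2.2⟩) fun s t hst => ?_, ?_, ?_⟩
  · simp only [Subtype.dist_eq, Set.Icc.coe_zero, Set.Icc.coe_one, arch_zero hp.2.2.1,
      arch_one hq.2.2.1]
    exact dist_arch_le hst
  · rw [Geo.eval_ofDistLe]
    exact Subtype.ext (by simpa using arch_zero hp.2.2.1)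
  · rw [Geo.eval_ofDistLe]
    exact Subtype.ext (by simpa using arch_one hq.2.2.1)

/-! ### The local condition on the strip -/

/-- A segment between points outside a disc stays outside of the disc if it is pushed away from the
centre by a multiple of `t (1 - t)` that is at least quadratic in its length: this is the defect of the
squared distance along a segment. -/
lemma sq_le_of_push {x₀ x₁ y₀ y₁ t B R σ : ℝ} (ht : 0 ≤ t) (ht' : t ≤ 1)
    (h0 : R ^ 2 ≤ x₀ ^ 2 + y₀ ^ 2) (h1 : R ^ 2 ≤ x₁ ^ 2 + y₁ ^ 2) (hy0 : σ ≤ y₀)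
    (hy1 : σ ≤ y₁) (hB : 0 ≤ B) (hpush : (x₁ - x₀) ^ 2 + (y₁ - y₀) ^ 2 ≤ 2 * σ * B) :
    R ^ 2 ≤ ((1 - t) * x₀ + t * x₁) ^ 2 + ((1 - t) * y₀ + t * y₁ + t * (1 - t) * B) ^ 2 := by
  have ht1 : 0 ≤ 1 - t := by linarith
  have htt : 0 ≤ t * (1 - t) := mul_nonneg ht ht1
  have e : ((1 - t) * x₀ + t * x₁) ^ 2 + ((1 - t) * y₀ + t * y₁ + t * (1 - t) * B) ^ 2 =
      (1 - t) * (x₀ ^ 2 + y₀ ^ 2) + t * (x₁ ^ 2 + y₁ ^ 2)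
        + t * (1 - t) * (2 * ((1 - t) * y₀ + t * y₁) * B - ((x₁ - x₀) ^ 2 + (y₁ - y₀) ^ 2))
        + (t * (1 - t) * B) ^ 2 := by ring
  have h2 : σ ≤ (1 - t) * y₀ + t * y₁ := by nlinarith
  have h3 : 2 * σ * B ≤ 2 * ((1 - t) * y₀ + t * y₁) * B := by gcongr
  have h4 := mul_nonneg htt (sub_nonneg.2 (hpush.trans h3))
  have h5 := mul_le_mul_of_nonneg_left h0 ht1
  have h6 := mul_le_mul_of_nonneg_left h1 ht
  rw [e]
  nlinarith [sq_nonneg (t * (1 - t) * B)]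

/-- If the vertical displacement is smaller than the horizontal one by a definite factor, the push is
at least quadratic in the displacement. The constant `3` leaves room: `k * s ≥ 100 / 49` would be
enough, which is `25 / 16` divided by `8 * (49 / 256) * (1 / 2)`. -/
lemma sq_add_sq_le_bump {k s d δ v : ℝ} (hs : 0 < s) (hk : k = 3 / s) (hv : 36 * k * |v| ≤ 1)
    (hδ : |δ| ≤ 3 / 4 * |d|) :
    d ^ 2 + δ ^ 2 ≤ 2 * (4 * s) * (k * bumpE d δ * (1 + 18 * k * v)) := by
  have hkpos : 0 < k := by rw [hk]; positivity
  have hks : k * s = 3 := by rw [hk]; field_simp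
  have hδ2 : δ ^ 2 ≤ 9 / 16 * d ^ 2 := by
    have := pow_le_pow_left₀ (abs_nonneg δ) hδ 2
    rw [mul_pow, sq_abs, sq_abs] at this
    linarith
  have hE : 49 / 256 * d ^ 2 ≤ bumpE d δ := by
    rw [bumpE_of_le (hδ.trans (by linarith [abs_nonneg d]))]
    rcases eq_or_ne d 0 with rfl | hd
    · simp
    · rw [le_div_iff₀ (by positivity)]
      nlinarith [sq_nonneg d]
  have hv2 : 1 / 2 ≤ 1 + 18 * k * v := by
    have : -(36 * k * |v|) ≤ 36 * k * v := by
      have := neg_abs_le v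
      nlinarith
    linarith
  have hE0 := bumpE_nonneg d δ
  calc d ^ 2 + δ ^ 2 ≤ 24 * (49 / 256 * d ^ 2 * (1 / 2)) := by nlinarith [sq_nonneg d]
    _ ≤ 24 * (bumpE d δ * (1 + 18 * k * v)) := by gcongr
    _ = 2 * (4 * s) * (k * bumpE d δ * (1 + 18 * k * v)) := by
        rw [show 2 * (4 * s) * (k * bumpE d δ * (1 + 18 * k * v)) =
          8 * (k * s) * (bumpE d δ * (1 + 18 * k * v)) by ring, hks]
        ring

/-- Near a point of the boundary of a disc, the interpolating curves avoid the disc. -/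
lemma interp_mem_discCompl {n : ℕ} {k c t : ℝ} {q : (ℝ × ℝ) × (ℝ × ℝ)} (hk : k = 3 / discH n)
    (hq : 12 * k * |q.2.1 - q.1.1| ≤ 1 ∧ 36 * k * |q.1.2 + q.2.2 - 2 * c| ≤ 1)
    (h0 : q.1 ∈ discCompl n) (h1 : q.2 ∈ discCompl n) (hy0 : 0 ≤ q.1.2) (hy1 : 0 ≤ q.2.2)
    (ht : 0 ≤ t) (ht' : t ≤ 1) : interp k c t q ∈ discCompl n := by
  have hs := discH_pos n
  have hk0 : 0 ≤ k := by rw [hk]; positivity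
  have ht1 : 0 ≤ 1 - t := by linarith
  -- Displacements of slope at most `3 / 4` need the push; steeper ones stay in the cone over the lower
  -- end point.
  rcases le_total |q.2.2 - q.1.2| (3 / 4 * |q.2.1 - q.1.1|) with h | h
  · have hB := sq_add_sq_le_bump hs hk hq.2 h
    have hB0 := (bump_bounds hk0 hq.1 hq.2 (h.trans (by linarith [abs_nonneg (q.2.1 - q.1.1)]))).1
    have := sq_le_of_push (x₀ := q.1.1 - discX n) (x₁ := q.2.1 - discX n)
      (y₀ := q.1.2 + 4 * discH n) (y₁ := q.2.2 + 4 * discH n)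
      (σ := 4 * discH n) ht ht' h0 h1
      (by linarith) (by linarith) hB0
      (by simpa using hB)
    simp only [discCompl, mem_ofPred_eq, interp, curveY]
    convert this using 2 <;> ring
  · obtain ⟨B, hB, hB0, -, -⟩ := interp_snd hk0 hq
    have hpush : 0 ≤ t * (1 - t) * B := by positivity
    rcases le_total q.1.2 q.2.2 with hle | hle
    · rw [abs_of_nonneg (sub_nonneg.2 hle)] at h
      have := discCompl_cone h0 hy0 (a := t * (q.2.1 - q.1.1))
        (b := t * (q.2.2 - q.1.2) + t * (1 - t) * B) (by
          rw [abs_mul, abs_of_nonneg ht]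
          nlinarith)
      convert this using 1
      refine Prod.ext (by simp only [interp]; ring) ?_
      rw [hB t]; ring
    · rw [abs_of_nonpos (sub_nonpos.2 hle)] at h
      have := discCompl_cone h1 hy1 (a := (1 - t) * (q.1.1 - q.2.1))
        (b := (1 - t) * (q.1.2 - q.2.2) + t * (1 - t) * B) (by
          rw [abs_mul, abs_of_nonneg ht1, abs_sub_comm q.1.1]
          nlinarith)
      convert this using 1
      refine Prod.ext (by simp only [interp]; ring) ?_
      rw [hB t]; ring

lemma interp_fst_mem {I : Set ℝ} (hI : I.OrdConnected) {k c t : ℝ} {q : (ℝ × ℝ) × (ℝ × ℝ)}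
    (h0 : q.1.1 ∈ I) (h1 : q.2.1 ∈ I) (ht : 0 ≤ t) (ht' : t ≤ 1) : (interp k c t q).1 ∈ I :=
  hI.convex h0 h1 (sub_nonneg.2 ht') ht (by ring)

/-- A point that is not on a circle has a neighbourhood that avoids all discs. -/
lemma exists_ball_subset_discCompl {p : ℝ × ℝ}
    (hp : ∀ n, (5 * discH n) ^ 2 < (p.1 - discX n) ^ 2 + (p.2 + 4 * discH n) ^ 2) :
    ∃ r, 0 < r ∧ ∀ n, Metric.ball p r ⊆ discCompl n := by
  have hball : ∀ q ∈ Metric.ball p (1 / 2), |q.1 - p.1| ≤ 1 / 2 := fun q hq => by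
    rw [Metric.mem_ball, Prod.dist_eq, max_lt_iff, Real.dist_eq] at hq
    exact hq.1.le
  by_cases h : ∃ n, |p.1 - discX n| ≤ 1
  · obtain ⟨n, hn⟩ := h
    have hopen : IsOpen {q : ℝ × ℝ | (5 * discH n) ^ 2 < (q.1 - discX n) ^ 2 + (q.2 + 4 * discH n) ^ 2} :=
      isOpen_lt (by fun_prop) (by fun_prop)
    obtain ⟨r, hr, hsub⟩ := Metric.isOpen_iff.1 hopen p (hp n)
    refine ⟨min r (1 / 2), by positivity, fun m q hq => ?_⟩
    rcases eq_or_ne m n with rfl | hmn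
    · have hlt : (5 * discH m) ^ 2 < (q.1 - discX m) ^ 2 + (q.2 + 4 * discH m) ^ 2 :=
        hsub (Metric.ball_subset_ball (min_le_left _ _) hq)
      exact hlt.le
    · refine mem_discCompl_of_ne hmn ?_
      have h1 := hball q (Metric.ball_subset_ball (min_le_right _ _) hq)
      have h2 := abs_sub_le q.1 p.1 (discX n)
      linarith
  · push Not at h
    refine ⟨1 / 2, by norm_num, fun m q hq => mem_discCompl_of_abs_le ?_⟩
    have h1 := hball q hq
    have h2 := abs_sub_le p.1 q.1 (discX m)
    rw [abs_sub_comm p.1 q.1] at h2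
    linarith [h m]

/-- Near a point of a circle the push has size `k = 3 / ρ`, which is large enough to avoid the disc, and
the radius `ρ / 216` makes the displacements small enough for a push of this size. Near all other
points the set is locally convex, and segments (`k = 0`) are good enough. -/
theorem isCDLocally_discStrip {I : Set ℝ} (hI : I.OrdConnected) (hIc : IsClosed I) :
    IsCDLocally (lebesgueOn (discStrip I)) 0 4 := by
  refine isCDLocally_of_interp_mem (isClosed_discStrip hIc) fun p hp => ?_
  by_cases hcirc : ∃ n, (p.1 - discX n) ^ 2 + (p.2 + 4 * discH n) ^ 2 = (5 * discH n) ^ 2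
  · obtain ⟨n, hn⟩ := hcirc
    have hs := discH_pos n
    have hs' := discH_le n
    set s := discH n with hs_def
    have hpy : p.2 ≤ s := by
      by_contra hcon
      push Not at hcon
      nlinarith [sq_nonneg (p.1 - discX n)]
    have hpx : |p.1 - discX n| ≤ 3 * s := by
      refine abs_le_of_sq_le_sq ?_ (by positivity)
      nlinarith [hp.2.1]
    refine ⟨s / 216, 3 / s, by positivity, by positivity, le_of_eq (by field_simp; norm_num), ?_⟩
    rintro p₀ ⟨h0, hb0⟩ p₁ ⟨h1, hb1⟩ t ht ht'
    rw [Metric.mem_ball, Prod.dist_eq, max_lt_iff, Real.dist_eq, Real.dist_eq, abs_lt, abs_lt] at hb0 hb1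
    have d1 : |p₁.1 - p₀.1| ≤ s / 108 := abs_le.2 ⟨by linarith, by linarith⟩
    have d2 : |p₀.2 + p₁.2 - 2 * p.2| ≤ s / 108 := abs_le.2 ⟨by linarith, by linarith⟩
    have hq : 12 * (3 / s) * |p₁.1 - p₀.1| ≤ 1 ∧ 36 * (3 / s) * |p₀.2 + p₁.2 - 2 * p.2| ≤ 1 := by
      constructor
      · calc 12 * (3 / s) * |p₁.1 - p₀.1| ≤ 12 * (3 / s) * (s / 108) := by gcongr
          _ = 1 / 3 := by field_simp; norm_num
          _ ≤ 1 := by norm_num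
      · calc 36 * (3 / s) * |p₀.2 + p₁.2 - 2 * p.2| ≤ 36 * (3 / s) * (s / 108) := by gcongr
          _ = 1 := by field_simp; norm_num
    obtain ⟨B, hB, hB0, hB1, hB2⟩ := interp_snd (q := (p₀, p₁)) (by positivity) hq
    simp only at hB hB1 hB2
    have hBs : B ≤ s := by
      rcases le_total |p₁.1 - p₀.1| |p₁.2 - p₀.2| with h | h
      · rw [hB1 h]; exact hs.le
      · have := hB2 h
        have := abs_nonneg (p₁.2 - p₀.2)
        linarith
    have ht1 : 0 ≤ 1 - t := by linarith
    have hy0 := h0.2.1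
    have hy1 := h1.2.1
    refine ⟨interp_fst_mem hI h0.1 h1.1 ht ht', ?_, ?_, fun m => ?_⟩
    · rw [hB t]; positivity
    · rw [hB t]
      have u1 : (1 - t) * p₀.2 + t * p₁.2 ≤ 1 / 2 := by nlinarith
      have u2 : t * (1 - t) * B ≤ 1 * B := by gcongr; nlinarith
      linarith
    · rcases eq_or_ne m n with rfl | hmn
      · exact interp_mem_discCompl rfl hq (h0.2.2.2 m) (h1.2.2.2 m) hy0 hy1 ht ht'
      · refine mem_discCompl_of_ne hmn ?_
        have hx : (interp (3 / s) p.2 t (p₀, p₁)).1 ∈ Metric.ball p.1 (s / 216) :=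
          interp_fst_mem (convex_ball _ _).ordConnected
            (by rw [Metric.mem_ball, Real.dist_eq, abs_lt]; exact hb0.1)
            (by rw [Metric.mem_ball, Real.dist_eq, abs_lt]; exact hb1.1) ht ht'
        rw [Metric.mem_ball, Real.dist_eq] at hx
        have h2 := abs_sub_le (interp (3 / s) p.2 t (p₀, p₁)).1 p.1 (discX n)
        linarith
  · push Not at hcirc
    obtain ⟨r, hr, hsub⟩ := exists_ball_subset_discCompl (p := p) fun n =>
      lt_of_le_of_ne (hp.2.2.2 n) (hcirc n).symm
    refine ⟨r, 0, hr, le_rfl, by norm_num, ?_⟩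
    rintro p₀ ⟨h0, hb0⟩ p₁ ⟨h1, hb1⟩ t ht ht'
    have ht1 : 0 ≤ 1 - t := by linarith
    have hy0 := h0.2.1
    have hy1 := h1.2.1
    have hmem : interp 0 p.2 t (p₀, p₁) ∈ Metric.ball p r := by
      rw [interp_zero]
      exact (convex_ball p r) hb0 hb1 ht1 ht (by ring)
    refine ⟨interp_fst_mem hI h0.1 h1.1 ht ht', ?_, ?_, fun m => hsub m hmem⟩
    · rw [interp_zero]; positivity
    · rw [interp_zero]
      have := h0.2.2.1
      have := h1.2.2.1
      simp only
      nlinarith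

/-! ### Entropies of uniform and of concentrated measures -/

/-- The inverse density of the uniform measure on a set of measure `V` is `V`. -/
lemma rnDeriv_uniform {X : Type*} [MeasurableSpace X] {m μ : Measure X} [IsFiniteMeasure μ]
    {A : Set X} (hA : MeasurableSet A) {V : ℝ≥0∞} (hV : V ≠ 0) (hV' : V ≠ ⊤)
    (hμ : μ = V⁻¹ • m.restrict A) : ∀ᵐ x ∂μ, m.rnDeriv μ x = V := by
  have h := Measure.eq_rnDeriv (μ := m) (ν := μ) (s := m.restrict Aᶜ) (f := fun _ => V)
    measurable_const ?_ ?_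
  · filter_upwards [h] with x hx using hx.symm
  · refine ⟨A, hA, ?_, ?_⟩
    · rw [Measure.restrict_apply hA, inter_compl_self, measure_empty]
    · rw [hμ, Measure.smul_apply, Measure.restrict_apply hA.compl, compl_inter_self, measure_empty,
        smul_zero]
  · rw [withDensity_const, hμ, smul_smul, ENNReal.mul_inv_cancel hV hV', one_smul, add_comm,
      Measure.restrict_add_restrict_compl hA]

lemma entInfty_uniform_le {X : Type*} [MeasurableSpace X] {m μ : Measure X} [SigmaFinite m]
    {A : Set X} (hA : MeasurableSet A) {v : ℝ} (hv : 0 < v) (hv1 : v < 1)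
    (hmA : m A = ENNReal.ofReal v) (hμ : μ = (ENNReal.ofReal v)⁻¹ • m.restrict A) :
    entInfty m μ ≤ ((-Real.log v : ℝ) : EReal) := by
  have hac : μ ≪ m := by
    rw [hμ]
    exact (Measure.absolutelyContinuous_of_le Measure.restrict_le_self).smul_left _
  have hρ : μ.rnDeriv m =ᵐ[m] A.indicator fun _ => ENNReal.ofReal v⁻¹ := by
    have : μ = m.withDensity (A.indicator fun _ => ENNReal.ofReal v⁻¹) := by
      rw [withDensity_indicator hA, withDensity_const, hμ, ENNReal.ofReal_inv_of_pos hv]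
    rw [this]
    exact Measure.rnDeriv_withDensity _ (measurable_const.indicator hA)
  have hlog : 0 < -Real.log v := by
    have := Real.log_neg hv hv1
    linarith
  have hint : ∫⁻ x, ENNReal.ofReal ((μ.rnDeriv m x).toReal * Real.log (μ.rnDeriv m x).toReal) ∂m =
      ENNReal.ofReal (-Real.log v) := by
    calc ∫⁻ x, ENNReal.ofReal ((μ.rnDeriv m x).toReal * Real.log (μ.rnDeriv m x).toReal) ∂m
        = ∫⁻ x, A.indicator (fun _ => ENNReal.ofReal (v⁻¹ * -Real.log v)) x ∂m := by
          refine lintegral_congr_ae ?_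
          filter_upwards [hρ] with x hx
          rw [hx]
          by_cases hxA : x ∈ A
          · rw [indicator_of_mem hxA, indicator_of_mem hxA, ENNReal.toReal_ofReal (by positivity),
              Real.log_inv]
          · rw [indicator_of_notMem hxA, indicator_of_notMem hxA]; simp
      _ = ENNReal.ofReal (-Real.log v) := by
          rw [lintegral_indicator_const hA, hmA, ← ENNReal.ofReal_mul (by positivity)]
          congr 1
          field_simp
  unfold entInfty
  rw [if_pos ⟨hac, by rw [hint]; exact ENNReal.ofReal_ne_top⟩, hint]
  refine (EReal.sub_le_sub le_rfl (EReal.coe_ennreal_nonneg _)).trans (le_of_eq ?_)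
  rw [EReal.coe_ennreal_ofReal, max_eq_left hlog.le]
  simp

lemma ae_rnDeriv_eq_zero {X : Type*} [MeasurableSpace X] {m μ : Measure X} [SigmaFinite m]
    {M : Set X} (hM : MeasurableSet M) (hμM : μ Mᶜ = 0) : ∀ᵐ x ∂m, x ∉ M → μ.rnDeriv m x = 0 := by
  have h : ∫⁻ x in Mᶜ, μ.rnDeriv m x ∂m = 0 :=
    le_antisymm ((Measure.setLIntegral_rnDeriv_le Mᶜ).trans hμM.le) zero_le
  rw [lintegral_eq_zero_iff (Measure.measurable_rnDeriv _ _), Filter.EventuallyEq,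
    ae_restrict_iff' hM.compl] at h
  exact h

/-- A measure concentrated on a set `M` has Rényi functional at most `m(M)^(1/N)`, by Hölder's
inequality. -/
lemma renyi_le_of_concentrated {X : Type*} [MeasurableSpace X] {m μ : Measure X} [SigmaFinite m]
    [IsProbabilityMeasure μ] {M : Set X} (hM : MeasurableSet M) (hμM : μ Mᶜ = 0) {N : ℝ}
    (hN : 1 < N) : renyi m N μ ≤ m M ^ (1 / N) := by
  have hN0 : 0 ≤ 1 / N := by positivity
  have hN1 : 0 < 1 - 1 / N := by
    rw [sub_pos, div_lt_one (by linarith)]; exact hN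
  have hm := Measure.measurable_rnDeriv μ m
  calc renyi m N μ ≤ ∫⁻ x, μ.rnDeriv m x ^ (1 - 1 / N) ∂m := setLIntegral_le_lintegral _ _
    _ ≤ ∫⁻ x, μ.rnDeriv m x ^ (1 - 1 / N) * (M.indicator (fun _ => 1) x) ^ (1 / N) ∂m := by
        refine lintegral_mono_ae ?_
        filter_upwards [ae_rnDeriv_eq_zero hM hμM] with x hx
        by_cases hxM : x ∈ M
        · rw [indicator_of_mem hxM, ENNReal.one_rpow, mul_one]
        · rw [hx hxM, ENNReal.zero_rpow_of_pos hN1]; exact zero_le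
    _ ≤ (∫⁻ x, μ.rnDeriv m x ∂m) ^ (1 - 1 / N) * (∫⁻ x, M.indicator (fun _ => 1) x ∂m) ^ (1 / N) :=
        ENNReal.lintegral_mul_norm_pow_le hm.aemeasurable
          (measurable_const.indicator hM).aemeasurable hN1.le hN0 (by ring)
    _ ≤ 1 ^ (1 - 1 / N) * m M ^ (1 / N) := by
        rw [lintegral_indicator_const hM, one_mul]
        gcongr
        exact (Measure.lintegral_rnDeriv_le).trans (measure_univ (μ := μ)).le
    _ = m M ^ (1 / N) := by rw [ENNReal.one_rpow, one_mul]

/-- The tangent line of `x log x` at `a`. -/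
lemma mul_log_ge {x a : ℝ} (hx : 0 ≤ x) (ha : 0 < a) : x * (Real.log a + 1) - a ≤ x * Real.log x := by
  rcases hx.eq_or_lt with rfl | hx
  · simp [ha.le]
  have h := Real.log_le_sub_one_of_pos (div_pos ha hx)
  rw [Real.log_div ha.ne' hx.ne'] at h
  have h2 := mul_le_mul_of_nonneg_left h hx.le
  have h3 : x * (a / x - 1) = a - x := by field_simp
  linarith

/-- A measure concentrated on a set of measure at most `v` has entropy at least `-log v`: this is
Jensen's inequality, obtained by integrating the tangent line at `1 / v`. The integral of the negative
part of the entropy is finite, so that the entropy is not a junk value. -/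
lemma le_entInfty_of_concentrated {X : Type*} [MeasurableSpace X] {m μ : Measure X} [SigmaFinite m]
    [IsProbabilityMeasure μ] {M : Set X} (hM : MeasurableSet M) (hμM : μ Mᶜ = 0) {v : ℝ} (hv : 0 < v)
    (hmM : m M ≤ ENNReal.ofReal v) : ((-Real.log v : ℝ) : EReal) ≤ entInfty m μ := by
  unfold entInfty
  split_ifs with h
  swap
  · exact le_top
  obtain ⟨hac, hP⟩ := h
  set ρ : X → ℝ := fun x => (μ.rnDeriv m x).toReal with hρ
  have hρm : Measurable ρ := (Measure.measurable_rnDeriv _ _).ennreal_toReal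
  have hρ0 : ∀ x, 0 ≤ ρ x := fun x => ENNReal.toReal_nonneg
  have hMfin : m M ≠ ⊤ := (hmM.trans_lt ENNReal.ofReal_lt_top).ne
  set a := v⁻¹ with ha
  have hapos : 0 < a := inv_pos.2 hv
  set b : X → ℝ := fun x => ρ x * (Real.log a + 1) - M.indicator (fun _ => a) x with hb
  have hρint : Integrable ρ m := Measure.integrable_toReal_rnDeriv
  have hiint : Integrable (M.indicator fun _ => a) m :=
    (integrable_indicator_iff hM).2 (integrableOn_const hMfin)
  have hbint : Integrable b m := (hρint.mul_const _).sub hiint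
  have hle : ∀ᵐ x ∂m, b x ≤ ρ x * Real.log (ρ x) := by
    filter_upwards [ae_rnDeriv_eq_zero hM hμM] with x hx
    by_cases hxM : x ∈ M
    · simp only [hb]
      rw [indicator_of_mem hxM]
      exact mul_log_ge (hρ0 x) hapos
    · have : ρ x = 0 := by simp only [hρ, hx hxM, ENNReal.toReal_zero]
      simp only [hb]
      rw [indicator_of_notMem hxM, this]
      simp
  have hfm : Measurable fun x => ρ x * Real.log (ρ x) := hρm.mul (Real.measurable_log.comp hρm)
  have hQ : ∫⁻ x, ENNReal.ofReal (-(ρ x * Real.log (ρ x))) ∂m ≠ ⊤ := by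
    refine ne_top_of_le_ne_top hbint.2.ne (lintegral_mono_ae ?_)
    filter_upwards [hle] with x hx
    rw [← ofReal_norm, Real.norm_eq_abs]
    exact ENNReal.ofReal_le_ofReal (by have := neg_abs_le (b x); linarith)
  have hfint : Integrable (fun x => ρ x * Real.log (ρ x)) m := by
    refine ⟨hfm.aestronglyMeasurable, ?_⟩
    refine lt_of_le_of_lt (b := ∫⁻ x, ENNReal.ofReal (ρ x * Real.log (ρ x)) +
      ENNReal.ofReal (-(ρ x * Real.log (ρ x))) ∂m) (lintegral_mono fun x => ?_) ?_
    · rw [← ofReal_norm, Real.norm_eq_abs]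
      rcases abs_choice (ρ x * Real.log (ρ x)) with h | h <;> rw [h]
      · exact le_add_of_nonneg_right zero_le
      · exact le_add_of_nonneg_left zero_le
    · rw [lintegral_add_left (by fun_prop)]
      exact ENNReal.add_lt_top.2 ⟨hP.lt_top, hQ.lt_top⟩
  have hI := integral_eq_lintegral_pos_part_sub_lintegral_neg_part hfint
  have hint1 : ∫ x, ρ x ∂m = 1 := by
    rw [Measure.integral_toReal_rnDeriv hac]
    simp
  have hbI : -Real.log v ≤ ∫ x, b x ∂m := by
    rw [integral_sub (hρint.mul_const _) hiint, integral_mul_const, hint1,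
      integral_indicator_const _ hM, smul_eq_mul]
    have h1 : m.real M ≤ v := ENNReal.toReal_le_of_le_ofReal hv.le hmM
    have h2 : m.real M * a ≤ 1 := by
      calc m.real M * a ≤ v * a := by gcongr
        _ = 1 := mul_inv_cancel₀ hv.ne'
    rw [ha, Real.log_inv] at *
    linarith
  have hfin := hbI.trans (integral_mono_ae hbint hfint hle)
  rw [hI] at hfin
  rw [← EReal.coe_toReal (EReal.coe_ennreal_eq_top_iff.not.2 hP) (EReal.coe_ennreal_ne_bot _),
    ← EReal.coe_toReal (EReal.coe_ennreal_eq_top_iff.not.2 hQ) (EReal.coe_ennreal_ne_bot _),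
    ← EReal.coe_sub, EReal.coe_le_coe_iff]
  simpa only [EReal.toReal_coe_ennreal] using hfin

/-! ### Lower bounds of the distortion coefficients at the midpoint -/

/-- At the midpoint `σ` is at least `1 / 2` for `K ≥ 0`, and `1 / (2 cosh x)` with
`x = θ √(-K / N) / 2` for `K < 0`, where `cosh x ≤ exp (x² / 2)`. -/
lemma half_exp_le_sigmaCoeff {K N θ : ℝ} (hN : 0 < N) (hθ : 0 < θ) :
    ENNReal.ofReal (1 / 2 * Real.exp (-(|K| * θ ^ 2 / (8 * N)))) ≤ sigmaCoeff K N (1 / 2) θ := by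
  have hexp : 1 / 2 * Real.exp (-(|K| * θ ^ 2 / (8 * N))) ≤ 1 / 2 := by
    have : Real.exp (-(|K| * θ ^ 2 / (8 * N))) ≤ 1 := Real.exp_le_one_iff.2 (by
      rw [neg_nonpos]; positivity)
    linarith
  unfold sigmaCoeff
  split_ifs with h1 h2 h3
  · exact le_top
  · refine ENNReal.ofReal_le_ofReal (hexp.trans ?_)
    have hK : 0 < K := pos_of_mul_pos_left h2 (sq_nonneg θ)
    set x := 1 / 2 * θ * √(K / N) with hx
    have hx0 : 0 < x := by positivity
    have e : θ * √(K / N) = 2 * x := by rw [hx]; ring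
    have hlt : 2 * x < Real.pi := by
      rw [← e]
      refine lt_of_pow_lt_pow_left₀ 2 Real.pi_pos.le ?_
      rw [mul_pow, Real.sq_sqrt (by positivity), mul_div_assoc', div_lt_iff₀ hN]
      push Not at h1
      linarith
    rw [e, le_div_iff₀ (Real.sin_pos_of_pos_of_lt_pi (by linarith) hlt), Real.sin_two_mul]
    have h4 := Real.cos_le_one x
    have h5 := (Real.sin_pos_of_pos_of_lt_pi hx0 (by linarith)).le
    nlinarith
  · exact ENNReal.ofReal_le_ofReal hexp
  · have hK : K < 0 := by
      by_contra hcon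
      push Not at hcon
      have : 0 ≤ K * θ ^ 2 := by positivity
      exact h3 (le_antisymm (not_lt.1 h2) this)
    refine ENNReal.ofReal_le_ofReal ?_
    have hKN : 0 < -K / N := div_pos (neg_pos.2 hK) hN
    set x := 1 / 2 * θ * √(-K / N) with hx
    have hx0 : 0 < x := by positivity
    have e : θ * √(-K / N) = 2 * x := by rw [hx]; ring
    have hx2 : |K| * θ ^ 2 / (8 * N) = x ^ 2 / 2 := by
      rw [hx, mul_pow, Real.sq_sqrt hKN.le, abs_of_neg hK]; field_simp; ring
    have hs := Real.sinh_pos_iff.2 hx0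
    rw [e, hx2, le_div_iff₀ (Real.sinh_pos_iff.2 (by positivity)), Real.sinh_two_mul]
    have h4 : Real.cosh x ≤ Real.exp (x ^ 2 / 2) := Real.cosh_le_exp_half_sq x
    have h5 : Real.exp (-(x ^ 2 / 2)) * Real.cosh x ≤ 1 := by
      calc Real.exp (-(x ^ 2 / 2)) * Real.cosh x
          ≤ Real.exp (-(x ^ 2 / 2)) * Real.exp (x ^ 2 / 2) := by gcongr
        _ = 1 := by rw [← Real.exp_add, neg_add_cancel, Real.exp_zero]
    calc 1 / 2 * Real.exp (-(x ^ 2 / 2)) * (2 * Real.sinh x * Real.cosh x)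
        = Real.sinh x * (Real.exp (-(x ^ 2 / 2)) * Real.cosh x) := by ring
      _ ≤ Real.sinh x * 1 := by gcongr
      _ = Real.sinh x := mul_one _

/-- The bound for `τ` is the same as for `σ`: the power `1 - 1 / N` of `exp (- κ / (N - 1))` is
`exp (- κ / N)`. -/
lemma half_exp_le_tauCoeff {K N θ : ℝ} (hN : 1 < N) (hθ : 0 < θ) :
    ENNReal.ofReal (1 / 2 * Real.exp (-(|K| * θ ^ 2 / (8 * N)))) ≤ tauCoeff K N (1 / 2) θ := by
  have hexp : 1 / 2 * Real.exp (-(|K| * θ ^ 2 / (8 * N))) ≤ 1 / 2 := by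
    have : Real.exp (-(|K| * θ ^ 2 / (8 * N))) ≤ 1 := Real.exp_le_one_iff.2 (by
      rw [neg_nonpos]; positivity)
    linarith
  unfold tauCoeff
  split_ifs with h1 h2
  · exact ENNReal.ofReal_le_ofReal hexp
  · exact le_top
  · have hN1 : 0 < N - 1 := by linarith
    have hp : 0 ≤ 1 - 1 / N := by
      rw [sub_nonneg, div_le_one (by linarith)]; exact hN.le
    refine le_trans (le_of_eq ?_) (mul_le_mul_right
      (ENNReal.rpow_le_rpow (half_exp_le_sigmaCoeff (K := K) hN1 hθ) hp) _)
    rw [ENNReal.ofReal_rpow_of_nonneg (by positivity) hp, ← ENNReal.ofReal_mul (by positivity)]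
    congr 1
    rw [Real.mul_rpow (by norm_num) (Real.exp_pos _).le, ← mul_assoc,
      ← Real.rpow_add (by norm_num), add_sub_cancel, Real.rpow_one, ← Real.exp_mul]
    congr 2
    have : N ≠ 0 := by linarith
    field_simp

/-! ### Optimal transport through a neck -/

/-- If a translation by `l` along the first coordinate transports `μ₀` to `μ₁`, then all optimal
geodesics between `μ₀` and `μ₁` have length `l`, and end points at horizontal distance `l`: the mean of
the horizontal displacement is `l`, it is at most the length, and the mean square of the length is
at most `l ^ 2`. -/
lemma IsOptGeo.ae_dist_eq_of_translation {X : Set (ℝ × ℝ)} {μ₀ μ₁ : Measure X}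
    [IsProbabilityMeasure μ₀] {T : X → X} (hT : Measurable T) (hT1 : μ₀.map T = μ₁) {l : ℝ}
    (hl : 0 ≤ l) (hTl : ∀ᵐ x ∂μ₀, ((T x : ℝ × ℝ)) = (x.1.1 + l, x.1.2))
    (hint : Integrable (fun x : X => x.1.1) μ₀) :
    W2sq μ₀ μ₁ ≤ ENNReal.ofReal (l ^ 2) ∧
    ∀ π, IsOptGeo π μ₀ μ₁ → ∀ᵐ γ ∂π, dist (γ.eval 0) (γ.eval 1) = l ∧
      (γ.eval 1).1.1 = (γ.eval 0).1.1 + l := by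
  have hpair : Measurable fun x => (x, T x) := measurable_id.prodMk hT
  have hW : W2sq μ₀ μ₁ ≤ ENNReal.ofReal (l ^ 2) := by
    have hc : IsCoupling (μ₀.map fun x => (x, T x)) μ₀ μ₁ := by
      constructor
      · rw [Measure.map_map measurable_fst hpair]; exact Measure.map_id
      · rw [Measure.map_map measurable_snd hpair]; exact hT1
    refine (iInf₂_le (f := fun (γ : Measure (X × X)) (_ : IsCoupling γ μ₀ μ₁) => quadCost γ) _ hc).trans
      (le_of_eq ?_)
    rw [quadCost, lintegral_map (by fun_prop) hpair]
    have : ∀ᵐ x ∂μ₀, edist x (T x) ^ 2 = ENNReal.ofReal (l ^ 2) := by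
      filter_upwards [hTl] with x hx
      rw [Subtype.edist_eq, edist_dist, dist_pair_eq, hx, ← ENNReal.ofReal_pow (by positivity)]
      simp [abs_of_nonneg hl, hl]
    rw [lintegral_congr_ae this, lintegral_const, measure_univ, mul_one]
  refine ⟨hW, fun π ⟨hπ, hcoup, hopt⟩ => ?_⟩
  have hends : Measurable fun γ : Geo X => (γ.eval 0, γ.eval 1) :=
    (measurable_eval 0).prodMk (measurable_eval 1)
  have hm0 : π.map (Geo.eval 0) = μ₀ := by
    rw [← hcoup.1, Measure.map_map measurable_fst hends]; rfl
  have hm1 : π.map (Geo.eval 1) = μ₁ := by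
    rw [← hcoup.2, Measure.map_map measurable_snd hends]; rfl
  have hfstm : Measurable fun x : X => x.1.1 := by fun_prop
  set d : Geo X → ℝ := fun γ => dist (γ.eval 0) (γ.eval 1) with hd
  set x₀ : Geo X → ℝ := fun γ => (γ.eval 0).1.1 with hx₀
  set x₁ : Geo X → ℝ := fun γ => (γ.eval 1).1.1 with hx₁
  have hdm : Measurable d := by fun_prop
  have hTfst : (fun x => (T x).1.1) =ᵐ[μ₀] fun x => x.1.1 + l := by
    filter_upwards [hTl] with x hx
    rw [hx]
  have hi0 : Integrable x₀ π := by
    rw [← hm0] at hint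
    exact hint.comp_measurable (measurable_eval 0)
  have hint1 : Integrable (fun x : X => x.1.1) μ₁ := by
    rw [← hT1, integrable_map_measure hfstm.aestronglyMeasurable hT.aemeasurable]
    exact (hint.add (integrable_const l)).congr hTfst.symm
  have hi1 : Integrable x₁ π := by
    rw [← hm1] at hint1
    exact hint1.comp_measurable (measurable_eval 1)
  have hmean : ∫ γ, (x₁ γ - x₀ γ) ∂π = l := by
    rw [integral_sub hi1 hi0]
    have e0 : ∫ γ, x₀ γ ∂π = ∫ x, x.1.1 ∂μ₀ := by
      rw [← hm0, integral_map (measurable_eval 0).aemeasurable hfstm.aestronglyMeasurable]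
    have e1 : ∫ γ, x₁ γ ∂π = ∫ x, x.1.1 ∂μ₀ + l := by
      rw [← integral_map (f := fun x : X => x.1.1) (measurable_eval 1).aemeasurable
        hfstm.aestronglyMeasurable, hm1, ← hT1,
        integral_map hT.aemeasurable hfstm.aestronglyMeasurable, integral_congr_ae hTfst,
        integral_add hint (integrable_const l)]
      simp
    rw [e0, e1]; ring
  have hcost : ∫⁻ γ, ENNReal.ofReal (d γ ^ 2) ∂π ≤ ENNReal.ofReal (l ^ 2) := by
    refine le_trans (le_of_eq ?_) hW
    rw [← hopt, quadCost, lintegral_map (by fun_prop) hends]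
    refine lintegral_congr fun γ => ?_
    rw [edist_dist, ENNReal.ofReal_pow dist_nonneg]
  have hsq : Integrable (fun γ => d γ ^ 2) π := by
    refine ⟨(hdm.pow_const 2).aestronglyMeasurable, ?_⟩
    rw [hasFiniteIntegral_iff_ofReal (Filter.Eventually.of_forall fun γ => sq_nonneg _)]
    exact hcost.trans_lt ENNReal.ofReal_lt_top
  have hsqle : ∫ γ, d γ ^ 2 ∂π ≤ l ^ 2 := by
    rw [integral_eq_lintegral_of_nonneg_ae (Filter.Eventually.of_forall fun γ => sq_nonneg _)
      hsq.aestronglyMeasurable]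
    exact ENNReal.toReal_le_of_le_ofReal (sq_nonneg l) hcost
  have hdint : Integrable d π :=
    ((memLp_two_iff_integrable_sq hdm.aestronglyMeasurable).2 hsq).integrable (by norm_num)
  -- The chain `l = E[x₁ - x₀] ≤ E[d] ≤ E[d²]^(1/2) ≤ l` consists of equalities.
  have hle : ∀ γ, x₁ γ - x₀ γ ≤ d γ := fun γ => by
    rw [hd]
    simp only
    rw [Subtype.dist_eq, dist_pair_eq]
    exact (le_abs_self _).trans (le_max_left _ _)
  have hdl : l ≤ ∫ γ, d γ ∂π := hmean ▸ integral_mono (hi1.sub hi0) hdint hle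
  have e : (fun γ => (d γ - l) ^ 2) = fun γ => d γ ^ 2 - 2 * l * d γ + l ^ 2 := by
    funext γ; ring
  have hlin : Integrable (fun γ => d γ ^ 2 - 2 * l * d γ) π := hsq.sub (hdint.const_mul _)
  have hvar : ∫ γ, (d γ - l) ^ 2 ∂π ≤ 0 := by
    rw [e, integral_add hlin (integrable_const _), integral_sub hsq (hdint.const_mul _), integral_const_mul]
    simp only [integral_const, probReal_univ, smul_eq_mul, one_mul]
    nlinarith
  have hvint : Integrable (fun γ => (d γ - l) ^ 2) π := by
    rw [e]
    exact hlin.add (integrable_const _)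
  have h1 : (fun γ => (d γ - l) ^ 2) =ᵐ[π] 0 :=
    (integral_eq_zero_iff_of_nonneg (fun γ => sq_nonneg _) hvint).1
      (le_antisymm hvar (integral_nonneg fun γ => sq_nonneg _))
  have hdl' : ∀ᵐ γ ∂π, d γ = l := by
    filter_upwards [h1] with γ hγ
    have : d γ - l = 0 := pow_eq_zero_iff (by norm_num) |>.1 hγ
    linarith
  have hdeq : ∫ γ, d γ ∂π = l := by
    rw [integral_congr_ae hdl']; simp
  have hi : Integrable (fun γ => x₁ γ - x₀ γ) π := hi1.sub hi0
  have h2 : (fun γ => d γ - (x₁ γ - x₀ γ)) =ᵐ[π] 0 := by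
    refine (integral_eq_zero_iff_of_nonneg (fun γ => sub_nonneg.2 (hle γ)) (hdint.sub hi)).1 ?_
    rw [integral_sub hdint hi, hmean, hdeq, sub_self]
  filter_upwards [hdl', h2] with γ hγ hγ2
  refine ⟨hγ, ?_⟩
  have : d γ - (x₁ γ - x₀ γ) = 0 := hγ2
  simp only [hx₀, hx₁] at this
  linarith

/-- The midpoint of the unit interval. -/
def midTime : unitInterval := ⟨1 / 2, by norm_num, by norm_num⟩

lemma coe_midTime : (midTime : ℝ) = 1 / 2 := rfl

lemma Geo.dist_eval {X : Type*} [MetricSpace X] (γ : Geo X) (s t : unitInterval) :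
    dist (γ.eval s) (γ.eval t) = |(s : ℝ) - t| * dist (γ.eval 0) (γ.eval 1) := γ.2 s t

/-- A geodesic whose length equals its horizontal displacement is at half of this displacement at the
midpoint. -/
lemma eval_midTime_fst {X : Set (ℝ × ℝ)} {γ : Geo X} {l : ℝ} (hd : dist (γ.eval 0) (γ.eval 1) = l)
    (hx : (γ.eval 1).1.1 = (γ.eval 0).1.1 + l) :
    (γ.eval midTime).1.1 = (γ.eval 0).1.1 + l / 2 := by
  have h0 : dist (γ.eval 0) (γ.eval midTime) = 1 / 2 * l := by
    rw [γ.dist_eval, hd, coe_midTime, Set.Icc.coe_zero]; norm_num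
  have h1 : dist (γ.eval midTime) (γ.eval 1) = 1 / 2 * l := by
    rw [γ.dist_eval, hd, coe_midTime, Set.Icc.coe_one]; norm_num
  rw [Subtype.dist_eq, dist_pair_eq] at h0 h1
  have e0 := (le_abs_self _).trans ((le_max_left _ _).trans h0.le)
  have e1 := (le_abs_self _).trans ((le_max_left _ _).trans h1.le)
  linarith

/-- `X` consists, near the vertical line over `c`, of two rectangles of unit height, and of a lower
passage between them. The rectangles have width `2 ρ`, and `8 ρ` is the distance of corresponding
points, whose midpoints are at horizontal distance at most `ρ` from `c`. -/
structure NeckAt (X : Set (ℝ × ℝ)) (c ρ : ℝ) : Prop where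
  measurableSet : MeasurableSet X
  pos : 0 < ρ
  le : ρ ≤ 1 / 20
  left_subset : Icc (c - 5 * ρ) (c - 3 * ρ) ×ˢ Icc (0 : ℝ) 1 ⊆ X
  right_subset : Icc (c + 3 * ρ) (c + 5 * ρ) ×ˢ Icc (0 : ℝ) 1 ⊆ X
  passage : ∀ p ∈ X, |p.1 - c| ≤ ρ → ρ / 2 ≤ p.2 ∧ p.2 ≤ 1

lemma lebesgueOn_preimage {X A : Set (ℝ × ℝ)} (hX : MeasurableSet X) :
    lebesgueOn X (Subtype.val ⁻¹' A) = volume (A ∩ X) := by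
  rw [lebesgueOn, (MeasurableEmbedding.subtype_coe hX).comap_apply, Subtype.image_preimage_coe,
    inter_comm]

lemma volume_Icc_prod (a b y z : ℝ) (h : a ≤ b) :
    volume (Icc a b ×ˢ Icc y z) = ENNReal.ofReal ((b - a) * (z - y)) := by
  rw [Measure.volume_eq_prod, Measure.prod_prod, Real.volume_Icc, Real.volume_Icc,
    ENNReal.ofReal_mul (sub_nonneg.2 h)]

/-- The uniform probability measure on the part of `X` in `A`, a set of measure `2 ρ`. -/
def uniformOn (X A : Set (ℝ × ℝ)) (ρ : ℝ) : Measure X :=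
  (ENNReal.ofReal (2 * ρ))⁻¹ • (lebesgueOn X).restrict (Subtype.val ⁻¹' A)

section uniformOn

variable {X A : Set (ℝ × ℝ)} {ρ : ℝ}

lemma isProbabilityMeasure_uniformOn
    (hA : lebesgueOn X (Subtype.val ⁻¹' A) = ENNReal.ofReal (2 * ρ)) (hρ : 0 < ρ) :
    IsProbabilityMeasure (uniformOn X A ρ) := by
  constructor
  rw [uniformOn, Measure.smul_apply, Measure.restrict_apply_univ, hA, smul_eq_mul,
    ENNReal.inv_mul_cancel (ENNReal.ofReal_pos.2 (by positivity)).ne' ENNReal.ofReal_ne_top]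

lemma ae_mem_uniformOn (hA : MeasurableSet A) : ∀ᵐ x : X ∂(uniformOn X A ρ), (x : ℝ × ℝ) ∈ A :=
  Measure.smul_absolutelyContinuous.ae_le (ae_restrict_mem (measurable_subtype_coe hA))

lemma support_uniformOn_subset (hA : IsClosed A) :
    (uniformOn X A ρ).support ⊆ Subtype.val ⁻¹' A :=
  Measure.support_subset_of_isClosed (hA.preimage continuous_subtype_val)
    (ae_mem_uniformOn hA.measurableSet)

lemma isBounded_support_uniformOn (hA : IsClosed A) (hb : Bornology.IsBounded A) :
    Bornology.IsBounded (uniformOn X A ρ).support := by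
  refine Bornology.IsBounded.subset ?_ (support_uniformOn_subset hA)
  obtain ⟨C, hC⟩ := Metric.isBounded_iff.1 hb
  exact Metric.isBounded_iff.2 ⟨C, fun x hx y hy => hC hx hy⟩

lemma uniformOn_absolutelyContinuous : uniformOn X A ρ ≪ lebesgueOn X :=
  (Measure.absolutelyContinuous_of_le Measure.restrict_le_self).smul_left _

lemma map_val_uniformOn (hX : MeasurableSet X) (hA : MeasurableSet A) (hAX : A ⊆ X) :
    (uniformOn X A ρ).map Subtype.val = (ENNReal.ofReal (2 * ρ))⁻¹ • volume.restrict A := by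
  rw [uniformOn, Measure.map_smul, ← Measure.restrict_map measurable_subtype_coe hA,
    map_val_lebesgueOn hX, Measure.restrict_restrict hA, inter_eq_self_of_subset_left hAX]

end uniformOn

/-- Two uniform measures on the sides of a neck, such that all optimal geodesics between them have
length `8 ρ` and pass at the midpoint through a set `M`, which is smaller than the rectangles by the
factor `1 - ρ / 2`. -/
lemma NeckAt.exists_measures {X : Set (ℝ × ℝ)} {c ρ : ℝ} (h : NeckAt X c ρ) :
    ∃ A B M : Set X, MeasurableSet A ∧ MeasurableSet B ∧ MeasurableSet M ∧
      lebesgueOn X A = ENNReal.ofReal (2 * ρ) ∧ lebesgueOn X B = ENNReal.ofReal (2 * ρ) ∧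
      lebesgueOn X M ≤ ENNReal.ofReal (2 * ρ * (1 - ρ / 2)) ∧
      ∃ μ₀ μ₁ : Measure X, IsProbabilityMeasure μ₀ ∧ IsProbabilityMeasure μ₁ ∧
        μ₀ = (ENNReal.ofReal (2 * ρ))⁻¹ • (lebesgueOn X).restrict A ∧
        μ₁ = (ENNReal.ofReal (2 * ρ))⁻¹ • (lebesgueOn X).restrict B ∧
        Bornology.IsBounded μ₀.support ∧ Bornology.IsBounded μ₁.support ∧
        μ₀.support ⊆ (lebesgueOn X).support ∧ μ₁.support ⊆ (lebesgueOn X).support ∧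
        W2sq μ₀ μ₁ ≤ ENNReal.ofReal ((8 * ρ) ^ 2) ∧
        ∀ π, IsOptGeo π μ₀ μ₁ → (∀ᵐ γ ∂π, dist (γ.eval 0) (γ.eval 1) = 8 * ρ) ∧
          π.map (Geo.eval midTime) Mᶜ = 0 := by
  have hρ := h.pos
  have hX := h.measurableSet
  set A : Set (ℝ × ℝ) := Icc (c - 5 * ρ) (c - 3 * ρ) ×ˢ Icc (0 : ℝ) 1 with hA
  set B : Set (ℝ × ℝ) := Icc (c + 3 * ρ) (c + 5 * ρ) ×ˢ Icc (0 : ℝ) 1 with hB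
  have hAc : IsClosed A := isClosed_Icc.prod isClosed_Icc
  have hBc : IsClosed B := isClosed_Icc.prod isClosed_Icc
  have hAb : Bornology.IsBounded A := (Metric.isBounded_Icc _ _).prod (Metric.isBounded_Icc _ _)
  have hBb : Bornology.IsBounded B := (Metric.isBounded_Icc _ _).prod (Metric.isBounded_Icc _ _)
  have hAvol : lebesgueOn X (Subtype.val ⁻¹' A) = ENNReal.ofReal (2 * ρ) := by
    rw [lebesgueOn_preimage hX, inter_eq_self_of_subset_left h.left_subset,
      volume_Icc_prod _ _ _ _ (by linarith)]
    congr 1; ring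
  have hBvol : lebesgueOn X (Subtype.val ⁻¹' B) = ENNReal.ofReal (2 * ρ) := by
    rw [lebesgueOn_preimage hX, inter_eq_self_of_subset_left h.right_subset,
      volume_Icc_prod _ _ _ _ (by linarith)]
    congr 1; ring
  have hP0 := isProbabilityMeasure_uniformOn hAvol hρ
  have hP1 := isProbabilityMeasure_uniformOn hBvol hρ
  set M : Set (ℝ × ℝ) := {p | |p.1 - c| ≤ ρ} with hM
  have hMm : MeasurableSet M := measurableSet_le (by fun_prop) (by fun_prop)
  have htrans : ∀ p ∈ A, (p.1 + 8 * ρ, p.2) ∈ B := by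
    rintro p ⟨h1, h2⟩
    exact ⟨⟨by linarith [h1.1], by linarith [h1.2]⟩, h2⟩
  have hAemb : MeasurableEmbedding (Subtype.val : (Subtype.val ⁻¹' A : Set X) → X) :=
    MeasurableEmbedding.subtype_coe (measurable_subtype_coe hAc.measurableSet)
  -- The translation by `8 ρ`, as a map of `X`; its values outside of `A` do not matter.
  obtain ⟨T, hT, hTA⟩ := hAemb.exists_measurable_extend
    (g := fun x => (⟨(x.1.1.1 + 8 * ρ, x.1.1.2), h.right_subset (htrans _ x.2)⟩ : X))
    (by fun_prop) fun x => ⟨x⟩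
  have hTA' : ∀ x : X, (x : ℝ × ℝ) ∈ A → ((T x : ℝ × ℝ)) = (x.1.1 + 8 * ρ, x.1.2) := fun x hx =>
    congrArg Subtype.val (congrFun hTA ⟨x, hx⟩)
  have hTl : ∀ᵐ x ∂(uniformOn X A ρ), ((T x : ℝ × ℝ)) = (x.1.1 + 8 * ρ, x.1.2) := by
    filter_upwards [ae_mem_uniformOn hAc.measurableSet] with x hx using hTA' x hx
  have hTmap : (uniformOn X A ρ).map T = uniformOn X B ρ := by
    refine (MeasurableEmbedding.subtype_coe hX).map_injective ?_
    rw [map_val_uniformOn hX hBc.measurableSet h.right_subset, Measure.map_map measurable_subtype_coe hT]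
    have e : (Subtype.val ∘ T) =ᵐ[uniformOn X A ρ] (fun p : ℝ × ℝ => p + (8 * ρ, 0)) ∘ Subtype.val := by
      filter_upwards [hTl] with x hx
      simp only [Function.comp_apply, hx]
      exact Prod.ext rfl (add_zero _).symm
    rw [Measure.map_congr e, ← Measure.map_map (by fun_prop) measurable_subtype_coe,
      map_val_uniformOn hX hAc.measurableSet h.left_subset, Measure.map_smul]
    congr 1
    have hpre : A = (fun p : ℝ × ℝ => p + (8 * ρ, 0)) ⁻¹' B := by
      ext p
      simp only [hA, hB, mem_preimage, mem_prod, mem_Icc, Prod.fst_add, Prod.snd_add, add_zero]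
      constructor
      · rintro ⟨⟨h1, h2⟩, h3⟩; exact ⟨⟨by linarith, by linarith⟩, h3⟩
      · rintro ⟨⟨h1, h2⟩, h3⟩; exact ⟨⟨by linarith, by linarith⟩, h3⟩
    rw [hpre, ← Measure.restrict_map (by fun_prop) hBc.measurableSet,
      (measurePreserving_add_right (volume : Measure (ℝ × ℝ)) (8 * ρ, 0)).map_eq]
  have hint : Integrable (fun x : X => x.1.1) (uniformOn X A ρ) := by
    refine Integrable.of_bound (by fun_prop : Measurable fun x : X => x.1.1).aestronglyMeasurable
      (|c| + 5 * ρ) ?_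
    filter_upwards [ae_mem_uniformOn hAc.measurableSet] with x hx
    have h1 := hx.1
    rw [Real.norm_eq_abs, abs_le]
    have h2 := le_abs_self c
    have h3 := neg_abs_le c
    exact ⟨by linarith [h1.1], by linarith [h1.2]⟩
  obtain ⟨hW, hgeo⟩ := IsOptGeo.ae_dist_eq_of_translation hT hTmap (by positivity : 0 ≤ 8 * ρ) hTl hint
  refine ⟨Subtype.val ⁻¹' A, Subtype.val ⁻¹' B, Subtype.val ⁻¹' M,
    measurable_subtype_coe hAc.measurableSet, measurable_subtype_coe hBc.measurableSet,
    measurable_subtype_coe hMm, hAvol, hBvol, ?_, uniformOn X A ρ, uniformOn X B ρ, hP0, hP1, rfl, rfl,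
    isBounded_support_uniformOn hAc hAb, isBounded_support_uniformOn hBc hBb,
    uniformOn_absolutelyContinuous.support_mono, uniformOn_absolutelyContinuous.support_mono, hW,
    fun π hπ => ⟨(hgeo π hπ).mono fun γ hγ => hγ.1, ?_⟩⟩
  · rw [lebesgueOn_preimage hX]
    have hsub : M ∩ X ⊆ Icc (c - ρ) (c + ρ) ×ˢ Icc (ρ / 2) 1 := by
      rintro p ⟨hpM, hpX⟩
      obtain ⟨h1, h2⟩ := h.passage p hpX hpM
      have hpM' : |p.1 - c| ≤ ρ := hpM
      rw [abs_le] at hpM'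
      exact ⟨⟨by linarith [hpM'.1], by linarith [hpM'.2]⟩, h1, h2⟩
    refine (measure_mono hsub).trans (le_of_eq ?_)
    rw [volume_Icc_prod _ _ _ _ (by linarith)]
    congr 1; ring
  · have hm0 : π.map (Geo.eval 0) = uniformOn X A ρ := by
      rw [← hπ.2.1.1, Measure.map_map measurable_fst
        ((measurable_eval 0).prodMk (measurable_eval 1))]
      rfl
    have hA0 : ∀ᵐ γ ∂π, ((Geo.eval 0 γ : X) : ℝ × ℝ) ∈ A := by
      refine ae_of_ae_map (p := fun x : X => (x : ℝ × ℝ) ∈ A) (measurable_eval 0).aemeasurable ?_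
      rw [hm0]
      exact ae_mem_uniformOn hAc.measurableSet
    rw [Measure.map_apply (measurable_eval _) (measurable_subtype_coe hMm).compl]
    change ∀ᵐ γ ∂π, ((Geo.eval midTime γ : X) : ℝ × ℝ) ∈ M
    filter_upwards [hgeo π hπ, hA0] with γ hγ hγA
    have := eval_midTime_fst hγ.1 hγ.2
    have h1 := hγA.1
    simp only [hM, mem_ofPred_eq]
    rw [this, abs_le]
    exact ⟨by linarith [h1.1], by linarith [h1.2]⟩

/-! ### Failure of the curvature-dimension conditions -/

/-- The loss of area in a neck is of first order in `ρ`, the effect of the curvature of second order. -/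
lemma NeckAt.sub_lt_exp {ρ K : ℝ} (hρ : 0 < ρ) (hK : 16 * |K| * ρ < 1) :
    1 - ρ / 2 < Real.exp (-(8 * |K| * ρ ^ 2)) := by
  have h1 := Real.add_one_le_exp (-(8 * |K| * ρ ^ 2))
  nlinarith

/-- A neck contradicts the entropy inequality, if it is short compared to the curvature. -/
lemma NeckAt.not_isCDInfty {X : Set (ℝ × ℝ)} {c ρ K : ℝ} (h : NeckAt X c ρ)
    (hK : 16 * |K| * ρ < 1) : ¬ IsCDInfty (lebesgueOn X) K := by
  intro hCD
  have hρ := h.pos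
  have hρ1 := h.le
  have hσ := sigmaFinite_lebesgueOn h.measurableSet
  obtain ⟨A, B, M, hA, hB, hM, hmA, hmB, hmM, μ₀, μ₁, hP0, hP1, hμ₀, hμ₁, hb0, hb1, hs0, hs1, hW,
    hgeo⟩ := h.exists_measures
  obtain ⟨π, hπ, hent⟩ := hCD μ₀ μ₁ hP0 hP1 hb0 hb1 hs0 hs1
  have hπP := hπ.1
  have hmid := (hgeo π hπ).2
  have hPt : IsProbabilityMeasure (π.map (Geo.eval midTime)) :=
    Measure.isProbabilityMeasure_map (measurable_eval _).aemeasurable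
  have hv : 0 < 1 - ρ / 2 := by linarith
  have hlow := le_entInfty_of_concentrated hM hmid (by positivity : 0 < 2 * ρ * (1 - ρ / 2)) hmM
  have hup0 := entInfty_uniform_le hA (by positivity : 0 < 2 * ρ) (by linarith) hmA hμ₀
  have hup1 := entInfty_uniform_le hB (by positivity : 0 < 2 * ρ) (by linarith) hmB hμ₁
  have hW' : (W2sq μ₀ μ₁).toReal ≤ (8 * ρ) ^ 2 := ENNReal.toReal_le_of_le_ofReal (by positivity) hW
  have hW0 : 0 ≤ (W2sq μ₀ μ₁).toReal := ENNReal.toReal_nonneg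
  have hmain := hlow.trans (hent midTime)
  rw [coe_midTime] at hmain
  set L := -Real.log (2 * ρ)
  set W := (W2sq μ₀ μ₁).toReal
  have hhalf : (0 : EReal) ≤ ((1 / 2 : ℝ) : EReal) := by exact_mod_cast (by norm_num : (0 : ℝ) ≤ 1 / 2)
  have hbound : ((1 - 1 / 2 : ℝ) : EReal) * entInfty (lebesgueOn X) μ₀
      + ((1 / 2 : ℝ) : EReal) * entInfty (lebesgueOn X) μ₁
      - ((K / 2 * (1 / 2) * (1 - 1 / 2) * W : ℝ) : EReal)
      ≤ ((L - K / 8 * W : ℝ) : EReal) := by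
    have e1 : ((1 - 1 / 2 : ℝ) : EReal) * entInfty (lebesgueOn X) μ₀
        ≤ ((1 / 2 * L : ℝ) : EReal) := by
      rw [show (1 - 1 / 2 : ℝ) = 1 / 2 by norm_num, EReal.coe_mul]
      exact mul_le_mul_of_nonneg_left hup0 hhalf
    have e2 : ((1 / 2 : ℝ) : EReal) * entInfty (lebesgueOn X) μ₁ ≤ ((1 / 2 * L : ℝ) : EReal) := by
      rw [EReal.coe_mul]
      exact mul_le_mul_of_nonneg_left hup1 hhalf
    refine (EReal.sub_le_sub (add_le_add e1 e2) le_rfl).trans (le_of_eq ?_)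
    rw [← EReal.coe_add, ← EReal.coe_sub]
    congr 1; ring
  have hreal := hmain.trans hbound
  rw [EReal.coe_le_coe_iff, Real.log_mul (by positivity) hv.ne'] at hreal
  have hKW : -(K / 8 * W) ≤ 8 * |K| * ρ ^ 2 := by
    have h1 : -(K * W) ≤ |K| * W := by
      have := neg_abs_le K
      nlinarith
    have h2 : |K| * W ≤ |K| * (8 * ρ) ^ 2 := by gcongr
    linarith
  have hlog : -(8 * |K| * ρ ^ 2) ≤ Real.log (1 - ρ / 2) := by
    simp only [L] at hreal
    linarith
  rw [Real.le_log_iff_exp_le hv] at hlog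
  exact absurd (NeckAt.sub_lt_exp hρ hK) hlog.not_gt

/-- A neck contradicts the inequality of Rényi functionals for distortion coefficients that are
almost `1 / 2` at the midpoint, if it is short compared to the curvature. -/
lemma NeckAt.not_isCDWith {X : Set (ℝ × ℝ)} {c ρ K N : ℝ} (h : NeckAt X c ρ)
    (hK : 16 * |K| * ρ < 1) (hN : 1 ≤ N) {w : ℝ → ℝ → ℝ → ℝ≥0∞}
    (hw : ∀ N' θ : ℝ, 1 < N' → 0 < θ →
      ENNReal.ofReal (1 / 2 * Real.exp (-(|K| * θ ^ 2 / (8 * N')))) ≤ w N' (1 / 2) θ) :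
    ¬ IsCDWith w (lebesgueOn X) N := by
  intro hCD
  have hρ := h.pos
  have hρ1 := h.le
  have hσ := sigmaFinite_lebesgueOn h.measurableSet
  obtain ⟨A, B, M, hA, hB, hM, hmA, hmB, hmM, μ₀, μ₁, hP0, hP1, hμ₀, hμ₁, hb0, hb1, hs0, hs1, hW,
    hgeo⟩ := h.exists_measures
  obtain ⟨π, hπ, hcd⟩ := hCD μ₀ μ₁ hP0 hP1 hb0 hb1 hs0 hs1
  have hπP := hπ.1
  obtain ⟨hlen, hmid⟩ := hgeo π hπ
  have hPt : IsProbabilityMeasure (π.map (Geo.eval midTime)) :=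
    Measure.isProbabilityMeasure_map (measurable_eval _).aemeasurable
  -- The bounds at the midpoint need an exponent larger than `1`, and `N` may be equal to `1`.
  set n := N + 1 with hn
  have hn1 : 1 < n := by linarith
  have hn0 : 0 < n := by linarith
  have hv : 0 < 1 - ρ / 2 := by linarith
  set V := ENNReal.ofReal (2 * ρ) with hV
  have hV0 : V ≠ 0 := (ENNReal.ofReal_pos.2 (by positivity)).ne'
  set E := |K| * (8 * ρ) ^ 2 / (8 * n) with hE
  have hends := (measurable_eval (X := X) 0).prodMk (measurable_eval (X := X) 1)
  have hm0 : π.map (Geo.eval 0) = μ₀ := by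
    rw [← hπ.2.1.1, Measure.map_map measurable_fst hends]; rfl
  have hm1 : π.map (Geo.eval 1) = μ₁ := by
    rw [← hπ.2.1.2, Measure.map_map measurable_snd hends]; rfl
  have hd0 : ∀ᵐ γ ∂π, (lebesgueOn X).rnDeriv μ₀ (Geo.eval 0 γ) = V :=
    ae_of_ae_map (measurable_eval 0).aemeasurable
      (by rw [hm0]; exact rnDeriv_uniform hA hV0 ENNReal.ofReal_ne_top hμ₀)
  have hd1 : ∀ᵐ γ ∂π, (lebesgueOn X).rnDeriv μ₁ (Geo.eval 1 γ) = V :=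
    ae_of_ae_map (measurable_eval 1).aemeasurable
      (by rw [hm1]; exact rnDeriv_uniform hB hV0 ENNReal.ofReal_ne_top hμ₁)
  have hlow : ENNReal.ofReal (Real.exp (-E)) * V ^ (1 / n) ≤
      ENNReal.ofReal (2 * ρ * (1 - ρ / 2)) ^ (1 / n) := by
    calc ENNReal.ofReal (Real.exp (-E)) * V ^ (1 / n)
        = ∫⁻ _, ENNReal.ofReal (Real.exp (-E)) * V ^ (1 / n) ∂π := by
          rw [lintegral_const, measure_univ, mul_one]
      _ ≤ ∫⁻ γ, w n (1 - midTime) (dist (γ.eval 0) (γ.eval 1))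
            * invDensityPow (lebesgueOn X) n μ₀ (γ.eval 0)
          + w n midTime (dist (γ.eval 0) (γ.eval 1))
            * invDensityPow (lebesgueOn X) n μ₁ (γ.eval 1) ∂π := by
          refine lintegral_mono_ae ?_
          filter_upwards [hlen, hd0, hd1] with γ hγ h0 h1
          rw [hγ, invDensityPow, invDensityPow, h0, h1, coe_midTime,
            show (1 - 1 / 2 : ℝ) = 1 / 2 by norm_num, ← add_mul]
          gcongr
          refine le_trans (le_of_eq ?_) (add_le_add (hw n (8 * ρ) hn1 (by positivity))
            (hw n (8 * ρ) hn1 (by positivity)))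
          rw [← ENNReal.ofReal_add (by positivity) (by positivity)]
          congr 1; ring
      _ ≤ renyi (lebesgueOn X) n (π.map (Geo.eval midTime)) := hcd midTime n (by linarith)
      _ ≤ lebesgueOn X M ^ (1 / n) := renyi_le_of_concentrated hM hmid hn1
      _ ≤ ENNReal.ofReal (2 * ρ * (1 - ρ / 2)) ^ (1 / n) := by gcongr
  have hpow := ENNReal.rpow_le_rpow hlow hn0.le
  rw [ENNReal.mul_rpow_of_nonneg _ _ hn0.le, ← ENNReal.rpow_mul, ← ENNReal.rpow_mul,
    one_div_mul_cancel hn0.ne', ENNReal.rpow_one, ENNReal.rpow_one,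
    ENNReal.ofReal_rpow_of_nonneg (Real.exp_pos _).le hn0.le, hV,
    ← ENNReal.ofReal_mul (by positivity), ENNReal.ofReal_le_ofReal_iff (by positivity),
    ← Real.exp_mul] at hpow
  have hEn : -E * n = -(8 * |K| * ρ ^ 2) := by
    rw [hE]; field_simp
  rw [hEn] at hpow
  have := NeckAt.sub_lt_exp hρ hK
  nlinarith

lemma NeckAt.not_isCDStar {X : Set (ℝ × ℝ)} {c ρ K : ℝ} (h : NeckAt X c ρ)
    (hK : 16 * |K| * ρ < 1) {N : ℝ≥0∞} (hN : 1 ≤ N) : ¬ IsCDStar (lebesgueOn X) K N := by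
  rintro ⟨h1, h2⟩
  rcases eq_or_ne N ⊤ with hT | hT
  · exact h.not_isCDInfty hK (h1 hT)
  · refine h.not_isCDWith hK ?_ (fun N' θ hN' hθ => half_exp_le_sigmaCoeff (by linarith) hθ) (h2 hT)
    simpa using ENNReal.toReal_mono hT hN

lemma NeckAt.not_isCD {X : Set (ℝ × ℝ)} {c ρ K : ℝ} (h : NeckAt X c ρ)
    (hK : 16 * |K| * ρ < 1) {N : ℝ≥0∞} (hN : 1 ≤ N) : ¬ IsCD (lebesgueOn X) K N := by
  rintro ⟨h1, h2⟩
  rcases eq_or_ne N ⊤ with hT | hT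
  · exact h.not_isCDInfty hK (h1 hT)
  · refine h.not_isCDWith hK ?_ (fun N' θ hN' hθ => half_exp_le_tauCoeff hN' hθ) (h2 hT)
    simpa using ENNReal.toReal_mono hT hN

/-! ### The pieces of the strip -/

/-- The piece of the strip that contains the `n`-th disc in its middle. -/
def discPiece (n : ℕ) : Set (ℝ × ℝ) := discStrip (Icc (2 * n) (2 * n + 2))

/-- Near the `n`-th disc, only this disc matters. -/
lemma mem_discStrip_iff {I : Set ℝ} {n : ℕ} (hI : Icc (2 * n : ℝ) (2 * n + 2) ⊆ I) {p : ℝ × ℝ}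
    (hp : |p.1 - discX n| ≤ 1) : p ∈ discStrip I ↔ 0 ≤ p.2 ∧ p.2 ≤ 1 ∧ p ∈ discCompl n := by
  refine ⟨fun h => ⟨h.2.1, h.2.2.1, h.2.2.2 n⟩, fun ⟨h0, h1, hn⟩ => ⟨hI ?_, h0, h1, fun m => ?_⟩⟩
  · rw [abs_le, discX] at hp
    exact ⟨by linarith [hp.1], by linarith [hp.2]⟩
  · rcases eq_or_ne m n with rfl | hmn
    · exact hn
    · exact mem_discCompl_of_ne hmn (by linarith)

/-- The part of the strip next to a disc lies outside of the disc. -/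
lemma mem_discCompl_of_three_mul_le {n : ℕ} {p : ℝ × ℝ} (h : 3 * discH n ≤ |p.1 - discX n|)
    (h0 : 0 ≤ p.2) : p ∈ discCompl n := by
  have hs := discH_pos n
  have h1 : (3 * discH n) ^ 2 ≤ |p.1 - discX n| ^ 2 := by gcongr
  have h2 : (4 * discH n) ^ 2 ≤ (p.2 + 4 * discH n) ^ 2 := by gcongr; linarith
  rw [sq_abs] at h1
  simp only [discCompl, mem_ofPred_eq]
  nlinarith

lemma left_rectangle_subset {I : Set ℝ} {n : ℕ} (hI : Icc (2 * n : ℝ) (2 * n + 2) ⊆ I) :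
    Icc (discX n - 5 * discH n) (discX n - 3 * discH n) ×ˢ Icc (0 : ℝ) 1 ⊆ discStrip I := by
  have hs := discH_pos n
  have hs' := discH_le n
  rintro p ⟨h1, h2⟩
  have habs : |p.1 - discX n| = discX n - p.1 := by
    rw [abs_of_nonpos (by linarith [h1.2])]; ring
  exact (mem_discStrip_iff hI (by rw [habs]; linarith [h1.1])).2 ⟨h2.1, h2.2,
    mem_discCompl_of_three_mul_le (by rw [habs]; linarith [h1.2]) h2.1⟩

lemma right_rectangle_subset {I : Set ℝ} {n : ℕ} (hI : Icc (2 * n : ℝ) (2 * n + 2) ⊆ I) :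
    Icc (discX n + 3 * discH n) (discX n + 5 * discH n) ×ˢ Icc (0 : ℝ) 1 ⊆ discStrip I := by
  have hs := discH_pos n
  have hs' := discH_le n
  rintro p ⟨h1, h2⟩
  have habs : |p.1 - discX n| = p.1 - discX n := abs_of_nonneg (by linarith [h1.1])
  exact (mem_discStrip_iff hI (by rw [habs]; linarith [h1.2])).2 ⟨h2.1, h2.2,
    mem_discCompl_of_three_mul_le (by rw [habs]; linarith [h1.1]) h2.1⟩

/-- Over the interval of length `2 ρ` around its centre, the disc of radius `5 ρ` has height at least
`(√24 - 4) ρ ≥ ρ / 2`. -/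
lemma neckAt_discStrip {I : Set ℝ} (hIc : IsClosed I) {n : ℕ}
    (hI : Icc (2 * n : ℝ) (2 * n + 2) ⊆ I) : NeckAt (discStrip I) (discX n) (discH n) where
  measurableSet := (isClosed_discStrip hIc).measurableSet
  pos := discH_pos n
  le := discH_le n
  left_subset := left_rectangle_subset hI
  right_subset := right_rectangle_subset hI
  passage p hp hpc := by
    have hs := discH_pos n
    refine ⟨?_, hp.2.2.1⟩
    have h1 := hp.2.2.2 n
    simp only [discCompl, mem_ofPred_eq] at h1
    have h2 : |p.1 - discX n| ^ 2 ≤ discH n ^ 2 := by gcongr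
    rw [sq_abs] at h2
    have h0 := hp.2.1
    by_contra hcon
    push Not at hcon
    have h3 : (p.2 + 4 * discH n) ^ 2 ≤ (discH n / 2 + 4 * discH n) ^ 2 := by gcongr
    nlinarith

/-- The discs become arbitrarily small. -/
lemma exists_discH_small (K : ℝ) : ∃ n, 16 * |K| * discH n < 1 := by
  obtain ⟨n, hn⟩ := exists_nat_gt |K|
  refine ⟨n, ?_⟩
  rw [discH, mul_one_div, div_lt_one (by positivity)]
  linarith [abs_nonneg K]

lemma isCompact_discPiece (n : ℕ) : IsCompact (discPiece n) := by
  refine IsCompact.of_isClosed_subset (isCompact_Icc.prod isCompact_Icc)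
    (isClosed_discStrip isClosed_Icc) (fun p hp => ?_) (s := Icc (2 * n : ℝ) (2 * n + 2) ×ˢ Icc (0 : ℝ) 1)
  exact ⟨hp.1, hp.2.1, hp.2.2.1⟩

lemma not_convex_discPiece (n : ℕ) : ¬ Convex ℝ (discPiece n) := by
  intro h
  have hs := discH_pos n
  have h1 : (discX n - 3 * discH n, (0 : ℝ)) ∈ discPiece n :=
    left_rectangle_subset subset_rfl ⟨⟨by simp only; linarith, le_rfl⟩, le_rfl, zero_le_one⟩
  have h2 : (discX n + 3 * discH n, (0 : ℝ)) ∈ discPiece n :=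
    right_rectangle_subset subset_rfl ⟨⟨le_rfl, by simp only; linarith⟩, le_rfl, zero_le_one⟩
  have h3 := (h h1 h2 (by norm_num : (0 : ℝ) ≤ 1 / 2) (by norm_num : (0 : ℝ) ≤ 1 / 2)
    (by norm_num)).2.2.2 n
  simp only [discCompl, mem_ofPred_eq, Prod.smul_mk, Prod.mk_add_mk, smul_eq_mul] at h3
  ring_nf at h3
  nlinarith [pow_pos hs 2]

lemma hasCircularArc_discPiece (n : ℕ) : HasCircularArc (discPiece n) := by
  have hs := discH_pos n
  have hs' := discH_le n
  refine ⟨(discX n, -4 * discH n), (discX n, discH n), 5 * discH n, discH n / 2, by positivity,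
    by positivity, by simp only; ring, fun q hq => ?_⟩
  rw [Metric.mem_ball, Prod.dist_eq, max_lt_iff, Real.dist_eq, Real.dist_eq, abs_lt, abs_lt] at hq
  have hx : |q.1 - discX n| ≤ 1 := abs_le.2 ⟨by linarith [hq.1.1], by linarith [hq.1.2]⟩
  rw [discPiece, mem_discStrip_iff subset_rfl hx]
  have hy0 : 0 ≤ q.2 := by linarith [hq.2.1]
  have hy1 : q.2 ≤ 1 := by linarith [hq.2.2]
  simp only [hy0, hy1, true_and, discCompl, mem_ofPred_eq]
  rw [show q.2 - -4 * discH n = q.2 + 4 * discH n by ring]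

lemma hasNeck_discPiece (n : ℕ) : HasNeck (discPiece n) := by
  have hs := discH_pos n
  have hs' := discH_le n
  refine ⟨discX n - 5 * discH n, 8 * discH n, 2 * discH n, 0, 1, discX n, discH n, 1, by positivity,
    one_pos, by linarith, by linarith, by linarith, by linarith, ?_, ?_, ?_⟩
  · rw [show discX n - 5 * discH n + 2 * discH n = discX n - 3 * discH n by ring, zero_add]
    exact left_rectangle_subset subset_rfl
  · rw [show discX n - 5 * discH n + 8 * discH n = discX n + 3 * discH n by ring, zero_add,
      show discX n + 3 * discH n + 2 * discH n = discX n + 5 * discH n by ring]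
    exact right_rectangle_subset subset_rfl
  · ext p
    simp only [mem_ofPred_eq, mem_prod, mem_singleton_iff, mem_Icc]
    constructor
    · rintro ⟨hp, hx⟩
      refine ⟨hx, ?_, hp.2.2.1⟩
      have h1 := hp.2.2.2 n
      have h0 := hp.2.1
      simp only [discCompl, mem_ofPred_eq, hx, sub_self] at h1
      by_contra hcon
      push Not at hcon
      nlinarith
    · rintro ⟨hx, h1, h2⟩
      refine ⟨(mem_discStrip_iff subset_rfl (by rw [hx]; simp)).2 ⟨by linarith, h2, ?_⟩, hx⟩
      simp only [discCompl, mem_ofPred_eq, hx, sub_self]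
      nlinarith

lemma isNeckExample_discPiece {K : ℝ} {N : ℝ≥0∞} (hN : 1 ≤ N) {n : ℕ}
    (hK : 16 * |K| * discH n < 1) : IsNeckExample K N (discPiece n) where
  isCompact := isCompact_discPiece n
  not_convex := not_convex_discPiece n
  hasCircularArc := hasCircularArc_discPiece n
  hasNeck := hasNeck_discPiece n
  isGeodesic := isGeodesicSpace_discStrip ordConnected_Icc
  locally_cd := isCDLocally_discStrip ordConnected_Icc isClosed_Icc
  not_cdStar := (neckAt_discStrip isClosed_Icc subset_rfl).not_isCDStar hK hN
  not_cd := (neckAt_discStrip isClosed_Icc subset_rfl).not_isCD hK hN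

lemma iUnion_discPiece : ⋃ n, discPiece n = discStrip (Ici 0) := by
  ext p
  simp only [mem_iUnion]
  constructor
  · rintro ⟨n, hp⟩
    have : (0 : ℝ) ≤ 2 * n := by positivity
    exact ⟨this.trans hp.1.1, hp.2⟩
  · rintro ⟨hp, hp'⟩
    have hp0 : 0 ≤ p.1 / 2 := by have : 0 ≤ p.1 := hp; positivity
    have h1 := Nat.floor_le hp0
    have h2 := Nat.lt_floor_add_one (p.1 / 2)
    exact ⟨⌊p.1 / 2⌋₊, ⟨by linarith, by linarith⟩, hp'⟩

lemma discPiece_inter (n : ℕ) :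
    discPiece n ∩ discPiece (n + 1) = {(2 * ((n + 1 : ℕ) : ℝ))} ×ˢ Icc (0 : ℝ) 1 := by
  ext p
  simp only [mem_inter_iff, mem_prod, mem_singleton_iff]
  constructor
  · rintro ⟨⟨h1, h2, h3, -⟩, ⟨h4, -⟩⟩
    have h5 := h1.2
    have h6 := h4.1
    push_cast at h6 ⊢
    exact ⟨by linarith, h2, h3⟩
  · rintro ⟨hx, h0, h1⟩
    have hd : ∀ m, p ∈ discCompl m := fun m => by
      refine mem_discCompl_of_abs_le ?_
      -- The abscissa is an even integer, the centres have odd abscissae.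
      have e : p.1 - discX m = ((2 * (n - m : ℤ) + 1 : ℤ) : ℝ) := by
        rw [hx, discX]; push_cast; ring
      rw [e, ← Int.cast_abs]
      have : (1 : ℤ) ≤ |2 * ((n : ℤ) - m) + 1| := Int.one_le_abs (by omega)
      have : (1 : ℝ) ≤ ((|2 * ((n : ℤ) - m) + 1| : ℤ) : ℝ) := by exact_mod_cast this
      linarith
    push_cast at hx
    refine ⟨⟨⟨by linarith, by linarith⟩, h0, h1, hd⟩, ⟨⟨?_, ?_⟩, h0, h1, hd⟩⟩
    · push_cast; linarith
    · push_cast; linarith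

end

theorem mainTheorem1 :
    (∀ (K : ℝ) (N : ℝ≥0∞), 1 ≤ N → ∃ X : Set (ℝ × ℝ), IsNeckExample K N X) ∧
    (∃ (P : ℕ → Set (ℝ × ℝ)) (a c d : ℕ → ℝ),
      StrictMono a ∧
      (∀ n, ∃ (K : ℝ) (N : ℝ≥0∞), 1 ≤ N ∧ IsNeckExample K N (P n)) ∧
      (∀ n, P n ⊆ Icc (a n) (a (n + 1)) ×ˢ univ) ∧
      (∀ n, c n < d n ∧ P n ∩ P (n + 1) = {a (n + 1)} ×ˢ Icc (c n) (d n)) ∧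
      CompleteSpace (⋃ n, P n : Set (ℝ × ℝ)) ∧
      ¬ IsCompact (⋃ n, P n) ∧
      IsGeodesicSpace (⋃ n, P n : Set (ℝ × ℝ)) ∧
      IsCDLocally (lebesgueOn (⋃ n, P n)) 0 4 ∧
      ∀ (K : ℝ) (N : ℝ≥0∞), 1 ≤ N → ¬ IsCD (lebesgueOn (⋃ n, P n)) K N) := by
  refine ⟨fun K N hN => ?_, discPiece, fun n => 2 * n, fun _ => 0, fun _ => 1, ?_, fun n => ?_,
    fun n p hp => ⟨⟨hp.1.1, ?_⟩, mem_univ _⟩, fun n => ⟨one_pos, discPiece_inter n⟩, ?_⟩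
  · obtain ⟨n, hn⟩ := exists_discH_small K
    exact ⟨discPiece n, isNeckExample_discPiece hN hn⟩
  · intro m n hmn
    have : (m : ℝ) < n := by exact_mod_cast hmn
    simp only
    linarith
  -- For `K = 0` every disc is small enough.
  · exact ⟨0, ⊤, le_top, isNeckExample_discPiece le_top (by simp)⟩
  · have := hp.1.2
    push_cast
    linarith
  · rw [iUnion_discPiece]
    have hclosed := isClosed_discStrip (isClosed_Ici (a := (0 : ℝ)))
    refine ⟨hclosed.completeSpace_coe, fun hc => ?_, isGeodesicSpace_discStrip ordConnected_Ici,
      isCDLocally_discStrip ordConnected_Ici isClosed_Ici, fun K N hN => ?_⟩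
    · obtain ⟨C, hC⟩ := (hc.image continuous_fst).bddAbove
      obtain ⟨n, hn⟩ := exists_nat_gt C
      -- The strip contains all points of height `1`.
      have hmem : ((n : ℝ), (1 : ℝ)) ∈ discStrip (Ici 0) :=
        ⟨mem_Ici.2 (Nat.cast_nonneg n), zero_le_one, le_rfl,
          fun m => mem_discCompl_of_one_le le_rfl⟩
      exact absurd (hC ⟨_, hmem, rfl⟩) hn.not_ge
    -- For every `K`, one of the discs is small enough.
    · obtain ⟨n, hn⟩ := exists_discH_small K
      refine (neckAt_discStrip isClosed_Ici fun x hx => ?_).not_isCD hn hN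
      have : (0 : ℝ) ≤ 2 * n := by positivity
      exact this.trans hx.1
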